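/- Let $d\ge 1$, $m>0$, $T>0$, $C>0$ and $\psi\in\mathcal S(\mathbb R^d)$. There is a constant $A>0$, depending only on $d,m,T,C,\psi$, such that the following holds. Let $V:\mathbb R^d\to\mathbb R$ be bounded and continuous, and for each $\hbar\in(0,1]$ let $t\mapsto R_\hbar(t)$, $t\in[-T,T]$, be a family of density operators on $L^2(\mathbb R^d)$ (self-adjoint, nonnegative, of trace $1$) that is continuous on $[-T,T]$ for the weak operator topology, is a weak solution on $(-T,T)$ of the von Neumann equation $i\hbar\,\partial_tR_\hbar=[-\tfrac{\hbar^2}{2m}\Delta+V,R_\hbar]$ (in the sense of distributions: for all $\varphi,\chi\in C_c^\infty(\mathbb R^d)$ and $\mathcal H=-\tfrac{\hbar^2}{2m}\Delta+V$, $i\hbar\frac{d}{dt}\langle\varphi,R_\hbar\chi\rangle=\langle\mathcal H\varphi,R_\hbar\chi\rangle-\langle\varphi,R_\hbar\mathcal H\chi\rangle$ in $\mathcal D'((-T,T))$), and satisfies $$\sup_{|t|\le T}\operatorname{tr}(R_\hbar(t)^2)\le C^2(2\pi\hbar)^d .$$ Let $R_\hbar(t,X,Y)$ denote the integral kernel of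 $R_\hbar(t)$; it can be chosen measurably in $(t,X,Y)$. Let $$w_\hbar(t,x,v)=\frac1{(2\pi)^d}\int_{\mathbb R^d}e^{-iv\cdot y}R_\hbar\big(t,x+\tfrac\hbar2y,x-\tfrac\hbar2y\big)\,dy,\qquad \rho_\psi[w_\hbar](t,x)=\int_{\mathbb R^d}w_\hbar(t,x,v)\psi(v)\,dv .$$ Then, for every $\hbar\in(0,1]$, these integrals converge absolutely for every $t\in[-T,T]$ and almost every $x$, the velocity average $\rho_\psi[w_\hbar]$ belongs to $H^{1/2}((-T,T)\times\mathbb R^d)$, and $$\|\rho_\psi[w_\hbar]\|_{H^{1/2}((-T,T)\times\mathbb R^d)}\le A\,(1+\|V\|_{L^\infty})\,\hbar^{-1/2}.$$ In particular, if $V\not\equiv0$, then with $C'_T=A(1+1/\|V\|_{L^\infty})$, which depends neither on $\hbar$ nor on the family $R_\hbar$, $$\|\rho_\psi[w_\hbar]\|_{H^{1/2}((-T,T)\times\mathbb R^d)}\le C'_T\,\|V\|_{L^\infty}\,\hbar^{-1/2}.$$ Here, for $Q=(-T,T)\times\mathbb R^d$, $\|u\|_{H^{1/2}(Q)}^2=\int_Q|u|^2+\iint_{Q\times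 Q}\frac{|u(z)-u(z')|^2}{|z-z'|^{d+2}}\,dz\,dz'$. -/

import Mathlib

open MeasureTheory Set Topology InnerProductSpace
open scoped ENNReal ContDiff Distributions SchwartzMap BoundedContinuousFunction Laplacian

namespace QuantumAveraging

/-- The space `ℝ^d` with its Euclidean norm and Lebesgue measure. -/
abbrev Space (d : ℕ) : Type := EuclideanSpace ℝ (Fin d)

/-- The complex Hilbert space `L²(ℝ^d)`. -/
abbrev L2 (d : ℕ) : Type := Lp ℂ 2 (volume : Measure (Space d))

/-! ### Density operators -/

/-- The bounded operator `A` is of trace class with trace `τ`: its diagonal sums to `τ` in every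
Hilbert basis. -/
def HasTrace {d : ℕ} (A : L2 d →L[ℂ] L2 d) (τ : ℂ) : Prop :=
  ∀ (ι : Type) (b : HilbertBasis ι ℂ (L2 d)), HasSum (fun i => ⟪b i, A (b i)⟫_ℂ) τ

/-- Density operators: self-adjoint, nonnegative, of trace one. -/
def IsDensityOperator {d : ℕ} (R : L2 d →L[ℂ] L2 d) : Prop :=
  R.IsPositive ∧ HasTrace R 1

/-- `tr (R²) ≤ B`. -/
def TraceSqLe {d : ℕ} (R : L2 d →L[ℂ] L2 d) (B : ℝ) : Prop :=
  ∃ τ : ℝ, HasTrace (R ∘L R) (τ : ℂ) ∧ τ ≤ B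

/-! ### The von Neumann equation -/

/-- The Hamilton operator `-(ħ²/2m) Δ + V`, acting on functions. -/
noncomputable def hamiltonian {d : ℕ} (m ħ : ℝ) (V : Space d →ᵇ ℝ) (φ : Space d → ℂ) :
    Space d → ℂ :=
  fun x => -((ħ ^ 2 / (2 * m) : ℝ) : ℂ) * (Δ φ) x + (V x : ℂ) * φ x

theorem memLp_test {d : ℕ} (φ : 𝓓((⊤ : TopologicalSpace.Opens (Space d)), ℂ)) :
    MemLp (φ : Space d → ℂ) 2 volume :=
  φ.continuous.memLp_of_hasCompactSupport φ.hasCompactSupport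

theorem memLp_hamiltonian {d : ℕ} (m ħ : ℝ) (V : Space d →ᵇ ℝ)
    (φ : 𝓓((⊤ : TopologicalSpace.Opens (Space d)), ℂ)) :
    MemLp (hamiltonian m ħ V φ) 2 volume := by
  have hc : ContDiff ℝ ∞ (φ : Space d → ℂ) := φ.contDiff
  have h2 : Continuous (iteratedFDeriv ℝ 2 (φ : Space d → ℂ)) :=
    hc.continuous_iteratedFDeriv (by norm_cast)
  have hs : HasCompactSupport (iteratedFDeriv ℝ 2 (φ : Space d → ℂ)) :=
    φ.hasCompactSupport.iteratedFDeriv 2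
  have hΔ : Δ (φ : Space d → ℂ) = fun x => ∑ i, iteratedFDeriv ℝ 2 (φ : Space d → ℂ) x
      ![stdOrthonormalBasis ℝ (Space d) i, stdOrthonormalBasis ℝ (Space d) i] :=
    laplacian_eq_iteratedFDeriv_stdOrthonormalBasis _
  have hΔc : Continuous (Δ (φ : Space d → ℂ)) := by
    rw [hΔ]
    exact continuous_finsetSum _ fun i _ =>
      (ContinuousMultilinearMap.apply ℝ (fun _ : Fin 2 => Space d) ℂ _).continuous.comp h2
  have hΔs : HasCompactSupport (Δ (φ : Space d → ℂ)) := by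
    refine hs.mono fun x hx => ?_
    rw [Function.mem_support] at hx ⊢
    intro h0
    apply hx
    rw [hΔ]
    simp [h0]
  have hA : HasCompactSupport
      (fun x => -((ħ ^ 2 / (2 * m) : ℝ) : ℂ) * (Δ (φ : Space d → ℂ)) x) :=
    hΔs.mul_left (f := fun _ => -((ħ ^ 2 / (2 * m) : ℝ) : ℂ))
  have hB : HasCompactSupport (fun x => (V x : ℂ) * φ x) :=
    φ.hasCompactSupport.mul_left (f := fun x => (V x : ℂ))
  have hVc : Continuous fun x => (V x : ℂ) := Complex.continuous_ofReal.comp V.continuous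
  exact ((continuous_const.mul hΔc).memLp_of_hasCompactSupport hA).add
    ((hVc.mul φ.continuous).memLp_of_hasCompactSupport hB)

/-- A test function as a vector of `L²(ℝ^d)`. -/
noncomputable def testVec {d : ℕ} (φ : 𝓓((⊤ : TopologicalSpace.Opens (Space d)), ℂ)) : L2 d :=
  (memLp_test φ).toLp _

/-- The Hamilton operator applied to a test function, as a vector of `L²(ℝ^d)`. -/
noncomputable def hamVec {d : ℕ} (m ħ : ℝ) (V : Space d →ᵇ ℝ)
    (φ : 𝓓((⊤ : TopologicalSpace.Opens (Space d)), ℂ)) : L2 d :=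
  (memLp_hamiltonian m ħ V φ).toLp _

/-- The open time interval `(-T, T)`. -/
def timeInterval (T : ℝ) : TopologicalSpace.Opens ℝ := ⟨Ioo (-T) T, isOpen_Ioo⟩

/-- Weak solutions on `(-T, T)` of `iħ ∂ₜ R = [H, R]`, `H = -(ħ²/2m) Δ + V`: for all test functions
`φ, χ` of `x`, the equation `iħ d/dt ⟨φ, R χ⟩ = ⟨H φ, R χ⟩ - ⟨φ, R H χ⟩` holds in `𝓓'((-T, T))`. -/
def IsWeakSolution {d : ℕ} (m ħ T : ℝ) (V : Space d →ᵇ ℝ) (R : ℝ → L2 d →L[ℂ] L2 d) : Prop :=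
  ∀ (φ χ : 𝓓((⊤ : TopologicalSpace.Opens (Space d)), ℂ)) (η : 𝓓(timeInterval T, ℂ)),
    -(Complex.I * (ħ : ℂ)) * ∫ t in Ioo (-T) T, deriv η t * ⟪testVec φ, R t (testVec χ)⟫_ℂ =
      ∫ t in Ioo (-T) T, η t * (⟪hamVec m ħ V φ, R t (testVec χ)⟫_ℂ -
        ⟪testVec φ, R t (hamVec m ħ V χ)⟫_ℂ)

/-- Continuity on `[-T, T]` for the weak operator topology. -/
def IsWOTContinuous {d : ℕ} (T : ℝ) (R : ℝ → L2 d →L[ℂ] L2 d) : Prop :=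
  ContinuousOn (fun t => (ContinuousLinearMapWOT.ofCLM (R t) : L2 d →WOT[ℂ] L2 d)) (Icc (-T) T)

/-! ### Density matrices, Wigner functions and velocity averages -/

/-- The function `k ∈ L²(ℝ^d × ℝ^d)` is the integral kernel of the operator `R`. -/
def IsIntegralKernel {d : ℕ} (R : L2 d →L[ℂ] L2 d) (k : Space d × Space d → ℂ) : Prop :=
  MemLp k 2 volume ∧ ∀ φ : L2 d, ∀ᵐ X, R φ X = ∫ Y, k (X, Y) * φ Y

/-- `k t` is a density matrix (integral kernel) of `R t` for every `t ∈ [-T, T]`, chosen measurably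
in all variables `(t, X, Y)`. -/
def IsDensityMatrix {d : ℕ} (T : ℝ) (R : ℝ → L2 d →L[ℂ] L2 d)
    (k : ℝ → Space d × Space d → ℂ) : Prop :=
  AEStronglyMeasurable (fun p : ℝ × (Space d × Space d) => k p.1 p.2)
      ((volume.restrict (Icc (-T) T)).prod volume) ∧
    ∀ t ∈ Icc (-T) T, IsIntegralKernel (R t) (k t)

/-- The density matrix in the variables `x = (X + Y)/2`, `y = (X - Y)/ħ`. -/
noncomputable def weylKernel {d : ℕ} (ħ : ℝ) (k : Space d × Space d → ℂ) (x y : Space d) : ℂ :=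
  k (x + (ħ / 2) • y, x - (ħ / 2) • y)

/-- The Wigner transform `w(x, v) = (2π)^{-d} ∫ e^{-i v·y} k(x + ħy/2, x - ħy/2) dy`. -/
noncomputable def wigner {d : ℕ} (ħ : ℝ) (k : Space d × Space d → ℂ) (x v : Space d) : ℂ :=
  (1 / (2 * Real.pi) ^ d : ℝ) *
    ∫ y : Space d, Complex.exp (-Complex.I * ((⟪v, y⟫_ℝ : ℝ) : ℂ)) * weylKernel ħ k x y

/-- The velocity average `ρ_ψ[w](t, x) = ∫ w(t, x, v) ψ(v) dv`. -/
noncomputable def velocityAverage {d : ℕ} (ħ : ℝ) (ψ : 𝓢(Space d, ℂ))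
    (k : ℝ → Space d × Space d → ℂ) : ℝ × Space d → ℂ :=
  fun z => ∫ v : Space d, wigner ħ (k z.1) z.2 v * ψ v

/-- For every `t ∈ [-T, T]` and almost every `x`, the integrals that define the Wigner function and
its velocity average converge absolutely. -/
def AverageConverges {d : ℕ} (T ħ : ℝ) (ψ : 𝓢(Space d, ℂ))
    (k : ℝ → Space d × Space d → ℂ) : Prop :=
  ∀ t ∈ Icc (-T) T, ∀ᵐ x : Space d,
    Integrable (fun y : Space d => weylKernel ħ (k t) x y) ∧
      Integrable (fun v : Space d => wigner ħ (k t) x v * ψ v)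

/-! ### The Sobolev space `H^{1/2}` on subsets of space-time -/

/-- The space-time slab `(-T, T) × ℝ^d`. -/
def slab (T : ℝ) (d : ℕ) : Set (ℝ × Space d) := Ioo (-T) T ×ˢ univ

/-- The norm of `H^{1/2}(Q)`, `Q ⊆ ℝ × ℝ^d`, with values in `[0, ∞]`:
`‖u‖² = ∫_Q |u|² + ∬_{Q×Q} |u(z) - u(z')|² / |z - z'|^{(d+1) + 2·(1/2)} dz dz'`,
where `|z - z'|² = |t - t'|² + |x - x'|²` for `z = (t, x)`, `z' = (t', x')`. -/
noncomputable def sobolevHalfNorm {d : ℕ} (Q : Set (ℝ × Space d)) (u : ℝ × Space d → ℂ) : ℝ≥0∞ :=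
  ((∫⁻ z in Q, ‖u z‖ₑ ^ 2) +
    ∫⁻ z in Q, ∫⁻ z' in Q, ‖u z - u z'‖ₑ ^ 2 /
      ENNReal.ofReal (((z.1 - z'.1) ^ 2 + ‖z.2 - z'.2‖ ^ 2) ^ (((d : ℝ) + 2) / 2))) ^ (1 / 2 : ℝ)

/-- Membership in `H^{1/2}(Q)`. -/
def MemSobolevHalf {d : ℕ} (Q : Set (ℝ × Space d)) (u : ℝ × Space d → ℂ) : Prop :=
  AEStronglyMeasurable u (volume.restrict Q) ∧ sobolevHalfNorm Q u < ⊤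

end QuantumAveraging

namespace QuantumAveraging
open Filter ComplexConjugate FourierTransform

/-! A density operator is Hilbert–Schmidt, and its kernel κ(t) satisfies ‖κ(t)‖² = tr R(t)² ≤ M²,
where M² = C²(2πħ)^d. Conjugating R(t) by the free evolution and passing to the momentum
representation gives a kernel F(t) of the same norm. The kinetic energy cancels in its equation and
only the commutator with V survives, so F is Lipschitz in time with constant 2‖V‖M/ħ
(`lipschitz_interaction`).

In Fourier variables the velocity average at (t, ξ) is the integral over p of F(t)(p, p - ξ) against
ψ(v) exp(-2πi t v·ξ/m), with v = 2πħ(p - ξ/2) (`InteractionData.fourier_positionAverage`,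
`momentumWeight_freeRate`). For a frozen F this is a solution of free transport, and classical
velocity averaging applies. By a TT* argument (`lintegral_oscillation_le`) the L² norm in time is
governed by the Fourier transform of |ψ|² on the line spanned by ξ, whose integral along that line
is of order 1/|ξ|. This is the gain of half a derivative, with the Jacobian (2πħ)^(-d) as the only
dependence on ħ (`exists_dispersion_bound`). The same bound for increments in time carries an extra
factor min(1, |r||ξ|)² (`exists_increment_bound`). Integrating against the singular weights in h and
r gives frozen bounds on the two halves of the Gagliardo seminorm (`exists_free_shift_bound`,
`exists_free_increment_bound`).

The true F moves with t. A chaining argument over dyadic refinements of a grid with N cells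
(`lintegral_varying_le`) carries a frozen bound over to F(t), and replaces ‖F‖² by a multiple of N
M² + (GT)²/N, where G is a Lipschitz constant of F. With G of order M(1 + ‖V‖)/ħ and N of order 1/ħ
both terms are at most of order M²(1 + ‖V‖)²/ħ. The factor (2πħ)^d in M² cancels the Jacobian, and a
square root gives the power ħ^(-1/2). Time differences also contain the contribution of F(t') -
F(t), which is handled by boundedness for long times and the Lipschitz bound for short ones. -/

/-- The Hilbert space of square-integrable kernels. -/
abbrev KernelSpace (d : ℕ) : Type := Lp ℂ 2 (volume : Measure (Space d × Space d))

/-! ### Cauchy–Schwarz and squared L² norms as lower integrals -/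

section CauchySchwarz
variable {α : Type*} [MeasurableSpace α] {μ : Measure α}

/-- The Cauchy–Schwarz inequality for lower integrals. -/
theorem lintegral_mul_sq_le {f g : α → ℝ≥0∞} (hf : AEMeasurable f μ) (hg : AEMeasurable g μ) :
    (∫⁻ x, f x * g x ∂μ) ^ 2 ≤ (∫⁻ x, f x ^ 2 ∂μ) * ∫⁻ x, g x ^ 2 ∂μ := by
  have h := ENNReal.lintegral_mul_le_Lp_mul_Lq μ Real.HolderConjugate.two_two hf hg
  have h2 : ∀ a : ℝ≥0∞, (a ^ (1 / 2 : ℝ)) ^ 2 = a := fun a => by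
    rw [← ENNReal.rpow_natCast, ← ENNReal.rpow_mul]; norm_num
  calc (∫⁻ x, f x * g x ∂μ) ^ 2 ≤ _ := pow_le_pow_left' h 2
    _ = _ := by
      rw [mul_pow, h2, h2]
      simp only [← ENNReal.rpow_natCast, Nat.cast_ofNat]

/-- The Cauchy–Schwarz inequality for integrals of products. -/
theorem enorm_integral_mul_sq_le {f g : α → ℂ} (hf : AEStronglyMeasurable f μ)
    (hg : AEStronglyMeasurable g μ) :
    ‖∫ x, f x * g x ∂μ‖ₑ ^ 2 ≤ (∫⁻ x, ‖f x‖ₑ ^ 2 ∂μ) * ∫⁻ x, ‖g x‖ₑ ^ 2 ∂μ := by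
  refine le_trans (pow_le_pow_left' (enorm_integral_le_lintegral_enorm _) 2) ?_
  simp_rw [enorm_mul]
  exact lintegral_mul_sq_le hf.enorm hg.enorm

theorem memLp_two_iff {f : α → ℂ} :
    MemLp f 2 μ ↔ AEStronglyMeasurable f μ ∧ ∫⁻ x, ‖f x‖ₑ ^ 2 ∂μ < ⊤ := by
  rw [MemLp, eLpNorm_lt_top_iff_lintegral_rpow_enorm_lt_top (by norm_num) (by norm_num)]
  simp only [ENNReal.toReal_ofNat, ENNReal.rpow_ofNat]

theorem lintegral_enorm_sq_eq (f : Lp ℂ 2 μ) : ∫⁻ x, ‖f x‖ₑ ^ 2 ∂μ = ‖f‖ₑ ^ 2 := by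
  rw [Lp.enorm_def, eLpNorm_eq_lintegral_rpow_enorm_toReal (by norm_num) (by norm_num),
    ← ENNReal.rpow_natCast, ← ENNReal.rpow_mul]
  norm_num

end CauchySchwarz

/-! ### Rank-one kernels in L² of the product space -/

section Tensor
variable {d : ℕ}

theorem memLp_tensor (f g : L2 d) :
    MemLp (fun z : Space d × Space d => f z.1 * conj (g z.2)) 2 volume := by
  have hf := Lp.memLp f
  have hg : MemLp (fun y => conj (g y)) 2 volume := (Lp.memLp g).star
  refine ⟨(hf.1.comp_fst).mul (hg.1.comp_snd), ?_⟩
  have h2 : (2 : ℝ≥0∞) ≠ 0 := by norm_num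
  have h2' : (2 : ℝ≥0∞) ≠ ⊤ := by norm_num
  rw [eLpNorm_lt_top_iff_lintegral_rpow_enorm_lt_top h2 h2']
  have hf' := (eLpNorm_lt_top_iff_lintegral_rpow_enorm_lt_top h2 h2').1 hf.2
  have hg' := (eLpNorm_lt_top_iff_lintegral_rpow_enorm_lt_top h2 h2').1 hg.2
  have : ∀ z : Space d × Space d, ‖f z.1 * conj (g z.2)‖ₑ ^ (2 : ℝ≥0∞).toReal =
      ‖f z.1‖ₑ ^ (2 : ℝ≥0∞).toReal * ‖conj (g z.2)‖ₑ ^ (2 : ℝ≥0∞).toReal := fun z => by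
    rw [enorm_mul, ENNReal.mul_rpow_of_nonneg _ _ (by norm_num)]
  simp_rw [this]
  rw [Measure.volume_eq_prod, lintegral_prod_mul (hf.1.enorm.pow_const _)
    (hg.1.enorm.pow_const _)]
  exact ENNReal.mul_lt_top hf' hg'

/-- The kernel `f(X) conj(g(Y))` of the rank-one operator `|f⟩⟨g|`. -/
noncomputable def tens (f g : L2 d) : KernelSpace d := (memLp_tensor f g).toLp _

theorem coeFn_tens (f g : L2 d) :
    tens f g =ᵐ[volume] fun z : Space d × Space d => f z.1 * conj (g z.2) :=
  (memLp_tensor f g).coeFn_toLp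

theorem inner_tens (a b c e : L2 d) : ⟪tens a b, tens c e⟫_ℂ = ⟪a, c⟫_ℂ * ⟪e, b⟫_ℂ := by
  rw [L2.inner_def, L2.inner_def, L2.inner_def]
  simp_rw [RCLike.inner_apply]
  rw [← integral_prod_mul (μ := volume) (ν := volume)]
  refine integral_congr_ae ?_
  filter_upwards [coeFn_tens a b, coeFn_tens c e] with z h1 h2
  rw [h1, h2]
  simp only [map_mul, RCLike.conj_conj]
  ring

theorem norm_tens (a b : L2 d) : ‖tens a b‖ = ‖a‖ * ‖b‖ := by
  have h : ((‖tens a b‖ : ℂ)) ^ 2 = ((‖a‖ * ‖b‖ : ℝ) : ℂ) ^ 2 := by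
    have := inner_self_eq_norm_sq_to_K (𝕜 := ℂ) (tens a b)
    rw [inner_tens, inner_self_eq_norm_sq_to_K, inner_self_eq_norm_sq_to_K] at this
    simp only [Complex.coe_algebraMap] at this
    rw [← this]
    push_cast
    ring
  have h' : ‖tens a b‖ ^ 2 = (‖a‖ * ‖b‖) ^ 2 := by exact_mod_cast h
  exact (sq_eq_sq₀ (norm_nonneg _) (by positivity)).1 h'

theorem tens_add_left (a a' b : L2 d) : tens (a + a') b = tens a b + tens a' b := by
  refine Lp.ext ?_
  have h := (Measure.quasiMeasurePreserving_fst (μ := (volume : Measure (Space d)))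
    (ν := (volume : Measure (Space d)))).ae (Lp.coeFn_add a a')
  filter_upwards [coeFn_tens (a + a') b, coeFn_tens a b, coeFn_tens a' b,
    Lp.coeFn_add (tens a b) (tens a' b), h] with z h1 h2 h3 h4 h5
  rw [h1, h4, Pi.add_apply, h2, h3, h5, Pi.add_apply]
  ring

theorem tens_add_right (a b b' : L2 d) : tens a (b + b') = tens a b + tens a b' := by
  refine Lp.ext ?_
  have h := (Measure.quasiMeasurePreserving_snd (μ := (volume : Measure (Space d)))
    (ν := (volume : Measure (Space d)))).ae (Lp.coeFn_add b b')
  filter_upwards [coeFn_tens a (b + b'), coeFn_tens a b, coeFn_tens a b',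
    Lp.coeFn_add (tens a b) (tens a b'), h] with z h1 h2 h3 h4 h5
  rw [h1, h4, Pi.add_apply, h2, h3, h5, Pi.add_apply]
  simp only [map_add]
  ring

theorem tens_sub_left (a a' b : L2 d) : tens (a - a') b = tens a b - tens a' b := by
  rw [eq_sub_iff_add_eq, ← tens_add_left, sub_add_cancel]

theorem tens_sub_right (a b b' : L2 d) : tens a (b - b') = tens a b - tens a b' := by
  rw [eq_sub_iff_add_eq, ← tens_add_right, sub_add_cancel]

/-- The product formula for the norm controls a telescoped difference. Continuity in both vectors
jointly is what lets identities between kernels be checked on dense sets of vectors. -/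
theorem continuous_tens : Continuous fun p : L2 d × L2 d => tens p.1 p.2 := by
  rw [continuous_iff_continuousAt]
  rintro ⟨a, b⟩
  rw [ContinuousAt, tendsto_iff_norm_sub_tendsto_zero]
  have h : ∀ p : L2 d × L2 d, ‖tens p.1 p.2 - tens a b‖ ≤
      ‖p.1 - a‖ * ‖p.2‖ + ‖a‖ * ‖p.2 - b‖ := fun p => by
    rw [← norm_tens, ← norm_tens, tens_sub_left, tens_sub_right]
    refine le_trans (le_of_eq ?_) (norm_add_le _ _)
    congr 1
    abel
  refine squeeze_zero (fun _ => norm_nonneg _) h ?_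
  have : Continuous fun p : L2 d × L2 d => ‖p.1 - a‖ * ‖p.2‖ + ‖a‖ * ‖p.2 - b‖ := by fun_prop
  simpa using this.tendsto (a, b)

/-- Fubini: pairing with a rank-one kernel reads off a matrix element of the integral operator with
kernel k. -/
theorem inner_tens_eq_integral (a b : L2 d) (k : KernelSpace d) :
    ⟪tens a b, k⟫_ℂ = ∫ X, conj (a X) * ∫ Y, k (X, Y) * b Y := by
  have hi : Integrable (fun z : Space d × Space d => conj (a z.1) * (k z * b z.2)) volume := by
    refine (L2.integrable_inner (𝕜 := ℂ) (tens a b) k).congr ?_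
    filter_upwards [coeFn_tens a b] with z h
    rw [RCLike.inner_apply, h]
    simp
    ring
  calc ⟪tens a b, k⟫_ℂ = ∫ z : Space d × Space d, conj (a z.1) * (k z * b z.2) := by
        rw [L2.inner_def]
        refine integral_congr_ae ?_
        filter_upwards [coeFn_tens a b] with z h
        rw [RCLike.inner_apply, h]
        simp
        ring
    _ = ∫ X, ∫ Y, conj (a X) * (k (X, Y) * b Y) := by
        exact integral_prod _ hi
    _ = _ := by simp_rw [integral_const_mul]

/-- Almost every slice of a square-integrable kernel is square integrable. -/
theorem ae_memLp_slice {k : Space d × Space d → ℂ} (hk : MemLp k 2 volume) :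
    ∀ᵐ X, MemLp (fun Y => k (X, Y)) 2 volume := by
  have h2 : (2 : ℝ≥0∞) ≠ 0 := by norm_num
  have h2' : (2 : ℝ≥0∞) ≠ ⊤ := by norm_num
  have h := (eLpNorm_lt_top_iff_lintegral_rpow_enorm_lt_top h2 h2').1 hk.2
  rw [Measure.volume_eq_prod, lintegral_prod _ (hk.1.enorm.pow_const _)] at h
  have hk1 : AEStronglyMeasurable k (volume.prod volume) := hk.1
  have h1 := ae_lt_top' (hk1.enorm.pow_const _).lintegral_prod_right' h.ne
  filter_upwards [h1, hk1.prodMk_left] with X hX hX'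
  exact ⟨hX', (eLpNorm_lt_top_iff_lintegral_rpow_enorm_lt_top h2 h2').2 hX⟩

/-- A kernel that annihilates a dense set of vectors vanishes. -/
theorem ae_eq_zero_of_forall_integral_mul_eq_zero {k : Space d × Space d → ℂ}
    (hk : MemLp k 2 volume) (h : ∀ b : L2 d, ∀ᵐ X, ∫ Y, k (X, Y) * b Y = 0) :
    k =ᵐ[volume] 0 := by
  have hne : (2 : ℝ≥0∞) ≠ ⊤ := by norm_num
  have : Fact ((2 : ℝ≥0∞) ≠ ⊤) := ⟨hne⟩
  have : TopologicalSpace.SeparableSpace (L2 d) := inferInstance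
  -- Separability of L² is essential here: the exceptional null set in the hypothesis depends on b,
  -- and only countably many of them can be united.
  have hall : ∀ᵐ X, ∀ n, ∫ Y, k (X, Y) * (TopologicalSpace.denseSeq (L2 d) n) Y = 0 :=
    ae_all_iff.2 fun n => h _
  have hs : ∀ᵐ X, ∀ᵐ Y, k (X, Y) = 0 := by
    filter_upwards [hall, ae_memLp_slice hk] with X hX hX'
    have hst : MemLp (fun Y => conj (k (X, Y))) 2 volume := hX'.star
    set s : L2 d := hst.toLp _ with hs
    have hz : ∀ n, ⟪s, TopologicalSpace.denseSeq (L2 d) n⟫_ℂ = 0 := fun n => by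
      rw [L2.inner_def, ← hX n]
      refine integral_congr_ae ?_
      filter_upwards [hst.coeFn_toLp] with Y hY
      rw [RCLike.inner_apply, hs, hY, RCLike.conj_conj, mul_comm]
    have hz' : ∀ b : L2 d, ⟪s, b⟫_ℂ = 0 := fun b => by
      refine (TopologicalSpace.denseRange_denseSeq (L2 d)).induction_on b ?_ hz
      exact isClosed_eq (by fun_prop) continuous_const
    have hs0 : s = 0 := by simpa using hz' s
    have := hst.coeFn_toLp
    rw [← hs, hs0] at this
    filter_upwards [this, Lp.coeFn_zero ℂ 2 (volume : Measure (Space d))] with Y h1 h2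
    rw [h2] at h1
    simpa using h1.symm
  have hk1 : AEStronglyMeasurable k (volume.prod volume) := hk.1
  rw [Measure.volume_eq_prod]
  -- Slicewise vanishing gives vanishing on the product only for a measurable zero set, so a
  -- measurable representative replaces k.
  obtain ⟨k', hk', hkk'⟩ := hk1
  have hms : MeasurableSet {z | k' z = 0} := hk'.measurable (measurableSet_singleton 0)
  have : ∀ᵐ z ∂(volume.prod volume : Measure (Space d × Space d)), k' z = 0 := by
    rw [Measure.ae_prod_iff_ae_ae hms]
    filter_upwards [hs, Measure.ae_ae_of_ae_prod hkk'] with X h1 h2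
    filter_upwards [h1, h2] with Y h3 h4
    exact h4.symm.trans h3
  filter_upwards [this, hkk'] with z h1 h2
  rw [h2, h1]
  rfl

theorem aestronglyMeasurable_integral_mul {k : Space d × Space d → ℂ} (hk : MemLp k 2 volume)
    (b : L2 d) : AEStronglyMeasurable (fun X => ∫ Y, k (X, Y) * b Y) volume := by
  have hk1 : AEStronglyMeasurable k (volume.prod volume) := hk.1
  have : AEStronglyMeasurable (fun z : Space d × Space d => k z * b z.2)
    (volume.prod volume) := hk1.mul (Lp.memLp b).1.comp_snd
  exact this.integral_prod_right'

theorem memLp_integral_mul {k : Space d × Space d → ℂ} (hk : MemLp k 2 volume) (b : L2 d) :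
    MemLp (fun X => ∫ Y, k (X, Y) * b Y) 2 volume := by
  refine memLp_two_iff.2 ⟨aestronglyMeasurable_integral_mul hk b, ?_⟩
  have hk1 : AEStronglyMeasurable k (volume.prod volume) := hk.1
  calc ∫⁻ X, ‖∫ Y, k (X, Y) * b Y‖ₑ ^ 2
      ≤ ∫⁻ X, (∫⁻ Y, ‖k (X, Y)‖ₑ ^ 2) * ‖b‖ₑ ^ 2 := by
        refine lintegral_mono_ae ?_
        filter_upwards [hk1.prodMk_left] with X hX
        rw [← lintegral_enorm_sq_eq]
        exact enorm_integral_mul_sq_le hX (Lp.memLp b).1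
    _ = (∫⁻ z, ‖k z‖ₑ ^ 2) * ‖b‖ₑ ^ 2 := by
        rw [lintegral_mul_const' _ _ (by finiteness), Measure.volume_eq_prod,
          lintegral_prod _ (hk1.enorm.pow_const _)]
    _ < ⊤ := ENNReal.mul_lt_top (memLp_two_iff.1 hk).2 (by finiteness)

/-- Rank-one kernels are total. -/
theorem eq_zero_of_forall_inner_tens {k : KernelSpace d} (h : ∀ a b, ⟪tens a b, k⟫_ℂ = 0) :
    k = 0 := by
  have hk := Lp.memLp k
  have : (k : Space d × Space d → ℂ) =ᵐ[volume] 0 := by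
    refine ae_eq_zero_of_forall_integral_mul_eq_zero hk fun b => ?_
    set F : L2 d := (memLp_integral_mul hk b).toLp _ with hF
    have h0 : ∀ a : L2 d, ⟪a, F⟫_ℂ = 0 := fun a => by
      rw [← h a b, inner_tens_eq_integral, L2.inner_def]
      refine integral_congr_ae ?_
      filter_upwards [(memLp_integral_mul hk b).coeFn_toLp] with X hX
      rw [RCLike.inner_apply, hF, hX, mul_comm]
    have hF0 : F = 0 := by simpa using h0 F
    have h1 := (memLp_integral_mul hk b).coeFn_toLp
    rw [← hF, hF0] at h1
    filter_upwards [h1, Lp.coeFn_zero ℂ 2 (volume : Measure (Space d))] with X h2 h3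
    rw [← h2, h3]
    rfl
  exact (Lp.eq_zero_iff_ae_eq_zero).2 this

end Tensor

/-! ### Spectral-type decomposition and Hilbert–Schmidt kernels of density operators -/

section DensityOperators
variable {d : ℕ}

theorem _root_.ContinuousLinearMap.IsPositive.exists_sqrt {H : Type*} [NormedAddCommGroup H]
    [InnerProductSpace ℂ H] [CompleteSpace H] {R : H →L[ℂ] H} (hR : R.IsPositive) :
    ∃ S : H →L[ℂ] H, S.IsPositive ∧ ∀ x, S (S x) = R x := by
  have hR0 : 0 ≤ R := (ContinuousLinearMap.nonneg_iff_isPositive R).2 hR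
  refine ⟨CFC.sqrt R,
    (ContinuousLinearMap.nonneg_iff_isPositive _).1 (CFC.sqrt_nonneg R), fun x => ?_⟩
  exact congrArg (fun A : H →L[ℂ] H => A x) (CFC.sqrt_mul_sqrt_self R hR0)

/-- A density operator is an absolutely convergent sum of rank-one operators `|gᵢ⟩⟨gᵢ|`. -/
theorem IsDensityOperator.exists_decomposition {R : L2 d →L[ℂ] L2 d} (hR : IsDensityOperator R) :
    ∃ (ι : Type) (_ : Countable ι) (g : ι → L2 d), HasSum (fun i => ‖g i‖ ^ 2) 1 ∧
      (∀ a b, HasSum (fun i => ⟪a, g i⟫_ℂ * ⟪g i, b⟫_ℂ) ⟪a, R b⟫_ℂ) ∧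
      ∀ τ, HasTrace (R ∘L R) τ → HasSum (fun i => ⟪g i, R (g i)⟫_ℂ) τ := by
  obtain ⟨w, b, -⟩ := exists_hilbertBasis ℂ (L2 d)
  -- With S the square root of R, the vectors S bᵢ serve as gᵢ: the sum of ‖S bᵢ‖² is the trace of
  -- R, and R = S S resolves into |gᵢ⟩⟨gᵢ|. No diagonalisation of R is needed.
  obtain ⟨S, hSpos, hSS⟩ := hR.1.exists_sqrt
  have hSsym : ∀ x y, ⟪S x, y⟫_ℂ = ⟪x, S y⟫_ℂ := fun x y => hSpos.isSymmetric x y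
  have hn : HasSum (fun i => ‖S (b i)‖ ^ 2) 1 := by
    have h := hR.2 w b
    have h' : HasSum (fun i => ((‖S (b i)‖ ^ 2 : ℝ) : ℂ)) ((1 : ℝ) : ℂ) := by
      convert h using 1
      · ext i
        rw [← hSS, ← hSsym, inner_self_eq_norm_sq_to_K]
        simp
      · simp
    exact_mod_cast h'
  -- The basis is not known to be countable, but a summable family has countable support.
  -- Countability is needed later to exchange sums with integrals and with almost-everywhere
  -- statements.
  have hcount : (Function.support fun i => ‖S (b i)‖ ^ 2).Countable :=
    hn.summable.countable_support
  have hz : ∀ i, i ∉ (Function.support fun i => ‖S (b i)‖ ^ 2) → S (b i) = 0 := fun i hi => by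
    simpa using hi
  refine ⟨(Function.support fun i => ‖S (b i)‖ ^ 2), hcount.to_subtype, fun i => S (b i), ?_, ?_, ?_⟩
  · exact (hasSum_subtype_iff_of_support_subset (f := fun i => ‖S (b i)‖ ^ 2) subset_rfl).2 hn
  · intro x y
    refine (hasSum_subtype_iff_of_support_subset
      (f := fun i => ⟪x, S (b i)⟫_ℂ * ⟪S (b i), y⟫_ℂ) ?_).2 ?_
    · intro i hi
      by_contra hc
      simp [hz i hc] at hi
    · have := b.hasSum_inner_mul_inner (S x) (S y)
      rw [hSsym, hSS] at this
      refine this.congr_fun fun i => ?_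
      rw [hSsym, hSsym]
  · intro τ hτ
    refine (hasSum_subtype_iff_of_support_subset
      (f := fun i => ⟪S (b i), R (S (b i))⟫_ℂ) ?_).2 ?_
    · intro i hi
      by_contra hc
      simp [hz i hc] at hi
    · refine (hτ w b).congr_fun fun i => ?_
      rw [hSsym, ContinuousLinearMap.comp_apply, ← hSS (R (b i)), ← hSS (S (b i)), hSS (b i)]

/-- The kernel of a density operator, as an absolutely convergent sum of rank-one kernels. -/
theorem IsDensityOperator.exists_kernel {R : L2 d →L[ℂ] L2 d} (hR : IsDensityOperator R) :
    ∃ (ι : Type) (_ : Countable ι) (g : ι → L2 d) (κ : KernelSpace d),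
      HasSum (fun i => ‖g i‖ ^ 2) 1 ∧ HasSum (fun i => tens (g i) (g i)) κ ∧
      (∀ a b, ⟪tens a b, κ⟫_ℂ = ⟪a, R b⟫_ℂ) ∧
      (∀ a b, HasSum (fun i => ⟪a, g i⟫_ℂ * ⟪g i, b⟫_ℂ) ⟪a, R b⟫_ℂ) ∧
      ∀ τ, HasTrace (R ∘L R) τ → ⟪κ, κ⟫_ℂ = τ := by
  obtain ⟨ι, hι, g, h1, h2, h3⟩ := hR.exists_decomposition
  have hs : Summable fun i => tens (g i) (g i) := by
    refine Summable.of_norm ?_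
    simp_rw [norm_tens, ← sq]
    exact h1.summable
  have hκ := hs.hasSum
  have hin : ∀ a b, ⟪tens a b, ∑' i, tens (g i) (g i)⟫_ℂ = ⟪a, R b⟫_ℂ := fun a b => by
    have := (innerSL ℂ (tens a b)).hasSum hκ
    refine this.unique ?_
    simp only [innerSL_apply_apply, inner_tens]
    exact h2 a b
  refine ⟨ι, hι, g, _, h1, hκ, hin, h2, fun τ hτ => ?_⟩
  have h := (innerSL ℂ (∑' i, tens (g i) (g i))).hasSum hκ
  have h4 := h3 τ hτ
  have h5 : HasSum (fun i => ⟪∑' i, tens (g i) (g i), tens (g i) (g i)⟫_ℂ) (conj τ) := by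
    refine ((Complex.hasSum_conj'.2 h4)).congr_fun ?_
    intro i
    rw [← inner_conj_symm, hin]
  have h6 := h.unique h5
  rw [innerSL_apply_apply] at h6
  rw [← inner_conj_symm, h6, RCLike.conj_conj]

/-- The matrix elements against all vectors a determine R b, and the same elements are those of the
integral operator with kernel κ. -/
theorem isIntegralKernel_of_inner_tens {R : L2 d →L[ℂ] L2 d} {κ : KernelSpace d}
    (h : ∀ a b, ⟪tens a b, κ⟫_ℂ = ⟪a, R b⟫_ℂ) : IsIntegralKernel R κ := by
  refine ⟨Lp.memLp κ, fun b => ?_⟩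
  set F : L2 d := (memLp_integral_mul (Lp.memLp κ) b).toLp _ with hF
  have h0 : R b = F := by
    refine ext_inner_left ℂ fun a => ?_
    rw [← h a b, inner_tens_eq_integral, L2.inner_def]
    refine integral_congr_ae ?_
    filter_upwards [(memLp_integral_mul (Lp.memLp κ) b).coeFn_toLp] with X hX
    rw [RCLike.inner_apply, hF, hX, mul_comm]
  rw [h0]
  exact (memLp_integral_mul (Lp.memLp κ) b).coeFn_toLp

/-- The difference of the kernels annihilates every vector. This uniqueness transfers to an
arbitrary density matrix whatever is proved for the kernel built from the decomposition. -/
theorem IsIntegralKernel.ae_eq {R : L2 d →L[ℂ] L2 d} {k k' : Space d × Space d → ℂ}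
    (h : IsIntegralKernel R k) (h' : IsIntegralKernel R k') : k =ᵐ[volume] k' := by
  have : (fun z => k z - k' z) =ᵐ[volume] 0 := by
    refine ae_eq_zero_of_forall_integral_mul_eq_zero (h.1.sub h'.1) fun b => ?_
    filter_upwards [h.2 b, h'.2 b, ae_memLp_slice h.1, ae_memLp_slice h'.1] with X h1 h2 h3 h4
    have i1 : Integrable (fun Y => k (X, Y) * b Y) := h3.integrable_mul (Lp.memLp b)
    have i2 : Integrable (fun Y => k' (X, Y) * b Y) := h4.integrable_mul (Lp.memLp b)
    simp_rw [sub_mul]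
    rw [integral_sub i1 i2, ← h1, ← h2, sub_self]
  filter_upwards [this] with z hz
  exact sub_eq_zero.1 hz

end DensityOperators

/-! ### Change of variables to midpoint and scaled difference -/

section WeylCoordinates
variable {d : ℕ}

theorem lintegral_comp_smul' (f : Space d → ℝ≥0∞) {c : ℝ} (hc : 0 < c) :
    ∫⁻ y, f (c • y) = ENNReal.ofReal (c ^ d)⁻¹ * ∫⁻ y, f y := by
  have h := Measure.map_addHaar_smul (volume : Measure (Space d)) hc.ne'
  have h2 : ∫⁻ y, f (c • y) = ∫⁻ y, f y ∂(Measure.map (fun y : Space d => c • y) volume) :=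
    ((Homeomorph.smulOfNeZero c hc.ne').measurableEmbedding.lintegral_map f).symm
  rw [h2, h, lintegral_smul_measure, smul_eq_mul, finrank_euclideanSpace, Fintype.card_fin,
    abs_of_pos (by positivity)]

/-- The coordinates `(x, y) ↦ (x + ħy/2, x - ħy/2)` scale the Lebesgue measure by `ħ⁻ᵈ`. -/
theorem lintegral_weyl {ħ : ℝ} (hħ : 0 < ħ) {f : Space d × Space d → ℝ≥0∞} (hf : Measurable f) :
    ∫⁻ z : Space d × Space d, f (z.1 + (ħ / 2) • z.2, z.1 - (ħ / 2) • z.2) =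
      ENNReal.ofReal (ħ ^ d)⁻¹ * ∫⁻ z, f z := by
  rw [Measure.volume_eq_prod, lintegral_prod_symm _ (by fun_prop), lintegral_prod_symm _ (by fun_prop)]
  calc ∫⁻ y : Space d, ∫⁻ x : Space d, f (x + (ħ / 2) • y, x - (ħ / 2) • y)
      = ∫⁻ y : Space d, ∫⁻ x : Space d, f (x + ħ • y, x) := by
        refine lintegral_congr fun y => ?_
        rw [← lintegral_add_right_eq_self _ ((ħ / 2) • y)]
        refine lintegral_congr fun x => ?_
        congr 2
        · rw [add_assoc, ← add_smul]; ring_nf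
        · rw [add_sub_cancel_right]
    _ = ∫⁻ x : Space d, ∫⁻ y : Space d, f (x + ħ • y, x) := by
        refine lintegral_lintegral_swap (Measurable.aemeasurable ?_)
        simp only [Function.uncurry_def]
        fun_prop
    _ = ∫⁻ x : Space d, ENNReal.ofReal (ħ ^ d)⁻¹ * ∫⁻ y : Space d, f (y, x) := by
        refine lintegral_congr fun x => ?_
        rw [lintegral_comp_smul' (fun y => f (x + y, x)) hħ,
          lintegral_add_left_eq_self (fun y => f (y, x)) x]
    _ = _ := by
        rw [lintegral_const_mul _ (Measurable.lintegral_prod_left' hf)]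

theorem map_weyl {ħ : ℝ} (hħ : 0 < ħ) :
    Measure.map (fun z : Space d × Space d => (z.1 + (ħ / 2) • z.2, z.1 - (ħ / 2) • z.2)) volume =
      ENNReal.ofReal (ħ ^ d)⁻¹ • volume := by
  ext s hs
  rw [Measure.map_apply (by fun_prop) hs, ← lintegral_indicator_one (by measurability),
    Measure.smul_apply, ← lintegral_indicator_one hs, smul_eq_mul,
    ← lintegral_weyl hħ (measurable_one.indicator hs)]
  rfl

theorem quasiMeasurePreserving_weyl {ħ : ℝ} (hħ : 0 < ħ) :
    Measure.QuasiMeasurePreserving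
      (fun z : Space d × Space d => (z.1 + (ħ / 2) • z.2, z.1 - (ħ / 2) • z.2)) := by
  refine ⟨by fun_prop, ?_⟩
  rw [map_weyl hħ]
  exact Measure.smul_absolutelyContinuous

end WeylCoordinates

/-! ### Absolute convergence of the Wigner integral -/

section Convergence
variable {d : ℕ}

/-- Cauchy–Schwarz in y and a change of variables in each factor. The bound is uniform in x and
quadratic in g, so it can be summed over a decomposition of trace one. -/
theorem lintegral_enorm_mul_comp_le {ħ : ℝ} (hħ : 0 < ħ) (g : L2 d) (x : Space d) :
    ∫⁻ y : Space d, ‖g (x + (ħ / 2) • y)‖ₑ * ‖g (x - (ħ / 2) • y)‖ₑ ≤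
      ENNReal.ofReal ((ħ / 2) ^ d)⁻¹ * ‖g‖ₑ ^ 2 := by
  have hg := Lp.stronglyMeasurable g
  have e1 : ∫⁻ y : Space d, ‖g (x + (ħ / 2) • y)‖ₑ ^ 2 =
      ENNReal.ofReal ((ħ / 2) ^ d)⁻¹ * ‖g‖ₑ ^ 2 := by
    rw [lintegral_comp_smul' (fun y => ‖g (x + y)‖ₑ ^ 2) (by positivity),
      lintegral_add_left_eq_self (fun y => ‖g y‖ₑ ^ 2) x, lintegral_enorm_sq_eq]
  have e2 : ∫⁻ y : Space d, ‖g (x - (ħ / 2) • y)‖ₑ ^ 2 =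
      ENNReal.ofReal ((ħ / 2) ^ d)⁻¹ * ‖g‖ₑ ^ 2 := by
    rw [lintegral_comp_smul' (fun y => ‖g (x - y)‖ₑ ^ 2) (by positivity),
      lintegral_sub_left_eq_self (fun y => ‖g y‖ₑ ^ 2) x, lintegral_enorm_sq_eq]
  have h := lintegral_mul_sq_le (μ := (volume : Measure (Space d)))
    (f := fun y => ‖g (x + (ħ / 2) • y)‖ₑ) (g := fun y => ‖g (x - (ħ / 2) • y)‖ₑ)
    (hg.comp_measurable (by fun_prop)).enorm.aemeasurable
    (hg.comp_measurable (by fun_prop)).enorm.aemeasurable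
  rw [e1, e2, ← sq] at h
  exact (ENNReal.pow_le_pow_left_iff two_ne_zero).1 h

/-- The density matrix of a density operator is integrable along almost every antidiagonal. -/
theorem IsDensityOperator.ae_integrable_weylKernel {R : L2 d →L[ℂ] L2 d}
    (hR : IsDensityOperator R) {k : Space d × Space d → ℂ} (hk : IsIntegralKernel R k)
    {ħ : ℝ} (hħ : 0 < ħ) : ∀ᵐ x, Integrable (fun y : Space d => weylKernel ħ k x y) := by
  obtain ⟨ι, hι, g, κ, h1, h2, h3, -, -⟩ := hR.exists_kernel
  have hkκ := hk.ae_eq (isIntegralKernel_of_inner_tens h3)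
  have hsum : ∑' i, ‖tens (g i) (g i)‖ₑ = 1 := by
    have : ∀ i, ‖tens (g i) (g i)‖ₑ = ENNReal.ofReal (‖g i‖ ^ 2) := fun i => by
      rw [← ofReal_norm, norm_tens, sq]
    simp_rw [this]
    rw [← ENNReal.ofReal_tsum_of_nonneg (fun i => by positivity) h1.summable, h1.tsum_eq,
      ENNReal.ofReal_one]
  have hpt := Lp.hasSum_coeFn_tsum (f := fun i => tens (g i) (g i)) (by rw [hsum]; simp)
  rw [h2.tsum_eq] at hpt
  have hten := ae_all_iff.2 fun i => coeFn_tens (g i) (g i)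
  -- This is where the trace-class property enters: square integrability of k alone would not give
  -- integrability in y, while the series of |gᵢ(X)||gᵢ(Y)| does.
  have hle : ∀ᵐ z : Space d × Space d, ‖k z‖ₑ ≤ ∑' i, ‖g i z.1‖ₑ * ‖g i z.2‖ₑ := by
    filter_upwards [hkκ, hpt, hten] with z a1 a2 a3
    rw [a1, ← a2.tsum_eq]
    refine (enorm_tsum_le_tsum_enorm).trans (le_of_eq (tsum_congr fun i => ?_))
    rw [a3, enorm_mul, RCLike.enorm_conj]
  have hmeas := (hk.1.1.comp_quasiMeasurePreserving (quasiMeasurePreserving_weyl hħ))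
  have hmeas' : AEStronglyMeasurable (fun z : Space d × Space d => weylKernel ħ k z.1 z.2)
    (volume.prod volume) := hmeas
  have hle' := Measure.ae_ae_of_ae_prod ((quasiMeasurePreserving_weyl hħ).ae hle)
  filter_upwards [hle', hmeas'.prodMk_left] with x b1 b2
  refine ⟨b2, ?_⟩
  calc ∫⁻ y, ‖weylKernel ħ k x y‖ₑ
      ≤ ∫⁻ y, ∑' i, ‖g i (x + (ħ / 2) • y)‖ₑ * ‖g i (x - (ħ / 2) • y)‖ₑ := lintegral_mono_ae b1
    _ = ∑' i, ∫⁻ y, ‖g i (x + (ħ / 2) • y)‖ₑ * ‖g i (x - (ħ / 2) • y)‖ₑ := by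
        refine lintegral_tsum fun i => ?_
        have hg := Lp.stronglyMeasurable (g i)
        exact ((hg.comp_measurable (by fun_prop)).enorm.mul
          (hg.comp_measurable (by fun_prop)).enorm).aemeasurable
    _ ≤ ∑' i, ENNReal.ofReal ((ħ / 2) ^ d)⁻¹ * ‖tens (g i) (g i)‖ₑ := by
        refine ENNReal.tsum_le_tsum fun i => ?_
        refine (lintegral_enorm_mul_comp_le hħ (g i) x).trans (le_of_eq ?_)
        rw [← ofReal_norm (tens _ _), norm_tens, ENNReal.ofReal_mul (norm_nonneg _), ofReal_norm, sq]
    _ < ⊤ := by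
        rw [ENNReal.tsum_mul_left, hsum]
        finiteness

end Convergence

/-! ### A jointly measurable density matrix -/

section ExistenceOfDensityMatrix
variable {d : ℕ}

theorem IsWOTContinuous.continuousOn_inner {T : ℝ} {R : ℝ → L2 d →L[ℂ] L2 d}
    (h : IsWOTContinuous T R) (a b : L2 d) :
    ContinuousOn (fun t => ⟪a, R t b⟫_ℂ) (Icc (-T) T) := by
  have h1 : Continuous fun A : L2 d →WOT[ℂ] L2 d => ⟪a, A b⟫_ℂ :=
    ContinuousLinearMapWOT.continuous_dual_apply b (innerSL ℂ a)
  exact h1.comp_continuousOn h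

/-- Averages of the kernel over rectangles are matrix elements between indicator functions, hence
continuous in time for a weakly continuous family. -/
theorem setIntegral_eq_inner_tens {κ : KernelSpace d}
    {s t : Set (Space d)} (hs : MeasurableSet s) (ht : MeasurableSet t)
    (hsf : volume s ≠ ⊤) (htf : volume t ≠ ⊤) :
    ∫ z in s ×ˢ t, κ z = ⟪tens (indicatorConstLp 2 hs hsf (1 : ℂ))
      (indicatorConstLp 2 ht htf (1 : ℂ)), κ⟫_ℂ := by
  rw [L2.inner_def, ← integral_indicator (hs.prod ht)]
  refine integral_congr_ae ?_
  have h1 := (Measure.quasiMeasurePreserving_fst (μ := (volume : Measure (Space d)))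
    (ν := (volume : Measure (Space d)))).ae (indicatorConstLp_coeFn (p := 2) (hs := hs) (hμs := hsf) (c := (1 : ℂ)))
  have h2 := (Measure.quasiMeasurePreserving_snd (μ := (volume : Measure (Space d)))
    (ν := (volume : Measure (Space d)))).ae (indicatorConstLp_coeFn (p := 2) (hs := ht) (hμs := htf) (c := (1 : ℂ)))
  filter_upwards [coeFn_tens (indicatorConstLp 2 hs hsf (1 : ℂ))
      (indicatorConstLp 2 ht htf (1 : ℂ)), h1, h2] with z a1 a2 a3
  rw [RCLike.inner_apply, a1, a2, a3]
  by_cases hz1 : z.1 ∈ s <;> by_cases hz2 : z.2 ∈ t <;> simp [indicator, hz1, hz2]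

/-- Weakly continuous families of density operators have a jointly measurable density matrix. -/
theorem exists_isDensityMatrix {T : ℝ} (hT : 0 < T) {R : ℝ → L2 d →L[ℂ] L2 d}
    (hR : ∀ t ∈ Icc (-T) T, IsDensityOperator (R t)) (hW : IsWOTContinuous T R) :
    ∃ k, IsDensityMatrix T R k := by
  have hTT : -T ≤ T := by linarith
  -- Projecting the time onto [-T, T] makes everything defined and continuous for all real times.
  set P : ℝ → ℝ := fun t => (projIcc (-T) T hTT t : ℝ) with hP
  have hPmem : ∀ t, P t ∈ Icc (-T) T := fun t => (projIcc (-T) T hTT t).2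
  have hPc : Continuous P := continuous_subtype_val.comp continuous_projIcc
  have hPid : ∀ t ∈ Icc (-T) T, P t = t := fun t ht => by
    simp only [hP, projIcc_of_mem hTT ht]
  have hex : ∀ t, ∃ κ : KernelSpace d, ∀ a b, ⟪tens a b, κ⟫_ℂ = ⟪a, R (P t) b⟫_ℂ := fun t => by
    obtain ⟨-, -, -, κ, -, -, h, -, -⟩ := (hR _ (hPmem t)).exists_kernel
    exact ⟨κ, h⟩
  choose κ hκ using hex
  set δ : ℕ → ℝ := fun n => 1 / ((n : ℝ) + 1) with hδ
  have hδpos : ∀ n, 0 < δ n := fun n => by positivity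
  have hδlim : Tendsto δ atTop (𝓝[>] 0) :=
    tendsto_nhdsWithin_iff.2 ⟨tendsto_one_div_add_atTop_nhds_zero_nat,
      Eventually.of_forall fun n => hδpos n⟩
  -- The ball averages are continuous in t and measurable in z, hence jointly measurable, although κ
  -- t was chosen without any measurability in t. Their limit recovers κ t almost everywhere by
  -- Lebesgue differentiation. Balls of the product are rectangles because the product carries the
  -- sup metric.
  set u : ℕ → ℝ × (Space d × Space d) → ℂ := fun n p =>
    ⨍ z in Metric.closedBall p.2 (δ n), κ p.1 z with hu
  have huc : ∀ n z, Continuous fun t => u n (t, z) := fun n z => by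
    simp only [hu, setAverage_eq]
    refine continuous_const.smul ?_
    have hb : Metric.closedBall z (δ n) = Metric.closedBall z.1 (δ n) ×ˢ Metric.closedBall z.2 (δ n) :=
      (closedBall_prod_same z.1 z.2 (δ n)).symm
    rw [hb]
    have := fun t => setIntegral_eq_inner_tens (κ := κ t)
      (measurableSet_closedBall (x := z.1) (ε := δ n))
      (measurableSet_closedBall (x := z.2) (ε := δ n)) measure_closedBall_lt_top.ne
      measure_closedBall_lt_top.ne
    simp_rw [this, hκ]
    exact (hW.continuousOn_inner _ _).comp_continuous hPc hPmem
  have hum : ∀ n t, StronglyMeasurable fun z => u n (t, z) := fun n t => by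
    simp only [hu, setAverage_eq]
    refine StronglyMeasurable.smul ?_ ?_
    · have : ∀ z : Space d × Space d, volume.real (Metric.closedBall z (δ n)) =
        volume.real (Metric.closedBall (0 : Space d × Space d) (δ n)) := fun z => by
          have : (volume : Measure (Space d × Space d)).IsAddHaarMeasure :=
            inferInstanceAs (Measure.prod volume volume).IsAddHaarMeasure
          exact congrArg ENNReal.toReal (Measure.addHaar_closedBall_center volume z _)
      simp_rw [this]
      exact stronglyMeasurable_const
    · simp_rw [← integral_indicator (measurableSet_closedBall)]
      have hm : StronglyMeasurable fun q : (Space d × Space d) × (Space d × Space d) =>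
          ({q : (Space d × Space d) × (Space d × Space d) | dist q.2 q.1 ≤ δ n}).indicator
            (fun q => κ t q.2) q :=
        ((Lp.stronglyMeasurable (κ t)).comp_measurable measurable_snd).indicator
          (measurableSet_le (by fun_prop) (by fun_prop))
      exact hm.integral_prod_right'
  have hujoint : ∀ n, StronglyMeasurable (u n) := fun n => by
    have := stronglyMeasurable_uncurry_of_continuous_of_stronglyMeasurable
      (u := fun (t : ℝ) (z : Space d × Space d) => u n (t, z)) (fun z => huc n z) (fun t => hum n t)
    simpa [Function.uncurry_def] using this
  refine ⟨fun t z => limUnder atTop fun n => u n (t, z), ?_, ?_⟩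
  · exact (StronglyMeasurable.limUnder hujoint).aestronglyMeasurable
  · intro t ht
    have hint := isIntegralKernel_of_inner_tens (R := R t) (κ := κ t) fun a b => by
      rw [hκ, hPid t ht]
    have hloc : LocallyIntegrable (κ t) volume := (Lp.memLp (κ t)).locallyIntegrable (by norm_num)
    have hae : (κ t : Space d × Space d → ℂ) =ᵐ[volume] fun z => limUnder atTop fun n => u n (t, z) := by
      filter_upwards [IsUnifLocDoublingMeasure.ae_tendsto_average volume hloc 1] with z hz
      refine (Tendsto.limUnder_eq ?_).symm
      refine hz (fun _ => z) δ hδlim (Eventually.of_forall fun n => ?_)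
      simp [(hδpos n).le]
    refine ⟨(memLp_congr_ae hae).1 (Lp.memLp _), fun φ => ?_⟩
    have hae' : ∀ᵐ z ∂(volume.prod volume : Measure (Space d × Space d)),
      κ t z = limUnder atTop fun n => u n (t, z) := hae
    filter_upwards [hint.2 φ, Measure.ae_ae_of_ae_prod hae'] with X h1 h2
    rw [h1]
    refine integral_congr_ae ?_
    filter_upwards [h2] with Y hY
    rw [hY]

end ExistenceOfDensityMatrix

/-! ### Bounded multiplication operators on L² -/

section Multiplication
variable {α : Type*} [MeasurableSpace α] {μ : Measure α}

theorem memLp_mul_of_bound {a : α → ℂ} (ha : AEStronglyMeasurable a μ) {K : ℝ}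
    (hK : ∀ x, ‖a x‖ ≤ K) (f : Lp ℂ 2 μ) : MemLp (fun x => a x * f x) 2 μ :=
  (Lp.memLp f).of_le_mul (c := K) (ha.mul (Lp.memLp f).1) (ae_of_all _ fun x => by
    rw [norm_mul]
    exact mul_le_mul_of_nonneg_right (hK x) (norm_nonneg _))

/-- Multiplication by a bounded measurable function, as an operator on `L²`. -/
noncomputable def mulCLM (a : α → ℂ) (ha : AEStronglyMeasurable a μ) (K : ℝ)
    (hK : ∀ x, ‖a x‖ ≤ K) : Lp ℂ 2 μ →L[ℂ] Lp ℂ 2 μ :=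
  LinearMap.mkContinuous
    { toFun := fun f => (memLp_mul_of_bound ha hK f).toLp _
      map_add' := fun f g => by
        refine Lp.ext ?_
        filter_upwards [(memLp_mul_of_bound ha hK (f + g)).coeFn_toLp,
          (memLp_mul_of_bound ha hK f).coeFn_toLp, (memLp_mul_of_bound ha hK g).coeFn_toLp,
          Lp.coeFn_add f g, Lp.coeFn_add ((memLp_mul_of_bound ha hK f).toLp _)
            ((memLp_mul_of_bound ha hK g).toLp _)] with x h1 h2 h3 h4 h5
        rw [h1, h5, Pi.add_apply, h2, h3, h4, Pi.add_apply, mul_add]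
      map_smul' := fun c f => by
        refine Lp.ext ?_
        filter_upwards [(memLp_mul_of_bound ha hK (c • f)).coeFn_toLp,
          (memLp_mul_of_bound ha hK f).coeFn_toLp,
          Lp.coeFn_smul c f, Lp.coeFn_smul c ((memLp_mul_of_bound ha hK f).toLp _)]
          with x h1 h2 h4 h5
        rw [RingHom.id_apply, h1, h5, Pi.smul_apply, h2, h4, Pi.smul_apply, smul_eq_mul, smul_eq_mul]
        ring } K (fun f => by
      refine Lp.norm_le_mul_norm_of_ae_le_mul ?_
      filter_upwards [(memLp_mul_of_bound ha hK f).coeFn_toLp] with x h1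
      simp only [LinearMap.coe_mk, AddHom.coe_mk]
      rw [h1, norm_mul]
      exact mul_le_mul_of_nonneg_right (hK x) (norm_nonneg _))

theorem coeFn_mulCLM {a : α → ℂ} (ha : AEStronglyMeasurable a μ) {K : ℝ}
    (hK : ∀ x, ‖a x‖ ≤ K) (f : Lp ℂ 2 μ) : mulCLM a ha K hK f =ᵐ[μ] fun x => a x * f x :=
  (memLp_mul_of_bound ha hK f).coeFn_toLp

theorem norm_mulCLM_le {a : α → ℂ} (ha : AEStronglyMeasurable a μ) {K : ℝ}
    (hK : ∀ x, ‖a x‖ ≤ K) (f : Lp ℂ 2 μ) : ‖mulCLM a ha K hK f‖ ≤ K * ‖f‖ := by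
  refine Lp.norm_le_mul_norm_of_ae_le_mul ?_
  filter_upwards [coeFn_mulCLM ha hK f] with x h1
  rw [h1, norm_mul]
  exact mul_le_mul_of_nonneg_right (hK x) (norm_nonneg _)

end Multiplication

/-! ### The free evolution and its time derivative -/

section Phase
variable {d : ℕ}

/-- The free phase `exp(-i s |p|²)`. -/
noncomputable def phase (s : ℝ) (p : Space d) : ℂ := Complex.exp (-(Complex.I * (s * ‖p‖ ^ 2 : ℝ)))

theorem norm_phase (s : ℝ) (p : Space d) : ‖phase s p‖ = 1 := by
  rw [phase, Complex.norm_exp]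
  simp [-Complex.ofReal_pow]

theorem contDiff_phase (s : ℝ) : ContDiff ℝ ∞ (phase (d := d) s) := by
  unfold phase
  have h : ContDiff ℝ ∞ fun p : Space d => ((s * ‖p‖ ^ 2 : ℝ) : ℂ) :=
    Complex.ofRealCLM.contDiff.comp (contDiff_const.mul (contDiff_norm_sq ℝ))
  exact (contDiff_const.mul h).neg.cexp

theorem phase_add (s s' : ℝ) (p : Space d) : phase (s + s') p = phase s p * phase s' p := by
  rw [phase, phase, phase, ← Complex.exp_add]
  congr 1
  push_cast
  ring

theorem phase_zero (p : Space d) : phase 0 p = 1 := by simp [phase]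

theorem conj_phase (s : ℝ) (p : Space d) : conj (phase s p) = phase (-s) p := by
  rw [phase, phase, ← Complex.exp_conj]
  congr 1
  simp

/-- Multiplication by the free phase. -/
noncomputable def phaseMul (s : ℝ) : L2 d →L[ℂ] L2 d :=
  mulCLM (phase s) (contDiff_phase s).continuous.aestronglyMeasurable 1 fun p => (norm_phase s p).le

theorem coeFn_phaseMul (s : ℝ) (f : L2 d) : phaseMul s f =ᵐ[volume] fun p => phase s p * f p :=
  coeFn_mulCLM _ _ f

theorem phaseMul_phaseMul (s s' : ℝ) (f : L2 d) : phaseMul s (phaseMul s' f) = phaseMul (s + s') f := by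
  refine Lp.ext ?_
  filter_upwards [coeFn_phaseMul s (phaseMul s' f), coeFn_phaseMul s' f, coeFn_phaseMul (s + s') f]
    with p h1 h2 h3
  rw [h1, h2, h3, phase_add, mul_assoc]

theorem phaseMul_zero (f : L2 d) : phaseMul 0 f = f := by
  refine Lp.ext ?_
  filter_upwards [coeFn_phaseMul 0 f] with p h1
  rw [h1, phase_zero, one_mul]

theorem inner_phaseMul (s : ℝ) (f g : L2 d) : ⟪phaseMul s f, phaseMul s g⟫_ℂ = ⟪f, g⟫_ℂ := by
  rw [L2.inner_def, L2.inner_def]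
  refine integral_congr_ae ?_
  filter_upwards [coeFn_phaseMul s f, coeFn_phaseMul s g] with p h1 h2
  rw [h1, h2, RCLike.inner_apply, RCLike.inner_apply, map_mul, conj_phase]
  have : phase s p * phase (-s) p = 1 := by rw [← phase_add, add_neg_cancel, phase_zero]
  linear_combination (g p * conj (f p)) * this

theorem norm_phaseMul (s : ℝ) (f : L2 d) : ‖phaseMul s f‖ = ‖f‖ := by
  rw [norm_eq_sqrt_re_inner (𝕜 := ℂ), inner_phaseMul, ← norm_eq_sqrt_re_inner]

/-- Taylor expansion for |x| ≤ 1, the triangle inequality otherwise. A quadratic remainder valid for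
all real x is needed because ‖p‖² is unbounded. -/
theorem norm_exp_sub_one_add_le (x : ℝ) :
    ‖Complex.exp (-(Complex.I * x)) - 1 + Complex.I * x‖ ≤ 3 * x ^ 2 := by
  by_cases hx : |x| ≤ 1
  · have h := Complex.norm_exp_sub_one_sub_id_le (x := -(Complex.I * x)) (by simpa using hx)
    rw [sub_neg_eq_add] at h
    simp only [norm_neg, norm_mul, Complex.norm_I, Complex.norm_real, one_mul, Real.norm_eq_abs,
      sq_abs] at h
    nlinarith [sq_nonneg x]
  · push Not at hx
    have h1 : ‖Complex.exp (-(Complex.I * x))‖ = 1 := by rw [Complex.norm_exp]; simp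
    have h2 : ‖Complex.exp (-(Complex.I * x)) - 1 + Complex.I * x‖ ≤ 1 + 1 + |x| := by
      refine (norm_add_le _ _).trans (add_le_add ((norm_sub_le _ _).trans ?_) ?_)
      · simp [h1]
      · simp
    rw [← sq_abs]
    nlinarith

/-- The group law and unitarity reduce the increment to s = 0, where the quadratic remainder of the
exponential is bounded by 3h²‖p‖⁴|f|. The vector q2 records that this majorant lies in L². -/
theorem hasDerivAt_phaseMul {f q q2 : L2 d} (hq : q =ᵐ[volume] fun p => ((‖p‖ ^ 2 : ℝ) : ℂ) * f p)
    (hq2 : q2 =ᵐ[volume] fun p => ((‖p‖ ^ 4 : ℝ) : ℂ) * f p) (s : ℝ) :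
    HasDerivAt (fun s => phaseMul s f) (-(Complex.I • phaseMul s q)) s := by
  have key : ∀ h : ℝ, ‖phaseMul (s + h) f - phaseMul s f - h • (-(Complex.I • phaseMul s q))‖ ≤
      3 * h ^ 2 * ‖q2‖ := fun h => by
    have e : phaseMul (s + h) f - phaseMul s f - h • (-(Complex.I • phaseMul s q)) =
        phaseMul s (phaseMul h f - f + (h : ℂ) • Complex.I • q) := by
      rw [map_add, map_sub, phaseMul_phaseMul, map_smul, map_smul, smul_neg, sub_neg_eq_add]
      rfl
    rw [e, norm_phaseMul]
    refine Lp.norm_le_mul_norm_of_ae_le_mul ?_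
    filter_upwards [Lp.coeFn_add (phaseMul h f - f) ((h : ℂ) • Complex.I • q),
      Lp.coeFn_sub (phaseMul h f) f, coeFn_phaseMul h f, Lp.coeFn_smul (h : ℂ) (Complex.I • q),
      Lp.coeFn_smul Complex.I q, hq, hq2] with p h1 h2 h3 h4 h5 h6 h7
    rw [h1, Pi.add_apply, h2, Pi.sub_apply, h3, h4, Pi.smul_apply, h5, Pi.smul_apply, h6, h7]
    have e2 : phase h p * f p - f p + (h : ℂ) • Complex.I • (((‖p‖ ^ 2 : ℝ) : ℂ) * f p) =
        (Complex.exp (-(Complex.I * (h * ‖p‖ ^ 2 : ℝ))) - 1 + Complex.I * (h * ‖p‖ ^ 2 : ℝ)) * f p := by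
      rw [phase]
      simp only [smul_eq_mul]
      push_cast
      ring
    rw [e2, norm_mul, norm_mul, Complex.norm_real, Real.norm_eq_abs, abs_of_nonneg (by positivity)]
    refine (mul_le_mul_of_nonneg_right (norm_exp_sub_one_add_le _) (norm_nonneg _)).trans
      (le_of_eq ?_)
    ring
  rw [hasDerivAt_iff_isLittleO_nhds_zero]
  refine Asymptotics.IsBigO.trans_isLittleO (g := fun h : ℝ => h ^ 2) ?_ ?_
  · refine Asymptotics.IsBigO.of_bound (3 * ‖q2‖) (Eventually.of_forall fun h => ?_)
    refine (key h).trans (le_of_eq ?_)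
    rw [Real.norm_eq_abs, abs_of_nonneg (sq_nonneg h)]
    ring
  · simpa using Asymptotics.isLittleO_pow_id (𝕜 := ℝ) (n := 2) (by norm_num)

/-- The free evolution, from the momentum representation to the position representation. -/
noncomputable def freeEvol (s : ℝ) : L2 d →L[ℂ] L2 d :=
  (Lp.fourierTransformₗᵢ (Space d) ℂ).symm.toContinuousLinearEquiv.toContinuousLinearMap ∘L phaseMul s

theorem freeEvol_apply (s : ℝ) (f : L2 d) : freeEvol s f = 𝓕⁻ (phaseMul s f) := rfl

theorem inner_freeEvol (s : ℝ) (f g : L2 d) : ⟪freeEvol s f, freeEvol s g⟫_ℂ = ⟪f, g⟫_ℂ := by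
  rw [freeEvol_apply, freeEvol_apply, ← Lp.inner_fourier_eq, fourier_fourierInv_eq,
    fourier_fourierInv_eq, inner_phaseMul]

theorem norm_freeEvol (s : ℝ) (f : L2 d) : ‖freeEvol s f‖ = ‖f‖ := by
  rw [norm_eq_sqrt_re_inner (𝕜 := ℂ), inner_freeEvol, ← norm_eq_sqrt_re_inner]

/-- The inverse of the free evolution. -/
noncomputable def freeEvolInv (s : ℝ) (f : L2 d) : L2 d := phaseMul (-s) (𝓕 f)

theorem freeEvol_freeEvolInv (s : ℝ) (f : L2 d) : freeEvol s (freeEvolInv s f) = f := by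
  rw [freeEvol_apply, freeEvolInv, phaseMul_phaseMul, add_neg_cancel, phaseMul_zero,
    fourierInv_fourier_eq]

theorem inner_freeEvolInv_right (s : ℝ) (f g : L2 d) :
    ⟪f, freeEvolInv s g⟫_ℂ = ⟪freeEvol s f, g⟫_ℂ := by
  rw [← inner_freeEvol s, freeEvol_freeEvolInv]

theorem norm_freeEvolInv (s : ℝ) (f : L2 d) : ‖freeEvolInv s f‖ = ‖f‖ := by
  rw [← norm_freeEvol s, freeEvol_freeEvolInv]

theorem hasDerivAt_freeEvol {f q q2 : L2 d} (hq : q =ᵐ[volume] fun p => ((‖p‖ ^ 2 : ℝ) : ℂ) * f p)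
    (hq2 : q2 =ᵐ[volume] fun p => ((‖p‖ ^ 4 : ℝ) : ℂ) * f p) (s : ℝ) :
    HasDerivAt (fun s => freeEvol s f) (-(Complex.I • freeEvol s q)) s := by
  set A := (Lp.fourierTransformₗᵢ (Space d) ℂ).symm.toContinuousLinearEquiv.toContinuousLinearMap
  have h := (A.restrictScalars ℝ).hasFDerivAt.comp_hasDerivAt s (hasDerivAt_phaseMul hq hq2 s)
  have e : (A.restrictScalars ℝ) (-(Complex.I • phaseMul s q)) = -(Complex.I • freeEvol s q) := by
    rw [ContinuousLinearMap.coe_restrictScalars', map_neg, map_smul]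
    rfl
  rw [e] at h
  exact h

end Phase

/-! ### From distributional to integrated equations in time -/

section DuBoisReymond

/-- The primitive of a test function of integral zero, as a test function. -/
theorem exists_testFunction_deriv_eq {T : ℝ} {θ : ℝ → ℝ} (hθ : ContDiff ℝ ∞ θ) {K : Set ℝ}
    (hK : IsCompact K) (hKne : K.Nonempty) (hKT : K ⊆ Ioo (-T) T) (hθK : ∀ x, x ∉ K → θ x = 0)
    (h0 : ∫ x in (-T)..T, θ x = 0) :
    ∃ η : 𝓓(timeInterval T, ℂ), ∀ x, deriv η x = (θ x : ℂ) := by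
  obtain ⟨a, haK, ha⟩ := hK.exists_isLeast hKne
  obtain ⟨b, hbK, hb⟩ := hK.exists_isGreatest hKne
  have haT := hKT haK
  have hbT := hKT hbK
  -- The primitive based at -T vanishes to the left of the compact set trivially and to its right
  -- because the total integral is zero, so it is compactly supported in the open interval.
  set E : ℝ → ℝ := fun t => ∫ x in (-T)..t, θ x with hE
  have hd : ∀ t, HasDerivAt E (θ t) t := fun t =>
    intervalIntegral.integral_hasDerivAt_right (hθ.continuous.intervalIntegrable _ _)
      hθ.continuous.aestronglyMeasurable.stronglyMeasurableAtFilter hθ.continuous.continuousAt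
  have hEc : ContDiff ℝ ∞ E := by
    refine contDiff_infty_iff_deriv.2 ⟨fun t => (hd t).differentiableAt, ?_⟩
    rwa [show deriv E = θ from funext fun t => (hd t).deriv]
  have hzl : ∀ t, t < a → E t = 0 := fun t ht => by
    refine (intervalIntegral.integral_congr (g := fun _ => (0 : ℝ)) fun x hx => hθK x fun hxK => ?_).trans
      (by simp)
    have h1 := ha hxK
    have h2 : x ≤ max (-T) t := hx.2
    rcases le_max_iff.1 h2 with h3 | h3
    · linarith [haT.1]
    · linarith
  have hzr : ∀ t, b < t → E t = 0 := fun t ht => by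
    have h1 : E t = (∫ x in (-T)..T, θ x) + ∫ x in T..t, θ x :=
      (intervalIntegral.integral_add_adjacent_intervals (hθ.continuous.intervalIntegrable _ _)
        (hθ.continuous.intervalIntegrable _ _)).symm
    rw [h1, h0, zero_add]
    refine (intervalIntegral.integral_congr (g := fun _ => (0 : ℝ)) fun x hx => hθK x fun hxK => ?_).trans
      (by simp)
    have h1 := hb hxK
    have h2 : min T t ≤ x := hx.1
    rcases min_le_iff.1 h2 with h3 | h3
    · linarith [hbT.2]
    · linarith
  have hsub : tsupport (fun t => (E t : ℂ)) ⊆ Icc a b := by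
    refine closure_minimal (fun t ht => ?_) isClosed_Icc
    rw [Function.mem_support] at ht
    by_contra hc
    rw [mem_Icc, not_and_or, not_le, not_le] at hc
    rcases hc with hc | hc
    · exact ht (by rw [hzl t hc, Complex.ofReal_zero])
    · exact ht (by rw [hzr t hc, Complex.ofReal_zero])
  refine ⟨⟨fun t => (E t : ℂ), Complex.ofRealCLM.contDiff.comp hEc,
    isCompact_Icc.of_isClosed_subset (isClosed_tsupport _) hsub, hsub.trans fun x hx => ?_⟩,
    fun x => (hd x).ofReal_comp.deriv⟩
  exact ⟨haT.1.trans_le hx.1, hx.2.trans_lt hbT.2⟩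

/-- A continuous function with vanishing distributional derivative is constant. -/
theorem exists_eq_const_of_forall_integral_deriv_mul {T : ℝ} (hT : 0 < T) {c : ℝ → ℂ}
    (hc : Continuous c)
    (h : ∀ η : 𝓓(timeInterval T, ℂ), ∫ t in Ioo (-T) T, deriv η t * c t = 0) :
    ∃ c₀, ∀ t ∈ Icc (-T) T, c t = c₀ := by
  let β : ContDiffBump (0 : ℝ) := ⟨T / 4, T / 2, by linarith, by linarith⟩
  have hβK : tsupport β ⊆ Ioo (-T) T := by
    rw [β.tsupport_eq]
    intro x hx
    rw [mem_closedBall_zero_iff, Real.norm_eq_abs, abs_le] at hx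
    have h1 := hx.1
    have h2 := hx.2
    simp only [β] at h1 h2
    constructor <;> linarith
  have hβpos : 0 < ∫ x, β x := β.integral_pos
  have hTT : -T ≤ T := by linarith
  have int_eq : ∀ f : ℝ → ℝ, tsupport f ⊆ Ioo (-T) T → ∫ x in (-T)..T, f x = ∫ x, f x := fun f hf => by
    rw [intervalIntegral.integral_of_le hTT, setIntegral_eq_integral_of_forall_compl_eq_zero]
    intro x hx
    refine image_eq_zero_of_notMem_tsupport fun hx' => hx ?_
    exact ⟨(hf hx').1, (hf hx').2.le⟩
  -- The only candidate for the constant: the mean of c against the normalised bump.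
  set c₀ : ℂ := (∫ x, β x : ℝ)⁻¹ * ∫ t in Ioo (-T) T, (β t : ℂ) * c t with hc₀
  have hci : ∀ f : ℝ → ℝ, Continuous f → IntegrableOn (fun t => (f t : ℂ) * c t) (Ioo (-T) T) :=
    fun f hf => (((Complex.continuous_ofReal.comp hf).mul hc).integrableOn_Icc).mono_set
      Ioo_subset_Icc_self
  have hfi : ∀ f : ℝ → ℝ, Continuous f → IntegrableOn (fun t => (f t : ℂ)) (Ioo (-T) T) :=
    fun f hf => ((Complex.continuous_ofReal.comp hf).integrableOn_Icc).mono_set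
      Ioo_subset_Icc_self
  -- Subtracting from ζ the multiple of the bump with the same integral leaves a function of mean
  -- zero, which is the derivative of an admissible test function.
  have key : ∀ ζ : ℝ → ℝ, ContDiff ℝ ∞ ζ → HasCompactSupport ζ → tsupport ζ ⊆ Ioo (-T) T →
      ∫ t, ζ t • (c t - c₀) = 0 := fun ζ hζ hζc hζT => by
    set I := ∫ x, ζ x with hI
    set J := ∫ x, β x with hJ
    have hθc : ContDiff ℝ ∞ fun x => ζ x - I * J⁻¹ * β x :=
      hζ.sub (contDiff_const.mul β.contDiff)
    have hne : (tsupport ζ ∪ tsupport β).Nonempty := by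
      refine ⟨0, Or.inr (subset_tsupport _ ?_)⟩
      rw [Function.mem_support, β.one_of_mem_closedBall (Metric.mem_closedBall_self β.rIn_pos.le)]
      exact one_ne_zero
    have hz : ∀ x, x ∉ tsupport ζ ∪ tsupport β → ζ x - I * J⁻¹ * β x = 0 := by
      intro x hx
      rw [mem_union, not_or] at hx
      rw [image_eq_zero_of_notMem_tsupport hx.1, image_eq_zero_of_notMem_tsupport hx.2]
      simp
    have h0 : ∫ x in (-T)..T, (ζ x - I * J⁻¹ * β x) = 0 := by
      rw [intervalIntegral.integral_sub (hζ.continuous.intervalIntegrable _ _)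
        ((β.continuous.const_mul _).intervalIntegrable _ _),
        intervalIntegral.integral_const_mul, int_eq ζ hζT, int_eq β hβK]
      field_simp
      ring
    obtain ⟨η, hη⟩ := exists_testFunction_deriv_eq hθc
      (hζc.isCompact.union β.hasCompactSupport.isCompact) hne (union_subset hζT hβK) hz h0
    have h1 := h η
    simp_rw [hη] at h1
    have h2 : ∀ t : ℝ, ((ζ t - I * J⁻¹ * β t : ℝ) : ℂ) * c t =
        (ζ t : ℂ) * c t - (I * (J : ℂ)⁻¹) * ((β t : ℂ) * c t) := fun t => by
      push_cast
      ring
    simp_rw [h2] at h1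
    rw [integral_sub (hci _ hζ.continuous) ((hci _ β.continuous).const_mul _),
      integral_const_mul] at h1
    have h3 : ∫ t, ζ t • (c t - c₀) = ∫ t in Ioo (-T) T, ((ζ t : ℂ) * c t - c₀ * (ζ t : ℂ)) := by
      rw [← setIntegral_eq_integral_of_forall_compl_eq_zero (s := Ioo (-T) T)]
      · refine integral_congr_ae (ae_of_all _ fun t => ?_)
        simp only [Complex.real_smul]
        ring
      · intro x hx
        rw [image_eq_zero_of_notMem_tsupport fun hx' => hx (hζT hx'), zero_smul]
    have h4 : ∫ t in Ioo (-T) T, (ζ t : ℂ) = (I : ℂ) := by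
      rw [integral_complex_ofReal, ← integral_Ioc_eq_integral_Ioo, ← intervalIntegral.integral_of_le hTT,
        int_eq ζ hζT]
    rw [h3, integral_sub (hci _ hζ.continuous) ((hfi _ hζ.continuous).const_mul _),
      integral_const_mul, h4, ← h1, hc₀]
    push_cast
    ring
  have hae := isOpen_Ioo.ae_eq_zero_of_integral_contDiff_smul_eq_zero (μ := volume)
    (((hc.sub continuous_const).locallyIntegrable).locallyIntegrableOn _) key
  have hEq : EqOn (fun t => c t - c₀) (fun _ => 0) (Ioo (-T) T) := by
    refine Measure.eqOn_open_of_ae_eq (μ := volume) ?_ isOpen_Ioo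
      (hc.sub continuous_const).continuousOn continuousOn_const
    exact (ae_restrict_iff' measurableSet_Ioo).2 hae
  refine ⟨c₀, fun t ht => ?_⟩
  have hcl : EqOn (fun t => c t - c₀) (fun _ => 0) (closure (Ioo (-T) T)) :=
    hEq.closure (hc.sub continuous_const) continuous_const
  rw [closure_Ioo (by linarith)] at hcl
  exact sub_eq_zero.1 (hcl ht)

/-- The weak formulation of `f' = g` on `(-T, T)`, for continuous `f` and `g`, gives the
integrated form. -/
theorem sub_eq_integral_of_weak_deriv {T : ℝ} (hT : 0 < T) {f g : ℝ → ℂ}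
    (hf : ContinuousOn f (Icc (-T) T)) (hg : ContinuousOn g (Icc (-T) T))
    (h : ∀ η : 𝓓(timeInterval T, ℂ),
      -∫ t in Ioo (-T) T, deriv η t * f t = ∫ t in Ioo (-T) T, η t * g t) :
    ∀ s ∈ Icc (-T) T, ∀ t ∈ Icc (-T) T, f t - f s = ∫ τ in s..t, g τ := by
  have hTT : -T ≤ T := by linarith
  -- Constant extension past the endpoints makes f and g continuous on the line without changing any
  -- integral over (-T, T).
  set f' : ℝ → ℂ := IccExtend hTT (domRestrict (Icc (-T) T) f) with hf'
  set g' : ℝ → ℂ := IccExtend hTT (domRestrict (Icc (-T) T) g) with hg'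
  have hfc : Continuous f' := (continuousOn_iff_continuous_domRestrict.1 hf).Icc_extend'
  have hgc : Continuous g' := (continuousOn_iff_continuous_domRestrict.1 hg).Icc_extend'
  have hff : ∀ t ∈ Icc (-T) T, f' t = f t := fun t ht => by rw [hf', IccExtend_of_mem _ _ ht]; rfl
  have hgg : ∀ t ∈ Icc (-T) T, g' t = g t := fun t ht => by rw [hg', IccExtend_of_mem _ _ ht]; rfl
  set P : ℝ → ℂ := fun t => ∫ τ in (-T)..t, g' τ with hP
  have hPd : ∀ t, HasDerivAt P (g' t) t := fun t =>
    intervalIntegral.integral_hasDerivAt_right (hgc.intervalIntegrable _ _)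
      hgc.aestronglyMeasurable.stronglyMeasurableAtFilter hgc.continuousAt
  have hPc : Continuous P := continuous_iff_continuousAt.2 fun t => (hPd t).continuousAt
  -- Integration by parts shows that f minus the primitive of g has zero distributional derivative.
  obtain ⟨c₀, hc₀⟩ := exists_eq_const_of_forall_integral_deriv_mul hT (hfc.sub hPc) fun η => by
    have hηd : Differentiable ℝ η := η.contDiff.differentiable (by norm_num)
    have hηd' : Continuous (deriv η) := η.contDiff.continuous_deriv (by norm_num)
    have hz : ∀ t, t ∉ Ioo (-T) T → η t = 0 := fun t ht =>
      image_eq_zero_of_notMem_tsupport fun hx => ht (η.tsupport_subset hx)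
    have hparts := intervalIntegral.integral_mul_deriv_eq_deriv_mul (a := -T) (b := T)
      (u := η) (v := P) (u' := deriv η) (v' := g')
      (fun t _ => (hηd t).hasDerivAt) (fun t _ => hPd t) (hηd'.intervalIntegrable _ _)
      (hgc.intervalIntegrable _ _)
    rw [hz T (fun h => lt_irrefl _ h.2), hz (-T) (fun h => lt_irrefl _ h.1), zero_mul, zero_mul,
      sub_zero, zero_sub, intervalIntegral.integral_of_le hTT, intervalIntegral.integral_of_le hTT,
      integral_Ioc_eq_integral_Ioo, integral_Ioc_eq_integral_Ioo] at hparts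
    have e1 : ∫ t in Ioo (-T) T, η t * g' t = ∫ t in Ioo (-T) T, η t * g t :=
      setIntegral_congr_fun measurableSet_Ioo fun t ht => by
        simp only [hgg t (Ioo_subset_Icc_self ht)]
    have e2 : ∫ t in Ioo (-T) T, deriv η t * f' t = ∫ t in Ioo (-T) T, deriv η t * f t :=
      setIntegral_congr_fun measurableSet_Ioo fun t ht => by
        simp only [hff t (Ioo_subset_Icc_self ht)]
    have i1 : IntegrableOn (fun t => deriv η t * f' t) (Ioo (-T) T) :=
      ((hηd'.mul hfc).integrableOn_Icc).mono_set Ioo_subset_Icc_self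
    have i2 : IntegrableOn (fun t => deriv η t * P t) (Ioo (-T) T) :=
      ((hηd'.mul hPc).integrableOn_Icc).mono_set Ioo_subset_Icc_self
    simp_rw [Pi.sub_apply, mul_sub]
    rw [integral_sub i1 i2, e2]
    have := h η
    rw [← e1, hparts] at this
    rw [neg_inj.1 this, sub_self]
  intro s hs t ht
  have h1 : f t - P t = f s - P s := by
    have := (hc₀ t ht).trans (hc₀ s hs).symm
    simpa only [Pi.sub_apply, hff t ht, hff s hs] using this
  have h2 : P t - P s = ∫ τ in s..t, g' τ :=
    intervalIntegral.integral_interval_sub_left (hgc.intervalIntegrable _ _)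
      (hgc.intervalIntegrable _ _)
  have h3 : ∫ τ in s..t, g' τ = ∫ τ in s..t, g τ :=
    intervalIntegral.integral_congr fun τ hτ => hgg τ (uIcc_subset_Icc hs ht hτ)
  rw [← h3, ← h2]
  linear_combination h1

end DuBoisReymond

/-! ### Dominated convergence in L² -/

section DominatedConvergence
variable {α : Type*} [MeasurableSpace α] {μ : Measure α}

theorem tendsto_toLp_of_dominated {f : ℕ → α → ℂ} {g : α → ℂ} {F : α → ℝ}
    (hf : ∀ n, MemLp (f n) 2 μ) (hg : MemLp g 2 μ) (hF : MemLp F 2 μ)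
    (hb : ∀ n x, ‖f n x‖ ≤ F x) (hlim : ∀ x, Tendsto (fun n => f n x) atTop (𝓝 (g x))) :
    Tendsto (fun n => (hf n).toLp (f n)) atTop (𝓝 (hg.toLp g)) := by
  rw [Lp.tendsto_Lp_iff_tendsto_eLpNorm'']
  have hgb : ∀ x, ‖g x‖ ≤ F x := fun x => le_of_tendsto' (hlim x).norm fun n => hb n x
  have h1 : Tendsto (fun n => ∫⁻ x, ‖f n x - g x‖ₑ ^ 2 ∂μ) atTop (𝓝 (∫⁻ _, 0 ∂μ)) := by
    refine tendsto_lintegral_of_dominated_convergence' (fun x => (2 * ‖F x‖ₑ) ^ 2) ?_ ?_ ?_ ?_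
    · exact fun n => ((hf n).1.sub hg.1).enorm.pow_const 2
    · refine fun n => ae_of_all _ fun x => pow_le_pow_left' ?_ 2
      rw [two_mul]
      refine (enorm_sub_le).trans (add_le_add ?_ ?_)
      · exact enorm_le_iff_norm_le.2 ((hb n x).trans (le_abs_self _))
      · exact enorm_le_iff_norm_le.2 ((hgb x).trans (le_abs_self _))
    · simp_rw [mul_pow]
      rw [lintegral_const_mul' _ _ (by finiteness)]
      have := (eLpNorm_lt_top_iff_lintegral_rpow_enorm_lt_top (p := 2) (by norm_num) (by norm_num)).1 hF.2
      simp only [ENNReal.toReal_ofNat, ENNReal.rpow_ofNat] at this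
      exact (ENNReal.mul_lt_top (by finiteness) this).ne
    · refine ae_of_all _ fun x => ?_
      have h : Tendsto (fun n => f n x - g x) atTop (𝓝 0) := by
        simpa using (hlim x).sub_const (g x)
      have h2 := (ENNReal.continuous_pow 2).tendsto 0 |>.comp (by simpa using h.enorm)
      simpa [Function.comp_def] using h2
  rw [lintegral_zero] at h1
  have h2 := (ENNReal.continuous_rpow_const (y := (1 / 2 : ℝ))).tendsto 0 |>.comp h1
  rw [ENNReal.zero_rpow_of_pos (by norm_num)] at h2
  refine h2.congr fun n => ?_
  rw [eLpNorm_eq_lintegral_rpow_enorm_toReal (by norm_num) (by norm_num)]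
  simp only [Function.comp_apply, ENNReal.toReal_ofNat, ENNReal.rpow_ofNat, Pi.sub_apply]

end DominatedConvergence

/-! ### Approximating Schwartz functions in the graph norm of the Hamiltonian -/

section Cutoff
variable {d : ℕ}

theorem memLp_norm_iteratedFDeriv (φ : 𝓢(Space d, ℂ)) (n : ℕ) :
    MemLp (fun x => ‖iteratedFDeriv ℝ n φ x‖) 2 volume := by
  have hc : Continuous fun x => ‖iteratedFDeriv ℝ n φ x‖ :=
    ((φ.smooth ⊤).continuous_iteratedFDeriv (by exact_mod_cast le_top)).norm
  have hi : Integrable fun x => ‖iteratedFDeriv ℝ n φ x‖ := by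
    simpa using φ.integrable_pow_mul_iteratedFDeriv volume 0 n
  obtain ⟨C, hC⟩ := φ.decay 0 n
  rw [memLp_two_iff_integrable_sq hc.aestronglyMeasurable]
  refine (hi.const_mul C).mono' (hc.pow 2).aestronglyMeasurable (ae_of_all _ fun x => ?_)
  have := hC.2 x
  simp only [pow_zero, one_mul] at this
  rw [Real.norm_eq_abs, abs_of_nonneg (by positivity), sq]
  exact mul_le_mul_of_nonneg_right this (norm_nonneg _)

theorem norm_laplacian_le (f : Space d → ℂ) (x : Space d) :
    ‖(Δ f) x‖ ≤ d * ‖iteratedFDeriv ℝ 2 f x‖ := by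
  rw [laplacian_eq_iteratedFDeriv_stdOrthonormalBasis]
  refine (norm_sum_le _ _).trans ?_
  have : ∀ i ∈ (Finset.univ : Finset (Fin (Module.finrank ℝ (Space d)))),
      ‖iteratedFDeriv ℝ 2 f x ![stdOrthonormalBasis ℝ (Space d) i, stdOrthonormalBasis ℝ (Space d) i]‖
        ≤ ‖iteratedFDeriv ℝ 2 f x‖ := fun i _ => by
    refine (ContinuousMultilinearMap.le_opNorm _ _).trans ?_
    simp
  refine (Finset.sum_le_sum this).trans ?_
  simp

/-- Smooth cutoff functions at scale `n + 1`. -/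
theorem exists_cutoff (d : ℕ) : ∃ (ζ : ℕ → Space d → ℝ) (Z : ℝ), 0 ≤ Z ∧
    (∀ n, ContDiff ℝ ∞ (ζ n)) ∧ (∀ n, HasCompactSupport (ζ n)) ∧
    (∀ n, ∀ i ≤ 2, ∀ x, ‖iteratedFDeriv ℝ i (ζ n) x‖ ≤ Z) ∧
    ∀ x, ∀ᶠ n in atTop, ∀ᶠ y in 𝓝 x, ζ n y = 1 := by
  let β : ContDiffBump (0 : Space d) := ⟨1, 2, by norm_num, by norm_num⟩
  have hβ : ContDiff ℝ ∞ β := β.contDiff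
  have hbd : ∀ i : ℕ, ∃ C, ∀ x, ‖iteratedFDeriv ℝ i β x‖ ≤ C := fun i => by
    have hc : Continuous (iteratedFDeriv ℝ i β) :=
      hβ.continuous_iteratedFDeriv (by exact_mod_cast le_top)
    exact hc.bounded_above_of_compact_support (β.hasCompactSupport.iteratedFDeriv i)
  choose C hC using hbd
  have hCpos : ∀ i, 0 ≤ C i := fun i => (norm_nonneg _).trans (hC i 0)
  set ε : ℕ → ℝ := fun n => 1 / ((n : ℝ) + 1) with hε
  have hεpos : ∀ n, 0 < ε n := fun n => by positivity
  have hεle : ∀ n, ε n ≤ 1 := fun n => by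
    rw [hε]
    simp only
    rw [div_le_one (by positivity)]
    linarith [Nat.cast_nonneg (α := ℝ) n]
  set L : ℕ → Space d →L[ℝ] Space d := fun n => ε n • ContinuousLinearMap.id ℝ (Space d) with hL
  have hLn : ∀ n, ‖L n‖ ≤ 1 := fun n => by
    refine ContinuousLinearMap.opNorm_le_bound _ zero_le_one fun x => ?_
    simp only [hL, smul_apply, ContinuousLinearMap.id_apply, norm_smul,
      Real.norm_eq_abs, abs_of_pos (hεpos n)]
    exact mul_le_mul_of_nonneg_right (hεle n) (norm_nonneg _)
  have hLa : ∀ n x, L n x = ε n • x := fun n x => rfl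
  -- The dilations L n are contractions, so each derivative of the rescaled bump is bounded by the
  -- same derivative of β; the sum of the three bounds covers orders 0, 1 and 2 at once.
  refine ⟨fun n => β ∘ L n, C 0 + C 1 + C 2, by linarith [hCpos 0, hCpos 1, hCpos 2], ?_, ?_, ?_, ?_⟩
  · exact fun n => hβ.comp (L n).contDiff
  · intro n
    exact β.hasCompactSupport.comp_homeomorph (Homeomorph.smulOfNeZero (ε n) (hεpos n).ne')
  · intro n i hi x
    rw [ContinuousLinearMap.iteratedFDeriv_comp_right (L n) hβ x (by exact_mod_cast le_top)]
    refine (ContinuousMultilinearMap.norm_compContinuousLinearMap_le _ _).trans ?_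
    have h1 : ∏ _j : Fin i, ‖L n‖ ≤ 1 :=
      Finset.prod_le_one (fun _ _ => norm_nonneg _) fun _ _ => hLn n
    have h2 : ‖iteratedFDeriv ℝ i β (L n x)‖ * ∏ _j : Fin i, ‖L n‖ ≤ C i :=
      (mul_le_of_le_one_right (norm_nonneg _) h1).trans (hC i _)
    refine h2.trans ?_
    interval_cases i <;> linarith [hCpos 0, hCpos 1, hCpos 2]
  · intro x
    have h1 : Tendsto (fun n : ℕ => ε n * ‖x‖) atTop (𝓝 (0 * ‖x‖)) :=
      tendsto_one_div_add_atTop_nhds_zero_nat.mul_const _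
    rw [zero_mul] at h1
    filter_upwards [h1.eventually (gt_mem_nhds zero_lt_one)] with n hn
    have h2 : Continuous fun y : Space d => ε n * ‖y‖ := by fun_prop
    filter_upwards [h2.continuousAt.eventually (gt_mem_nhds hn)] with y hy
    refine β.one_of_mem_closedBall ?_
    rw [mem_closedBall_zero_iff, hLa, norm_smul, Real.norm_eq_abs, abs_of_pos (hεpos n)]
    exact hy.le

theorem memLp_laplacian_schwartz (φ : 𝓢(Space d, ℂ)) : MemLp (Δ (φ : Space d → ℂ)) 2 volume := by
  have h := (Δ φ : 𝓢(Space d, ℂ)).memLp 2 volume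
  rwa [show ((Δ φ : 𝓢(Space d, ℂ)) : Space d → ℂ) = Δ (φ : Space d → ℂ) from
    funext fun x => SchwartzMap.laplacian_apply φ x] at h

theorem memLp_hamiltonian_schwartz (m ħ : ℝ) (V : Space d →ᵇ ℝ) (φ : 𝓢(Space d, ℂ)) :
    MemLp (hamiltonian m ħ V φ) 2 volume := by
  have h1 := (memLp_laplacian_schwartz φ).const_mul (-((ħ ^ 2 / (2 * m) : ℝ) : ℂ))
  have h2 : MemLp (fun x => (V x : ℂ) * φ x) 2 volume :=
    (φ.memLp 2 volume).of_le_mul (c := ‖V‖)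
      ((Complex.continuous_ofReal.comp V.continuous).mul φ.continuous).aestronglyMeasurable
      (ae_of_all _ fun x => by
        rw [norm_mul, Complex.norm_real]
        exact mul_le_mul_of_nonneg_right (V.norm_coe_le_norm x) (norm_nonneg _))
  exact h1.add h2

/-- The vectors `φ`, `φH` are limits of `φₙ`, `H φₙ` for test functions `φₙ`. -/
def IsHamPair (m ħ : ℝ) (V : Space d →ᵇ ℝ) (φ φH : L2 d) : Prop :=
  ∃ f : ℕ → 𝓓((⊤ : TopologicalSpace.Opens (Space d)), ℂ),
    Tendsto (fun n => testVec (f n)) atTop (𝓝 φ) ∧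
      Tendsto (fun n => hamVec m ħ V (f n)) atTop (𝓝 φH)

/-- Cutoffs agree with 1 near each point eventually, and the Leibniz rule gives a square-integrable
majorant for their Laplacians. Schwartz vectors are needed because the free evolution destroys
compact support in position. -/
theorem isHamPair_schwartz (m ħ : ℝ) (V : Space d →ᵇ ℝ) (φ : 𝓢(Space d, ℂ)) :
    IsHamPair m ħ V (φ.toLp 2) ((memLp_hamiltonian_schwartz m ħ V φ).toLp _) := by
  obtain ⟨ζ, Z, hZ, hζ, hζc, hζb, hζ1⟩ := exists_cutoff d
  set f : ℕ → 𝓓((⊤ : TopologicalSpace.Opens (Space d)), ℂ) := fun n =>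
    ⟨fun x => ζ n x • φ x, (hζ n).smul (φ.smooth ⊤), (hζc n).smul_right, fun _ _ => trivial⟩ with hf
  have hfx : ∀ n, (f n : Space d → ℂ) = fun x => ζ n x • φ x := fun n => rfl
  have hζ0 : ∀ n x, |ζ n x| ≤ Z := fun n x => by
    simpa using hζb n 0 (by norm_num) x
  have hev : ∀ x, ∀ᶠ n in atTop, (f n : Space d → ℂ) =ᶠ[𝓝 x] φ := fun x => by
    filter_upwards [hζ1 x] with n hn
    filter_upwards [hn] with y hy
    simp only [hfx, hy, one_smul]
  have hfb : ∀ n x, ‖f n x‖ ≤ Z * ‖φ x‖ := fun n x => by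
    rw [hfx, norm_smul]
    exact mul_le_mul_of_nonneg_right (hζ0 n x) (norm_nonneg _)
  have hφn : MemLp (fun x => ‖φ x‖) 2 volume := (φ.memLp 2 volume).norm
  refine ⟨f, ?_, ?_⟩
  · refine tendsto_toLp_of_dominated (F := fun x => Z * ‖φ x‖) (fun n => memLp_test (f n))
      (φ.memLp 2 volume) (hφn.const_mul Z) hfb fun x => ?_
    refine tendsto_const_nhds.congr' ?_
    filter_upwards [hev x] with n hn
    exact hn.self_of_nhds.symm
  · set S : Space d → ℝ := fun x => ∑ i ∈ Finset.range (2 + 1),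
      ((2 : ℕ).choose i : ℝ) * Z * ‖iteratedFDeriv ℝ (2 - i) φ x‖ with hS
    have hSm : MemLp S 2 volume :=
      memLp_finsetSum _ fun i _ => (memLp_norm_iteratedFDeriv φ (2 - i)).const_mul _
    set c : ℝ := |ħ ^ 2 / (2 * m)| with hc
    refine tendsto_toLp_of_dominated
      (F := fun x => c * (d * S x) + ‖V‖ * (Z * ‖φ x‖))
      (fun n => memLp_hamiltonian m ħ V (f n)) (memLp_hamiltonian_schwartz m ħ V φ)
      (((hSm.const_mul _).const_mul _).add ((hφn.const_mul Z).const_mul _)) (fun n x => ?_) fun x => ?_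
    · rw [hamiltonian]
      refine (norm_add_le _ _).trans (add_le_add ?_ ?_)
      · rw [norm_mul, norm_neg, Complex.norm_real, Real.norm_eq_abs]
        refine mul_le_mul_of_nonneg_left ((norm_laplacian_le _ _).trans ?_) (abs_nonneg _)
        refine mul_le_mul_of_nonneg_left ?_ (Nat.cast_nonneg d)
        rw [hfx]
        refine (norm_iteratedFDeriv_smul_le (hζ n) (φ.smooth ⊤) x (n := 2)
          (by norm_cast)).trans ?_
        refine Finset.sum_le_sum fun i hi => ?_
        refine mul_le_mul_of_nonneg_right (mul_le_mul_of_nonneg_left ?_ (Nat.cast_nonneg _))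
          (norm_nonneg _)
        exact hζb n i (by simpa [Nat.lt_succ_iff] using hi) x
      · rw [norm_mul, Complex.norm_real]
        exact mul_le_mul (V.norm_coe_le_norm x) (hfb n x) (norm_nonneg _) (norm_nonneg _)
    · refine tendsto_const_nhds.congr' ?_
      filter_upwards [hev x] with n hn
      rw [hamiltonian, hamiltonian, hn.self_of_nhds, (laplacian_congr_nhds hn).self_of_nhds]

end Cutoff

/-! ### The von Neumann equation tested on a larger class of vectors -/

section ExtendedEquation
variable {d : ℕ}

/-- For test functions the weak equation integrates in time, since both sides are continuous. The
integrated form involves only φ and Hφ, so it survives joint L² limits; the uniform bound on R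
supplies the dominating constant. -/
theorem IsWeakSolution.sub_eq_integral {m ħ T : ℝ} (hħ : 0 < ħ) (hT : 0 < T) {V : Space d →ᵇ ℝ}
    {R : ℝ → L2 d →L[ℂ] L2 d} (hW : IsWeakSolution m ħ T V R) (hc : IsWOTContinuous T R)
    {B : ℝ} (hB : ∀ t ∈ Icc (-T) T, ‖R t‖ ≤ B) {φ φH χ χH : L2 d}
    (h1 : IsHamPair m ħ V φ φH) (h2 : IsHamPair m ħ V χ χH) :
    ∀ s ∈ Icc (-T) T, ∀ t ∈ Icc (-T) T, ⟪φ, R t χ⟫_ℂ - ⟪φ, R s χ⟫_ℂ =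
      ∫ τ in s..t, (Complex.I * ħ)⁻¹ * (⟪φH, R τ χ⟫_ℂ - ⟪φ, R τ χH⟫_ℂ) := by
  have hIħ : Complex.I * (ħ : ℂ) ≠ 0 :=
    mul_ne_zero Complex.I_ne_zero (Complex.ofReal_ne_zero.2 hħ.ne')
  have key : ∀ (f g : 𝓓((⊤ : TopologicalSpace.Opens (Space d)), ℂ)),
      ∀ s ∈ Icc (-T) T, ∀ t ∈ Icc (-T) T,
      ⟪testVec f, R t (testVec g)⟫_ℂ - ⟪testVec f, R s (testVec g)⟫_ℂ =
      ∫ τ in s..t, (Complex.I * ħ)⁻¹ * (⟪hamVec m ħ V f, R τ (testVec g)⟫_ℂ -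
        ⟪testVec f, R τ (hamVec m ħ V g)⟫_ℂ) := fun f g => by
    refine sub_eq_integral_of_weak_deriv hT (hc.continuousOn_inner _ _)
      (continuousOn_const.mul ((hc.continuousOn_inner _ _).sub (hc.continuousOn_inner _ _)))
      fun η => ?_
    have h := hW f g η
    have e : ∀ t, η t * ((Complex.I * ħ)⁻¹ * (⟪hamVec m ħ V f, R t (testVec g)⟫_ℂ -
        ⟪testVec f, R t (hamVec m ħ V g)⟫_ℂ)) = (Complex.I * ħ)⁻¹ * (η t *
        (⟪hamVec m ħ V f, R t (testVec g)⟫_ℂ - ⟪testVec f, R t (hamVec m ħ V g)⟫_ℂ)) :=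
      fun t => by ring
    simp_rw [e]
    rw [integral_const_mul, ← h, neg_mul, mul_neg, inv_mul_cancel_left₀ hIħ]
  intro s hs t ht
  obtain ⟨f, hf1, hf2⟩ := h1
  obtain ⟨g, hg1, hg2⟩ := h2
  have hlim : ∀ {a b : ℕ → L2 d} {a' b' : L2 d}, Tendsto a atTop (𝓝 a') → Tendsto b atTop (𝓝 b') →
      ∀ τ, Tendsto (fun n => ⟪a n, R τ (b n)⟫_ℂ) atTop (𝓝 ⟪a', R τ b'⟫_ℂ) :=
    fun ha hb τ => ha.inner (((R τ).continuous.tendsto _).comp hb)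
  have hbd : ∀ {a b : ℕ → L2 d} {a' b' : L2 d}, Tendsto a atTop (𝓝 a') → Tendsto b atTop (𝓝 b') →
      ∃ C, ∀ n, ∀ τ ∈ Icc (-T) T, ‖⟪a n, R τ (b n)⟫_ℂ‖ ≤ C := fun {a b a' b'} ha hb => by
    obtain ⟨Ca, hCa⟩ := ha.norm.bddAbove_range
    obtain ⟨Cb, hCb⟩ := hb.norm.bddAbove_range
    refine ⟨Ca * (B * Cb), fun n τ hτ => (norm_inner_le_norm _ _).trans ?_⟩
    have h1 : ‖a n‖ ≤ Ca := hCa ⟨n, rfl⟩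
    have h2 : ‖b n‖ ≤ Cb := hCb ⟨n, rfl⟩
    have h3 : 0 ≤ B := (norm_nonneg _).trans (hB τ hτ)
    refine mul_le_mul h1 (((R τ).le_opNorm _).trans ?_) (norm_nonneg _) ((norm_nonneg _).trans h1)
    exact mul_le_mul (hB τ hτ) h2 (norm_nonneg _) h3
  refine tendsto_nhds_unique ((hlim hf1 hg1 t).sub (hlim hf1 hg1 s)) ?_
  simp_rw [fun n => key (f n) (g n) s hs t ht]
  obtain ⟨C1, hC1⟩ := hbd hf2 hg1
  obtain ⟨C2, hC2⟩ := hbd hf1 hg2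
  have hsub : uIoc s t ⊆ Icc (-T) T := uIoc_subset_uIcc.trans (uIcc_subset_Icc hs ht)
  refine intervalIntegral.tendsto_integral_filter_of_dominated_convergence
    (fun _ => ‖(Complex.I * (ħ : ℂ))⁻¹‖ * (C1 + C2)) ?_ ?_ ?_ ?_
  · refine Eventually.of_forall fun n => ContinuousOn.aestronglyMeasurable ?_ measurableSet_uIoc
    exact (continuousOn_const.mul ((hc.continuousOn_inner _ _).sub
      (hc.continuousOn_inner _ _))).mono hsub
  · refine Eventually.of_forall fun n => ae_of_all _ fun τ hτ => ?_
    rw [norm_mul]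
    refine mul_le_mul_of_nonneg_left ((norm_sub_le _ _).trans ?_) (norm_nonneg _)
    exact add_le_add (hC1 n τ (hsub hτ)) (hC2 n τ (hsub hτ))
  · exact intervalIntegrable_const
  · exact ae_of_all _ fun τ _ => ((hlim hf2 hg1 τ).sub (hlim hf1 hg2 τ)).const_mul _

theorem IsWeakSolution.hasDerivAt_inner {m ħ T : ℝ} (hħ : 0 < ħ) (hT : 0 < T) {V : Space d →ᵇ ℝ}
    {R : ℝ → L2 d →L[ℂ] L2 d} (hW : IsWeakSolution m ħ T V R) (hc : IsWOTContinuous T R)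
    {B : ℝ} (hB : ∀ t ∈ Icc (-T) T, ‖R t‖ ≤ B) {φ φH χ χH : L2 d}
    (h1 : IsHamPair m ħ V φ φH) (h2 : IsHamPair m ħ V χ χH) {t : ℝ} (ht : t ∈ Ioo (-T) T) :
    HasDerivAt (fun t => ⟪φ, R t χ⟫_ℂ) ((Complex.I * ħ)⁻¹ * (⟪φH, R t χ⟫_ℂ - ⟪φ, R t χH⟫_ℂ)) t := by
  set g : ℝ → ℂ := fun τ => (Complex.I * ħ)⁻¹ * (⟪φH, R τ χ⟫_ℂ - ⟪φ, R τ χH⟫_ℂ) with hg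
  have hgc : ContinuousOn g (Icc (-T) T) :=
    continuousOn_const.mul ((hc.continuousOn_inner _ _).sub (hc.continuousOn_inner _ _))
  have h0 : (0 : ℝ) ∈ Icc (-T) T := ⟨by linarith, hT.le⟩
  have hd : HasDerivAt (fun u => ∫ τ in (0 : ℝ)..u, g τ) (g t) t := by
    refine intervalIntegral.integral_hasDerivAt_right ?_ ?_ ?_
    · exact (hgc.mono (uIcc_subset_Icc h0 (Ioo_subset_Icc_self ht))).intervalIntegrable
    · exact (hgc.mono Ioo_subset_Icc_self).stronglyMeasurableAtFilter isOpen_Ioo t ht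
    · exact hgc.continuousAt (Icc_mem_nhds ht.1 ht.2)
  have hd' := hd.add_const ⟪φ, R 0 χ⟫_ℂ
  refine hd'.congr_of_eventuallyEq ?_
  filter_upwards [isOpen_Ioo.mem_nhds ht] with u hu
  rw [← hW.sub_eq_integral hħ hT hc hB h1 h2 0 h0 u (Ioo_subset_Icc_self hu), sub_add_cancel]

end ExtendedEquation

/-! ### Removing the kinetic energy -/

section InteractionPicture
variable {d : ℕ}

/-- Multiplication by the potential. -/
noncomputable def potMul (V : Space d →ᵇ ℝ) : L2 d →L[ℂ] L2 d :=
  mulCLM (fun x => (V x : ℂ)) (Complex.continuous_ofReal.comp V.continuous).aestronglyMeasurable ‖V‖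
    fun x => by rw [Complex.norm_real]; exact V.norm_coe_le_norm x

/-- The commutator with the potential, acting on kernels. -/
noncomputable def commMul (V : Space d →ᵇ ℝ) : KernelSpace d →L[ℂ] KernelSpace d :=
  mulCLM (fun z => (V z.1 : ℂ) - V z.2)
    (((Complex.continuous_ofReal.comp V.continuous).comp continuous_fst).sub
      ((Complex.continuous_ofReal.comp V.continuous).comp continuous_snd)).aestronglyMeasurable
    (2 * ‖V‖) fun z => by
      refine (norm_sub_le _ _).trans ?_
      rw [Complex.norm_real, Complex.norm_real, two_mul]
      exact add_le_add (V.norm_coe_le_norm _) (V.norm_coe_le_norm _)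

theorem coeFn_potMul (V : Space d →ᵇ ℝ) (f : L2 d) :
    potMul V f =ᵐ[volume] fun x => (V x : ℂ) * f x := coeFn_mulCLM _ _ f

/-- On kernels the commutator with V is multiplication by V(X) - V(Y), a bounded operator of norm at
most 2‖V‖; this is its action on |a⟩⟨b|. -/
theorem commMul_tens (V : Space d →ᵇ ℝ) (a b : L2 d) :
    commMul V (tens a b) = tens (potMul V a) b - tens a (potMul V b) := by
  refine Lp.ext ?_
  have h1 := (Measure.quasiMeasurePreserving_fst (μ := (volume : Measure (Space d)))
    (ν := (volume : Measure (Space d)))).ae (coeFn_potMul V a)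
  have h2 := (Measure.quasiMeasurePreserving_snd (μ := (volume : Measure (Space d)))
    (ν := (volume : Measure (Space d)))).ae (coeFn_potMul V b)
  have h3 : commMul V (tens a b) =ᵐ[volume] fun z => ((V z.1 : ℂ) - V z.2) * tens a b z :=
    coeFn_mulCLM _ _ _
  filter_upwards [h1, h2, h3, coeFn_tens a b, coeFn_tens (potMul V a) b, coeFn_tens a (potMul V b),
    Lp.coeFn_sub (tens (potMul V a) b) (tens a (potMul V b))] with z a1 a2 a3 a4 a5 a6 a7
  rw [a3, a4, a7, Pi.sub_apply, a5, a6, a1, a2, map_mul, Complex.conj_ofReal]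
  ring

/-- The vectors represented by smooth functions of compact support. -/
def smoothCompact (d : ℕ) : Set (L2 d) :=
  {f | ∃ g : Space d → ℂ, f =ᵐ[volume] g ∧ HasCompactSupport g ∧ ContDiff ℝ ∞ g}

theorem dense_smoothCompact : Dense (smoothCompact d) :=
  Lp.dense_hasCompactSupport_contDiff (by norm_num)

theorem exists_norm_pow_mul {f : L2 d} (hf : f ∈ smoothCompact d) (k : ℕ) :
    ∃ q : L2 d, q =ᵐ[volume] fun p => ((‖p‖ ^ (2 * k) : ℝ) : ℂ) * f p := by
  obtain ⟨g, hfg, hgc, hg⟩ := hf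
  have hc : Continuous fun p : Space d => ((‖p‖ ^ (2 * k) : ℝ) : ℂ) * g p :=
    (Complex.continuous_ofReal.comp (continuous_norm.pow _)).mul hg.continuous
  have hm : MemLp (fun p : Space d => ((‖p‖ ^ (2 * k) : ℝ) : ℂ) * g p) 2 volume :=
    hc.memLp_of_hasCompactSupport hgc.mul_left
  refine ⟨hm.toLp _, ?_⟩
  filter_upwards [hm.coeFn_toLp, hfg] with p h1 h2
  rw [h1, h2]

/-- For f smooth and compactly supported in momentum, the evolved vector is the inverse Fourier
transform of a Schwartz function, and the Laplacian becomes multiplication by -(2π)²‖p‖². -/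
theorem isHamPair_freeEvol (m ħ : ℝ) (V : Space d →ᵇ ℝ) {f q : L2 d} (hf : f ∈ smoothCompact d)
    (hq : q =ᵐ[volume] fun p => ((‖p‖ ^ 2 : ℝ) : ℂ) * f p) (s : ℝ) :
    IsHamPair m ħ V (freeEvol s f)
      (((ħ ^ 2 / (2 * m) * (2 * Real.pi) ^ 2 : ℝ) : ℂ) • freeEvol s q + potMul V (freeEvol s f)) := by
  obtain ⟨g, hfg, hgc, hg⟩ := hf
  have hsc : HasCompactSupport fun p => phase s p * g p := hgc.mul_left
  have hsd : ContDiff ℝ ∞ fun p => phase s p * g p := (contDiff_phase s).mul hg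
  set Θ : 𝓢(Space d, ℂ) := hsc.toSchwartzMap hsd with hΘ
  have hΘx : ∀ p, Θ p = phase s p * g p := fun p => rfl
  set φ : 𝓢(Space d, ℂ) := 𝓕⁻ Θ with hφ
  have e1 : Θ.toLp 2 volume = phaseMul s f := by
    refine Lp.ext ?_
    filter_upwards [Θ.coeFn_toLp 2 volume, coeFn_phaseMul s f, hfg] with p h1 h2 h3
    rw [h1, h2, h3, hΘx]
  have e2 : φ.toLp 2 volume = freeEvol s f := by
    rw [freeEvol_apply, ← e1, hφ, SchwartzMap.toLp_fourierInv_eq]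
  have htg : (fun x : Space d => ‖x‖ ^ 2).HasTemperateGrowth := by fun_prop
  have htg' : (fun x : Space d => (‖x‖ ^ 2 : ℝ)).HasTemperateGrowth := htg
  set Ψ : 𝓢(Space d, ℂ) := SchwartzMap.smulLeftCLM ℂ (fun x : Space d => ‖x‖ ^ 2) Θ with hΨ
  have e3 : Δ φ = -(2 * Real.pi) ^ 2 • 𝓕⁻ Ψ := by
    rw [SchwartzMap.laplacian_eq_fourierMultiplierCLM, SchwartzMap.fourierMultiplierCLM_apply, hφ,
      fourier_fourierInv_eq]
  have e4 : Ψ.toLp 2 volume = phaseMul s q := by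
    refine Lp.ext ?_
    filter_upwards [Ψ.coeFn_toLp 2 volume, coeFn_phaseMul s q, hfg, hq] with p h1 h2 h3 h4
    rw [h1, h2, h4, h3, hΨ, SchwartzMap.smulLeftCLM_apply_apply htg', hΘx, Complex.real_smul]
    ring
  have e5 : (𝓕⁻ Ψ).toLp 2 volume = freeEvol s q := by
    rw [freeEvol_apply, ← e4, SchwartzMap.toLp_fourierInv_eq]
  have h := isHamPair_schwartz m ħ V φ
  rw [e2] at h
  convert h using 1
  refine Lp.ext ?_
  have c1 := (𝓕⁻ Ψ).coeFn_toLp 2 volume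
  have c2 := φ.coeFn_toLp 2 volume
  rw [e5] at c1
  rw [e2] at c2
  filter_upwards [c1, c2, (memLp_hamiltonian_schwartz m ħ V φ).coeFn_toLp,
    coeFn_potMul V (freeEvol s f),
    Lp.coeFn_add (((ħ ^ 2 / (2 * m) * (2 * Real.pi) ^ 2 : ℝ) : ℂ) • freeEvol s q)
      (potMul V (freeEvol s f)),
    Lp.coeFn_smul ((ħ ^ 2 / (2 * m) * (2 * Real.pi) ^ 2 : ℝ) : ℂ) (freeEvol s q)]
    with x a1 a2 a3 a4 a5 a6
  rw [a5, Pi.add_apply, a6, Pi.smul_apply, a4, a3, a1, a2, hamiltonian,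
    ← SchwartzMap.laplacian_apply, e3, smul_apply, Complex.real_smul, smul_eq_mul]
  push_cast
  ring

/-- Weak operator convergence does not commute with moving vectors in general; it does when the
operators are eventually bounded and the vectors converge in norm. -/
theorem tendsto_inner_of_wot {R : ℝ → L2 d →L[ℂ] L2 d} {t B : ℝ} {l : Filter ℝ}
    (hR : ∀ a b, Tendsto (fun s => ⟪a, R s b⟫_ℂ) l (𝓝 ⟪a, R t b⟫_ℂ))
    (hB : ∀ᶠ s in l, ‖R s‖ ≤ B) {a b : ℝ → L2 d} {a' b' : L2 d} (ha : Tendsto a l (𝓝 a'))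
    (hb : Tendsto b l (𝓝 b')) : Tendsto (fun s => ⟪a s, R s (b s)⟫_ℂ) l (𝓝 ⟪a', R t b'⟫_ℂ) := by
  have h1 : Tendsto (fun s => ⟪a s - a', R s (b s)⟫_ℂ) l (𝓝 0) := by
    refine squeeze_zero_norm' (a := fun s => ‖a s - a'‖ * (B * ‖b s‖)) ?_ ?_
    · filter_upwards [hB] with s hs
      refine (norm_inner_le_norm _ _).trans (mul_le_mul_of_nonneg_left ?_ (norm_nonneg _))
      exact ((R s).le_opNorm _).trans (mul_le_mul_of_nonneg_right hs (norm_nonneg _))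
    · have := (tendsto_iff_norm_sub_tendsto_zero.1 ha).mul (hb.norm.const_mul B)
      simpa using this
  have h2 : Tendsto (fun s => ⟪a', R s (b s - b')⟫_ℂ) l (𝓝 0) := by
    refine squeeze_zero_norm' (a := fun s => ‖a'‖ * (B * ‖b s - b'‖)) ?_ ?_
    · filter_upwards [hB] with s hs
      refine (norm_inner_le_norm _ _).trans (mul_le_mul_of_nonneg_left ?_ (norm_nonneg _))
      exact ((R s).le_opNorm _).trans (mul_le_mul_of_nonneg_right hs (norm_nonneg _))
    · have := ((tendsto_iff_norm_sub_tendsto_zero.1 hb).const_mul B).const_mul ‖a'‖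
      simpa using this
  have h3 := (h1.add h2).add (hR a' b')
  rw [add_zero, zero_add] at h3
  refine h3.congr fun s => ?_
  rw [inner_sub_left, map_sub, inner_sub_right]
  ring

theorem real_smul_eq_complex_smul (r : ℝ) (x : L2 d) : r • x = (r : ℂ) • x := by
  refine Lp.ext ?_
  filter_upwards [Lp.coeFn_smul r x, Lp.coeFn_smul (r : ℂ) x] with z h1 h2
  rw [h1, h2, Pi.smul_apply, Pi.smul_apply, Complex.real_smul, smul_eq_mul]

/-- A product rule in which R need not be differentiable. The slope splits into one term with the
slope of a, one with the slope of b, and the slope of the matrix element at vectors frozen at time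
t; weak continuity suffices for the first two. -/
theorem hasDerivAt_inner_of_wot {R : ℝ → L2 d →L[ℂ] L2 d} {t B : ℝ}
    (hR : ∀ a b, Tendsto (fun s => ⟪a, R s b⟫_ℂ) (𝓝 t) (𝓝 ⟪a, R t b⟫_ℂ))
    (hB : ∀ᶠ s in 𝓝 t, ‖R s‖ ≤ B) {a b : ℝ → L2 d} {a' b' : L2 d} {c : ℂ} (ha : HasDerivAt a a' t)
    (hb : HasDerivAt b b' t) (hc : HasDerivAt (fun s => ⟪a t, R s (b t)⟫_ℂ) c t) :
    HasDerivAt (fun s => ⟪a s, R s (b s)⟫_ℂ) (⟪a', R t (b t)⟫_ℂ + ⟪a t, R t b'⟫_ℂ + c) t := by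
  have hle : 𝓝[≠] t ≤ 𝓝 t := nhdsWithin_le_nhds
  have hR' : ∀ a b, Tendsto (fun s => ⟪a, R s b⟫_ℂ) (𝓝[≠] t) (𝓝 ⟪a, R t b⟫_ℂ) :=
    fun a b => (hR a b).mono_left hle
  have hB' : ∀ᶠ s in 𝓝[≠] t, ‖R s‖ ≤ B := hle hB
  have h1 := tendsto_inner_of_wot hR' hB' (hasDerivAt_iff_tendsto_slope.1 ha)
    (hb.continuousAt.tendsto.mono_left hle)
  have h2 := tendsto_inner_of_wot hR' hB' (tendsto_const_nhds (x := a t))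
    (hasDerivAt_iff_tendsto_slope.1 hb)
  have h3 := (h1.add h2).add (hasDerivAt_iff_tendsto_slope.1 hc)
  rw [hasDerivAt_iff_tendsto_slope]
  refine h3.congr fun s => ?_
  simp only [slope_def_module, real_smul_eq_complex_smul, Complex.real_smul, map_smul, map_sub, inner_smul_left,
    inner_smul_right, inner_sub_left, inner_sub_right, Complex.conj_ofReal]
  ring

/-- The rate of the free phase: `exp(-i t Δ ħ / 2m)` is multiplication by the phase at
`freeRate m ħ * t`. -/
noncomputable def freeRate (m ħ : ℝ) : ℝ := 2 * Real.pi ^ 2 * ħ / m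

/-- The derivatives of the two freely evolving vectors cancel the kinetic part of the commutator
exactly, leaving only V. -/
theorem IsWeakSolution.hasDerivAt_interaction {m ħ T : ℝ} (hm : 0 < m) (hħ : 0 < ħ) (hT : 0 < T)
    {V : Space d →ᵇ ℝ} {R : ℝ → L2 d →L[ℂ] L2 d} (hW : IsWeakSolution m ħ T V R)
    (hc : IsWOTContinuous T R) {B : ℝ} (hB : ∀ t ∈ Icc (-T) T, ‖R t‖ ≤ B) {f g : L2 d}
    (hf : f ∈ smoothCompact d) (hg : g ∈ smoothCompact d) {t : ℝ} (ht : t ∈ Ioo (-T) T) :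
    HasDerivAt (fun t => ⟪freeEvol (freeRate m ħ * t) f, R t (freeEvol (freeRate m ħ * t) g)⟫_ℂ)
      ((Complex.I * ħ)⁻¹ * (⟪potMul V (freeEvol (freeRate m ħ * t) f),
          R t (freeEvol (freeRate m ħ * t) g)⟫_ℂ -
        ⟪freeEvol (freeRate m ħ * t) f, R t (potMul V (freeEvol (freeRate m ħ * t) g))⟫_ℂ)) t := by
  set α := freeRate m ħ with hα
  have hnh : Icc (-T) T ∈ 𝓝 t := Icc_mem_nhds ht.1 ht.2
  obtain ⟨qf, hqf⟩ := exists_norm_pow_mul hf 1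
  obtain ⟨qf2, hqf2⟩ := exists_norm_pow_mul hf 2
  obtain ⟨qg, hqg⟩ := exists_norm_pow_mul hg 1
  obtain ⟨qg2, hqg2⟩ := exists_norm_pow_mul hg 2
  have hlin : HasDerivAt (fun t : ℝ => α * t) α t := by
    simpa using (hasDerivAt_id t).const_mul α
  have da := (hasDerivAt_freeEvol hqf hqf2 (α * t)).scomp t hlin
  have db := (hasDerivAt_freeEvol hqg hqg2 (α * t)).scomp t hlin
  have dc := hW.hasDerivAt_inner hħ hT hc hB (isHamPair_freeEvol m ħ V hf hqf (α * t))
    (isHamPair_freeEvol m ħ V hg hqg (α * t)) ht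
  have h := hasDerivAt_inner_of_wot (R := R) (t := t) (B := B)
    (fun a b => ((hc.continuousOn_inner a b).continuousAt hnh).tendsto)
    (by filter_upwards [hnh] with s hs using hB s hs) da db dc
  refine h.congr_deriv ?_
  have hħ' : (ħ : ℂ) ≠ 0 := Complex.ofReal_ne_zero.2 hħ.ne'
  have hm' : (m : ℂ) ≠ 0 := Complex.ofReal_ne_zero.2 hm.ne'
  have hI : (Complex.I * (ħ : ℂ))⁻¹ = -Complex.I / ħ := by
    rw [mul_inv, Complex.inv_I]; rfl
  -- The rate is the kinetic symbol (ħ²/2m)(2π)² divided by ħ, the (2π)² coming from the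
  -- normalisation of the Fourier transform.
  have hαc : (α : ℂ) = (ħ : ℂ)⁻¹ * ((ħ ^ 2 / (2 * m) * (2 * Real.pi) ^ 2 : ℝ) : ℂ) := by
    rw [hα, freeRate]
    push_cast
    field_simp
  simp only [Function.comp_apply, real_smul_eq_complex_smul, map_smul, map_add, map_neg,
    inner_smul_left, inner_smul_right, inner_add_left, inner_add_right, inner_neg_left, inner_neg_right,
    Complex.conj_ofReal, Complex.conj_I, hI]
  rw [hαc]
  field_simp
  ring

/-- The kernel of a density operator in the interaction picture. -/
theorem exists_interaction_kernel {R : L2 d →L[ℂ] L2 d} {ι : Type} {g : ι → L2 d}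
    {κ : KernelSpace d} (hg : HasSum (fun i => ‖g i‖ ^ 2) 1)
    (hκ : HasSum (fun i => tens (g i) (g i)) κ)
    (hin : ∀ a b, ⟪tens a b, κ⟫_ℂ = ⟪a, R b⟫_ℂ)
    (hR : ∀ a b, HasSum (fun i => ⟪a, g i⟫_ℂ * ⟪g i, b⟫_ℂ) ⟪a, R b⟫_ℂ) (s : ℝ) :
    ∃ F : KernelSpace d, HasSum (fun i => tens (freeEvolInv s (g i)) (freeEvolInv s (g i))) F ∧
      (∀ a b, ⟪tens a b, F⟫_ℂ = ⟪freeEvol s a, R (freeEvol s b)⟫_ℂ) ∧ ‖F‖ = ‖κ‖ := by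
  have hs : Summable fun i => tens (freeEvolInv s (g i)) (freeEvolInv s (g i)) := by
    refine Summable.of_norm ?_
    simp_rw [norm_tens, norm_freeEvolInv, ← sq]
    exact hg.summable
  have hF := hs.hasSum
  set F := ∑' i, tens (freeEvolInv s (g i)) (freeEvolInv s (g i)) with hFdef
  have hinF : ∀ a b, ⟪tens a b, F⟫_ℂ = ⟪freeEvol s a, R (freeEvol s b)⟫_ℂ := fun a b => by
    refine ((innerSL ℂ (tens a b)).hasSum hF).unique ?_
    refine (hR (freeEvol s a) (freeEvol s b)).congr_fun fun i => ?_
    rw [innerSL_apply_apply, inner_tens, inner_freeEvolInv_right, ← inner_conj_symm _ b,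
      inner_freeEvolInv_right, inner_conj_symm]
  refine ⟨F, hF, hinF, ?_⟩
  -- Paired with their own rank-one terms, both kernels produce the same series of conjugates of
  -- ⟨gᵢ, R gᵢ⟩.
  have e : ⟪F, F⟫_ℂ = ⟪κ, κ⟫_ℂ := by
    refine ((innerSL ℂ F).hasSum hF).unique ?_
    refine ((innerSL ℂ κ).hasSum hκ).congr_fun fun i => ?_
    rw [innerSL_apply_apply, innerSL_apply_apply, ← inner_conj_symm, hinF, freeEvol_freeEvolInv,
      ← inner_conj_symm κ, hin]
  rw [norm_eq_sqrt_re_inner (𝕜 := ℂ), norm_eq_sqrt_re_inner (𝕜 := ℂ) κ, e]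

/-- The squared norm expands into inner products of the vectors, which the unitary evolution
preserves. -/
theorem norm_sum_tens_freeEvol (s : ℝ) {n : ℕ} (c : Fin n → ℂ) (a b : Fin n → L2 d) :
    ‖∑ i, c i • tens (freeEvol s (a i)) (freeEvol s (b i))‖ = ‖∑ i, c i • tens (a i) (b i)‖ := by
  rw [norm_eq_sqrt_re_inner (𝕜 := ℂ), norm_eq_sqrt_re_inner (𝕜 := ℂ) (∑ i, c i • tens (a i) (b i))]
  simp only [sum_inner, inner_sum, inner_smul_left, inner_smul_right, inner_tens, inner_freeEvol]

/-- The span of rank-one kernels of smooth, compactly supported vectors. -/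
theorem dense_span_tens :
    Dense (Submodule.span ℂ {k : KernelSpace d | ∃ a ∈ smoothCompact d, ∃ b ∈ smoothCompact d,
      tens a b = k} : Set (KernelSpace d)) := by
  rw [Submodule.dense_iff_topologicalClosure_eq_top,
    Submodule.topologicalClosure_eq_top_iff, Submodule.eq_bot_iff]
  intro k hk
  refine eq_zero_of_forall_inner_tens fun a b => ?_
  rw [Submodule.mem_orthogonal] at hk
  have h1 : ∀ a ∈ smoothCompact d, ∀ b ∈ smoothCompact d, ⟪tens a b, k⟫_ℂ = 0 :=
    fun a ha b hb => hk _ (Submodule.subset_span ⟨a, ha, b, hb, rfl⟩)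
  have hcont : Continuous fun p : L2 d × L2 d => ⟪tens p.1 p.2, k⟫_ℂ :=
    continuous_tens.inner continuous_const
  have hd : Dense (smoothCompact d ×ˢ smoothCompact d) :=
    dense_smoothCompact.prod dense_smoothCompact
  have := Continuous.ext_on hd hcont continuous_const (fun p hp => h1 _ hp.1 _ hp.2)
  exact congrFun this (a, b)

end InteractionPicture

/-! ### Lipschitz continuity of the interaction kernel -/

section InteractionKernels
variable {d : ℕ}

theorem norm_le_of_forall_dense_inner_le {E : Type*} [NormedAddCommGroup E] [InnerProductSpace ℂ E]
    {S : Set E} (hS : Dense S) {x : E} {B : ℝ} (hB : 0 ≤ B) (h : ∀ y ∈ S, ‖⟪y, x⟫_ℂ‖ ≤ B * ‖y‖) :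
    ‖x‖ ≤ B := by
  have hc : IsClosed {y : E | ‖⟪y, x⟫_ℂ‖ ≤ B * ‖y‖} :=
    isClosed_le (continuous_id.inner continuous_const).norm (continuous_const.mul continuous_norm)
  have h1 : ‖⟪x, x⟫_ℂ‖ ≤ B * ‖x‖ := hc.closure_subset_iff.2 (fun y hy => h y hy) (hS x)
  rcases eq_or_ne x 0 with rfl | hx
  · rwa [norm_zero]
  · rw [inner_self_eq_norm_sq_to_K, norm_pow, RCLike.norm_ofReal, abs_norm, sq] at h1
    exact le_of_mul_le_mul_right h1 (norm_pos_iff.2 hx)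

theorem norm_le_of_inner_tens {R : L2 d →L[ℂ] L2 d} {κ : KernelSpace d}
    (h : ∀ a b, ⟪tens a b, κ⟫_ℂ = ⟪a, R b⟫_ℂ) : ‖R‖ ≤ ‖κ‖ := by
  refine ContinuousLinearMap.opNorm_le_bound _ (norm_nonneg _) fun b => ?_
  refine norm_le_of_forall_dense_inner_le dense_univ (by positivity) fun a _ => ?_
  rw [← h]
  refine (norm_inner_le_norm _ _).trans (le_of_eq ?_)
  rw [norm_tens]
  ring

theorem continuous_freeEvol {f : L2 d} (hf : f ∈ smoothCompact d) (α : ℝ) :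
    Continuous fun t : ℝ => freeEvol (α * t) f := by
  obtain ⟨q, hq⟩ := exists_norm_pow_mul hf 1
  obtain ⟨q2, hq2⟩ := exists_norm_pow_mul hf 2
  have h : Continuous fun s => freeEvol s f :=
    continuous_iff_continuousAt.2 fun s => (hasDerivAt_freeEvol hq hq2 s).continuousAt
  exact h.comp (continuous_const.mul continuous_id)

theorem IsWOTContinuous.continuousOn_interaction {T : ℝ} {R : ℝ → L2 d →L[ℂ] L2 d}
    (hc : IsWOTContinuous T R) {B : ℝ} (hB : ∀ t ∈ Icc (-T) T, ‖R t‖ ≤ B) {f g : L2 d}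
    (hf : f ∈ smoothCompact d) (hg : g ∈ smoothCompact d) (α : ℝ) :
    ContinuousOn (fun t => ⟪freeEvol (α * t) f, R t (freeEvol (α * t) g)⟫_ℂ) (Icc (-T) T) :=
  fun t ht => tendsto_inner_of_wot (B := B) (fun a b => hc.continuousOn_inner a b t ht)
    (by filter_upwards [self_mem_nhdsWithin] with s hs using hB s hs)
    ((continuous_freeEvol hf α).tendsto t |>.mono_left nhdsWithin_le_nhds)
    ((continuous_freeEvol hg α).tendsto t |>.mono_left nhdsWithin_le_nhds)

/-- A density operator and its interaction picture: the kernel `κ` of `R` and the kernel `F` of the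
freely evolved operator, with a common decomposition in rank-one kernels. -/
structure InteractionData (R : L2 d →L[ℂ] L2 d) (s : ℝ) (κ F : KernelSpace d) : Prop where
  inner_tens : ∀ a b, ⟪tens a b, κ⟫_ℂ = ⟪a, R b⟫_ℂ
  inner_tens_free : ∀ a b, ⟪tens a b, F⟫_ℂ = ⟪freeEvol s a, R (freeEvol s b)⟫_ℂ
  norm_eq : ‖F‖ = ‖κ‖
  exists_hasSum : ∃ (ι : Type) (g : ι → L2 d), HasSum (fun i => tens (g i) (g i)) κ ∧
    HasSum (fun i => tens (freeEvolInv s (g i)) (freeEvolInv s (g i))) F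

/-- The squared norm of κ is the trace of R², which turns the trace hypothesis into a
Hilbert–Schmidt bound. -/
theorem IsDensityOperator.exists_interactionData {R : L2 d →L[ℂ] L2 d} (hR : IsDensityOperator R)
    {M : ℝ} (hM : 0 ≤ M) (htr : TraceSqLe R (M ^ 2)) (s : ℝ) :
    ∃ κ F : KernelSpace d, InteractionData R s κ F ∧ ‖κ‖ ≤ M := by
  obtain ⟨ι, -, g, κ, h1, h2, h3, h4, h5⟩ := hR.exists_kernel
  obtain ⟨F, hF, hF2, hF3⟩ := exists_interaction_kernel h1 h2 h3 h4 s
  refine ⟨κ, F, ⟨h3, hF2, hF3, ι, g, h2, hF⟩, ?_⟩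
  obtain ⟨τ, hτ, hτM⟩ := htr
  have h6 := h5 _ hτ
  rw [inner_self_eq_norm_sq_to_K] at h6
  have h7 : ‖κ‖ ^ 2 = τ := Complex.ofReal_injective (by rw [← h6]; push_cast; rfl)
  exact le_of_sq_le_sq (h7 ▸ hτM) hM

/-- By duality it suffices to pair F with a dense class of kernels Ξ, finite sums of rank-one
kernels with smooth compactly supported momentum vectors. The pairing has derivative (iħ)⁻¹⟨[V,
Ξ(t)], κ(t)⟩, where Ξ(t) is the free evolution of Ξ and has the same norm, so its size is at most
2‖V‖M‖Ξ‖/ħ. -/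
theorem lipschitz_interaction {m ħ T M : ℝ} (hm : 0 < m) (hħ : 0 < ħ) (hT : 0 < T) (hM : 0 ≤ M)
    {V : Space d →ᵇ ℝ} {R : ℝ → L2 d →L[ℂ] L2 d} (hW : IsWeakSolution m ħ T V R)
    (hc : IsWOTContinuous T R) {κ F : ℝ → KernelSpace d}
    (hI : ∀ t ∈ Icc (-T) T, InteractionData (R t) (freeRate m ħ * t) (κ t) (F t))
    (hκ : ∀ t ∈ Icc (-T) T, ‖κ t‖ ≤ M) {s t : ℝ} (hs : s ∈ Icc (-T) T) (ht : t ∈ Icc (-T) T) :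
    ‖F t - F s‖ ≤ 2 * ‖V‖ * M / ħ * |t - s| := by
  have hRB : ∀ t ∈ Icc (-T) T, ‖R t‖ ≤ M := fun t ht =>
    (norm_le_of_inner_tens (hI t ht).inner_tens).trans (hκ t ht)
  refine norm_le_of_forall_dense_inner_le dense_span_tens (by positivity) fun Ξ hΞ => ?_
  obtain ⟨n, c, k, rfl⟩ := Submodule.mem_span_set'.1 hΞ
  choose a ha b hb hab using fun i => (k i).2
  set α := freeRate m ħ with hα
  set Ξ : ℝ → KernelSpace d := fun t =>
    ∑ i, c i • tens (freeEvol (α * t) (a i)) (freeEvol (α * t) (b i)) with hΞt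
  have hΞ0 : ∑ i, c i • (k i : KernelSpace d) = ∑ i, c i • tens (a i) (b i) :=
    Finset.sum_congr rfl fun i _ => by rw [hab]
  rw [hΞ0]
  have hΞn : ∀ t, ‖Ξ t‖ = ‖∑ i, c i • tens (a i) (b i)‖ := fun t => norm_sum_tens_freeEvol _ c a b
  set φ : ℝ → ℂ := fun t => ∑ i, conj (c i) *
    ⟪freeEvol (α * t) (a i), R t (freeEvol (α * t) (b i))⟫_ℂ with hφ
  have hφF : ∀ t ∈ Icc (-T) T, ⟪∑ i, c i • tens (a i) (b i), F t⟫_ℂ = φ t := fun t ht => by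
    simp only [sum_inner, inner_smul_left, (hI t ht).inner_tens_free, hφ]
  have hcont : ContinuousOn φ (Icc (-T) T) := continuousOn_finsetSum _ fun i _ =>
    continuousOn_const.mul (hc.continuousOn_interaction hRB (ha i) (hb i) α)
  have hder : ∀ t ∈ Ioo (-T) T, HasDerivAt φ
      ((Complex.I * ħ)⁻¹ * ⟪commMul V (Ξ t), κ t⟫_ℂ) t := fun t ht => by
    have h := HasDerivAt.fun_sum fun i (_ : i ∈ (Finset.univ : Finset (Fin n))) =>
      (hW.hasDerivAt_interaction hm hħ hT hc hRB (ha i) (hb i) ht).const_mul (conj (c i))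
    refine h.congr_deriv ?_
    simp only [hΞt, map_sum, map_smul, sum_inner, inner_smul_left, commMul_tens, inner_sub_left,
      (hI t (Ioo_subset_Icc_self ht)).inner_tens, Finset.mul_sum]
    exact Finset.sum_congr rfl fun i _ => by ring
  set B := 2 * ‖V‖ * M / ħ * ‖∑ i, c i • tens (a i) (b i)‖ with hB
  have hB0 : 0 ≤ B := by positivity
  have hbound : ∀ t ∈ Ioo (-T) T, ‖(Complex.I * ħ)⁻¹ * ⟪commMul V (Ξ t), κ t⟫_ℂ‖ ≤ B := by
    intro t ht
    have e1 : ‖(Complex.I * (ħ : ℂ))⁻¹‖ = ħ⁻¹ := by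
      rw [norm_inv, norm_mul, Complex.norm_I, one_mul, Complex.norm_real, Real.norm_of_nonneg hħ.le]
    rw [norm_mul, e1]
    have e2 : ‖⟪commMul V (Ξ t), κ t⟫_ℂ‖ ≤ 2 * ‖V‖ * ‖Ξ t‖ * M :=
      (norm_inner_le_norm _ _).trans (mul_le_mul (norm_mulCLM_le _ _ _)
        (hκ t (Ioo_subset_Icc_self ht)) (norm_nonneg _) (by positivity))
    calc ħ⁻¹ * ‖⟪commMul V (Ξ t), κ t⟫_ℂ‖ ≤ ħ⁻¹ * (2 * ‖V‖ * ‖Ξ t‖ * M) := by gcongr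
      _ = B := by rw [hB, hΞn]; ring
  have hlip : LipschitzOnWith B.toNNReal φ (Ioo (-T) T) :=
    (convex_Ioo (-T) T).lipschitzOnWith_of_nnnorm_hasDerivWithin_le
      (fun t ht => (hder t ht).hasDerivWithinAt) fun t ht => by
        rw [← NNReal.coe_le_coe, coe_nnnorm, Real.coe_toNNReal _ hB0]
        exact hbound t ht
  have hcl : closure (Ioo (-T) T) = Icc (-T) T := closure_Ioo (by linarith)
  -- The equation holds only in the open interval; weak continuity carries the estimate to the
  -- endpoints.
  have hlip' := LipschitzOnWith.closure (by rwa [hcl]) hlip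
  rw [hcl] at hlip'
  have h := hlip'.norm_sub_le ht hs
  rw [inner_sub_right, hφF t ht, hφF s hs]
  refine h.trans (le_of_eq ?_)
  rw [Real.norm_eq_abs, Real.coe_toNNReal _ hB0, hB]
  ring

end InteractionKernels

/-! ### Averaging operators from kernels to functions -/

section Averaging
variable {d : ℕ}

/-- A measurable change of variables of `ℝ^d × ℝ^d` that scales Lebesgue measure by `J`. -/
structure ScalesVolume (Φ : Space d × Space d → Space d × Space d) (J : ℝ≥0∞) : Prop where
  measurable : Measurable Φ
  ne_top : J ≠ ⊤
  map_eq : Measure.map Φ volume = J • volume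

/-- A weight whose slices are square-integrable with a uniform bound. -/
structure IsSliceWeight (w : Space d × Space d → ℂ) (K : ℝ≥0∞) : Prop where
  measurable : Measurable w
  ne_top : K ≠ ⊤
  lintegral_le : ∀ x, ∫⁻ y, ‖w (x, y)‖ₑ ^ 2 ≤ K

variable {Φ : Space d × Space d → Space d × Space d} {J K : ℝ≥0∞} {w : Space d × Space d → ℂ}

theorem ScalesVolume.quasiMeasurePreserving (hΦ : ScalesVolume Φ J) :
    Measure.QuasiMeasurePreserving Φ volume volume :=
  ⟨hΦ.measurable, by rw [hΦ.map_eq]; exact Measure.smul_absolutelyContinuous⟩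

theorem ScalesVolume.lintegral_comp (hΦ : ScalesVolume Φ J) {f : Space d × Space d → ℝ≥0∞}
    (hf : AEMeasurable f volume) : ∫⁻ z, f (Φ z) = J * ∫⁻ z, f z := by
  rw [← lintegral_map' (f := f) (g := Φ) _ hΦ.measurable.aemeasurable, hΦ.map_eq,
    lintegral_smul_measure, smul_eq_mul]
  rw [hΦ.map_eq]
  exact hf.mono_ac Measure.smul_absolutelyContinuous

theorem ScalesVolume.memLp_comp (hΦ : ScalesVolume Φ J) {f : Space d × Space d → ℂ}
    (hf : MemLp f 2 volume) : MemLp (fun z => f (Φ z)) 2 volume := by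
  refine memLp_two_iff.2 ⟨hf.1.comp_quasiMeasurePreserving hΦ.quasiMeasurePreserving, ?_⟩
  rw [hΦ.lintegral_comp (f := fun z => ‖f z‖ₑ ^ 2) (hf.1.enorm.pow_const 2)]
  exact ENNReal.mul_lt_top hΦ.ne_top.lt_top (memLp_two_iff.1 hf).2

theorem IsSliceWeight.memLp (hw : IsSliceWeight w K) (x : Space d) :
    MemLp (fun y => w (x, y)) 2 volume :=
  memLp_two_iff.2 ⟨(hw.measurable.comp measurable_prodMk_left).aestronglyMeasurable,
    (hw.lintegral_le x).trans_lt hw.ne_top.lt_top⟩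

theorem IsSliceWeight.ae_integrable (hw : IsSliceWeight w K) (hΦ : ScalesVolume Φ J)
    {f : Space d × Space d → ℂ} (hf : MemLp f 2 volume) :
    ∀ᵐ x, Integrable (fun y => f (Φ (x, y)) * w (x, y)) := by
  filter_upwards [ae_memLp_slice (hΦ.memLp_comp hf)] with x hx
  exact hx.integrable_mul (hw.memLp x)

theorem aestronglyMeasurable_average (hΦ : ScalesVolume Φ J) (hw : IsSliceWeight w K)
    {f : Space d × Space d → ℂ} (hf : MemLp f 2 volume) :
    AEStronglyMeasurable (fun x => ∫ y, f (Φ (x, y)) * w (x, y)) volume := by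
  have h : AEStronglyMeasurable (fun z => f (Φ z) * w z)
      ((volume : Measure (Space d)).prod (volume : Measure (Space d))) :=
    (hΦ.memLp_comp hf).1.mul hw.measurable.aestronglyMeasurable
  exact h.integral_prod_right'

/-- Cauchy–Schwarz on each slice costs K, and the change of variables costs J. -/
theorem lintegral_average_le (hΦ : ScalesVolume Φ J) (hw : IsSliceWeight w K)
    {f : Space d × Space d → ℂ} (hf : MemLp f 2 volume) :
    ∫⁻ x, ‖∫ y, f (Φ (x, y)) * w (x, y)‖ₑ ^ 2 ≤ J * K * ∫⁻ z, ‖f z‖ₑ ^ 2 := by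
  have hm : AEMeasurable (fun z => ‖f (Φ z)‖ₑ ^ 2)
      ((volume : Measure (Space d)).prod (volume : Measure (Space d))) :=
    (hΦ.memLp_comp hf).1.enorm.pow_const 2
  calc ∫⁻ x, ‖∫ y, f (Φ (x, y)) * w (x, y)‖ₑ ^ 2
      ≤ ∫⁻ x, (∫⁻ y, ‖f (Φ (x, y))‖ₑ ^ 2) * K := by
        refine lintegral_mono_ae ?_
        filter_upwards [ae_memLp_slice (hΦ.memLp_comp hf)] with x hx
        exact (enorm_integral_mul_sq_le hx.1 (hw.memLp x).1).trans
          (mul_le_mul_right (hw.lintegral_le x) _)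
    _ = J * K * ∫⁻ z, ‖f z‖ₑ ^ 2 := by
        rw [lintegral_mul_const' _ _ hw.ne_top, ← lintegral_prod _ hm, ← Measure.volume_eq_prod,
          hΦ.lintegral_comp (f := fun z => ‖f z‖ₑ ^ 2) (hf.1.enorm.pow_const 2)]
        ring

theorem memLp_average (hΦ : ScalesVolume Φ J) (hw : IsSliceWeight w K)
    {f : Space d × Space d → ℂ} (hf : MemLp f 2 volume) :
    MemLp (fun x => ∫ y, f (Φ (x, y)) * w (x, y)) 2 volume :=
  memLp_two_iff.2 ⟨aestronglyMeasurable_average hΦ hw hf, (lintegral_average_le hΦ hw hf).trans_lt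
    (ENNReal.mul_lt_top (ENNReal.mul_lt_top hΦ.ne_top.lt_top hw.ne_top.lt_top)
      (memLp_two_iff.1 hf).2)⟩

theorem average_congr (hΦ : ScalesVolume Φ J) (w : Space d × Space d → ℂ)
    {f g : Space d × Space d → ℂ} (h : f =ᵐ[volume] g) :
    ∀ᵐ x, ∫ y, f (Φ (x, y)) * w (x, y) = ∫ y, g (Φ (x, y)) * w (x, y) := by
  have h1 : ∀ᵐ z : Space d × Space d, f (Φ z) = g (Φ z) := hΦ.quasiMeasurePreserving.ae h
  rw [Measure.volume_eq_prod] at h1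
  filter_upwards [Measure.ae_ae_of_ae_prod h1] with x hx
  refine integral_congr_ae ?_
  filter_upwards [hx] with y hy
  rw [hy]

/-- The operator `f ↦ ∫ f(Φ(x, y)) w(x, y) dy` from kernels to functions. -/
noncomputable def averageCLM (hΦ : ScalesVolume Φ J) (hw : IsSliceWeight w K) :
    KernelSpace d →L[ℂ] L2 d :=
  LinearMap.mkContinuous
    { toFun := fun f => (memLp_average hΦ hw (Lp.memLp f)).toLp _
      map_add' := fun f g => by
        refine Lp.ext ?_
        filter_upwards [(memLp_average hΦ hw (Lp.memLp (f + g))).coeFn_toLp,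
          (memLp_average hΦ hw (Lp.memLp f)).coeFn_toLp,
          (memLp_average hΦ hw (Lp.memLp g)).coeFn_toLp, average_congr hΦ w (Lp.coeFn_add f g),
          Lp.coeFn_add ((memLp_average hΦ hw (Lp.memLp f)).toLp _)
            ((memLp_average hΦ hw (Lp.memLp g)).toLp _), hw.ae_integrable hΦ (Lp.memLp f),
          hw.ae_integrable hΦ (Lp.memLp g)] with x h1 h2 h3 h4 h5 h6 h7
        rw [h1, h5, Pi.add_apply, h2, h3, h4, ← integral_add h6 h7]
        simp_rw [Pi.add_apply, add_mul]
      map_smul' := fun c f => by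
        refine Lp.ext ?_
        filter_upwards [(memLp_average hΦ hw (Lp.memLp (c • f))).coeFn_toLp,
          (memLp_average hΦ hw (Lp.memLp f)).coeFn_toLp, average_congr hΦ w (Lp.coeFn_smul c f),
          Lp.coeFn_smul c ((memLp_average hΦ hw (Lp.memLp f)).toLp _)] with x h1 h2 h4 h5
        rw [RingHom.id_apply, h1, h5, Pi.smul_apply, h2, h4, smul_eq_mul, ← integral_const_mul]
        simp_rw [Pi.smul_apply, smul_eq_mul, mul_assoc] } (J * K).toReal.sqrt (fun f => by
      refine le_of_sq_le_sq ?_ (by positivity)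
      have h := lintegral_average_le hΦ hw (Lp.memLp f)
      have e : ∫⁻ x, ‖(memLp_average hΦ hw (Lp.memLp f)).toLp _ x‖ₑ ^ 2 =
          ∫⁻ x, ‖∫ y, f (Φ (x, y)) * w (x, y)‖ₑ ^ 2 := by
        refine lintegral_congr_ae ?_
        filter_upwards [(memLp_average hΦ hw (Lp.memLp f)).coeFn_toLp] with x hx
        rw [hx]
      rw [lintegral_enorm_sq_eq, ← e, lintegral_enorm_sq_eq] at h
      have h2 := ENNReal.toReal_mono (ENNReal.mul_ne_top (ENNReal.mul_ne_top hΦ.ne_top hw.ne_top)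
        (ENNReal.pow_ne_top enorm_ne_top)) h
      rw [ENNReal.toReal_pow, ENNReal.toReal_mul, ENNReal.toReal_pow, toReal_enorm,
        toReal_enorm] at h2
      rw [mul_pow, Real.sq_sqrt ENNReal.toReal_nonneg]
      exact h2)

theorem coeFn_averageCLM (hΦ : ScalesVolume Φ J) (hw : IsSliceWeight w K) (f : KernelSpace d) :
    averageCLM hΦ hw f =ᵐ[volume] fun x => ∫ y, f (Φ (x, y)) * w (x, y) :=
  (memLp_average hΦ hw (Lp.memLp f)).coeFn_toLp

theorem enorm_averageCLM_sq_le (hΦ : ScalesVolume Φ J) (hw : IsSliceWeight w K)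
    (f : KernelSpace d) : ‖averageCLM hΦ hw f‖ₑ ^ 2 ≤ J * K * ‖f‖ₑ ^ 2 := by
  have h := lintegral_average_le hΦ hw (Lp.memLp f)
  rw [lintegral_enorm_sq_eq] at h
  rw [← lintegral_enorm_sq_eq]
  refine le_trans (le_of_eq (lintegral_congr_ae ?_)) h
  filter_upwards [coeFn_averageCLM hΦ hw f] with x hx
  rw [hx]

theorem scalesVolume_weyl {ħ : ℝ} (hħ : 0 < ħ) :
    ScalesVolume (fun z : Space d × Space d => (z.1 + (ħ / 2) • z.2, z.1 - (ħ / 2) • z.2))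
      (ENNReal.ofReal (ħ ^ d)⁻¹) :=
  ⟨by fun_prop, ENNReal.ofReal_ne_top, map_weyl hħ⟩

theorem scalesVolume_sub :
    ScalesVolume (fun z : Space d × Space d => (z.2, z.2 - z.1)) 1 := by
  refine ⟨by fun_prop, ENNReal.one_ne_top, ?_⟩
  have h := ((MeasurePreserving.id (volume : Measure (Space d))).prod
    (Measure.measurePreserving_neg (volume : Measure (Space d)))).comp
    (measurePreserving_prod_sub_swap (volume : Measure (Space d)) (volume : Measure (Space d)))
  rw [one_smul]
  refine Eq.trans ?_ h.map_eq
  congr 1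
  funext z
  simp

/-- The symbol `ψ̌(y) = ∫ e^{-i v·y} ψ(v) dv`. -/
noncomputable def unitaryFourier (ψ : 𝓢(Space d, ℂ)) (y : Space d) : ℂ :=
  ∫ v, Complex.exp (-Complex.I * ((⟪v, y⟫_ℝ : ℝ) : ℂ)) * ψ v

theorem unitaryFourier_eq (ψ : 𝓢(Space d, ℂ)) (y : Space d) :
    unitaryFourier ψ y = (𝓕 ψ) ((2 * Real.pi)⁻¹ • y) := by
  rw [SchwartzMap.fourier_coe, Real.fourier_eq', unitaryFourier]
  refine integral_congr_ae (ae_of_all _ fun v => ?_)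
  simp only [smul_eq_mul, inner_smul_right]
  congr 2
  push_cast
  field_simp

theorem integrable_unitaryFourier (ψ : 𝓢(Space d, ℂ)) : Integrable (unitaryFourier ψ) := by
  have h : unitaryFourier ψ = fun y => (𝓕 ψ) ((2 * Real.pi)⁻¹ • y) :=
    funext (unitaryFourier_eq ψ)
  rw [h]
  exact (𝓕 ψ).integrable.comp_smul (by positivity)

theorem continuous_unitaryFourier (ψ : 𝓢(Space d, ℂ)) : Continuous (unitaryFourier ψ) := by
  have h : unitaryFourier ψ = fun y => (𝓕 ψ) ((2 * Real.pi)⁻¹ • y) :=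
    funext (unitaryFourier_eq ψ)
  rw [h]
  exact (𝓕 ψ).continuous.comp (continuous_const_smul _)

/-- Fourier inversion with the two normalisations reconciled: the rescaling of y by 2π produces the
prefactor and moves the evaluation point to 2πu. -/
theorem integral_unitaryFourier (ψ : 𝓢(Space d, ℂ)) (u : Space d) :
    ∫ y, ((1 / (2 * Real.pi) ^ d : ℝ) : ℂ) * unitaryFourier ψ y * (𝐞 ⟪y, u⟫_ℝ : ℂ) =
      ψ ((2 * Real.pi) • u) := by
  have h1 : ∫ z, (𝐞 ⟪z, (2 * Real.pi) • u⟫_ℝ : ℂ) * (𝓕 ψ) z = ψ ((2 * Real.pi) • u) := by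
    conv_rhs => rw [← fourierInv_fourier_eq (F := 𝓢(Space d, ℂ)) ψ, SchwartzMap.fourierInv_coe,
      Real.fourierInv_eq]
    rfl
  rw [← h1]
  have h2 := Measure.integral_comp_smul (volume : Measure (Space d))
    (fun z => (𝐞 ⟪z, (2 * Real.pi) • u⟫_ℝ : ℂ) * (𝓕 ψ) z) (2 * Real.pi)⁻¹
  rw [finrank_euclideanSpace, Fintype.card_fin, abs_of_pos (by positivity)] at h2
  have h3 : ∫ z, (𝐞 ⟪z, (2 * Real.pi) • u⟫_ℝ : ℂ) * (𝓕 ψ) z = ((1 / (2 * Real.pi) ^ d : ℝ) : ℂ) *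
      ∫ y, (𝐞 ⟪(2 * Real.pi)⁻¹ • y, (2 * Real.pi) • u⟫_ℝ : ℂ) * (𝓕 ψ) ((2 * Real.pi)⁻¹ • y) := by
    rw [h2, Complex.real_smul, ← mul_assoc, ← Complex.ofReal_mul, inv_pow, inv_inv,
      one_div_mul_cancel (by positivity), Complex.ofReal_one, one_mul]
  rw [h3, ← integral_const_mul]
  refine integral_congr_ae (ae_of_all _ fun y => ?_)
  simp only [unitaryFourier_eq, inner_smul_left, inner_smul_right]
  have h4 : 2 * Real.pi * ((starRingEnd ℝ) (2 * Real.pi)⁻¹ * ⟪y, u⟫_ℝ) = ⟪y, u⟫_ℝ := by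
    rw [conj_trivial]
    field_simp
  rw [h4]
  ring

/-- The weight of the velocity average in the position representation. -/
theorem isSliceWeight_position (ψ : 𝓢(Space d, ℂ)) :
    IsSliceWeight (fun z : Space d × Space d =>
      ((1 / (2 * Real.pi) ^ d : ℝ) : ℂ) * unitaryFourier ψ z.2)
      (∫⁻ y, ‖((1 / (2 * Real.pi) ^ d : ℝ) : ℂ) * unitaryFourier ψ y‖ₑ ^ 2) := by
  refine ⟨(measurable_const.mul ((continuous_unitaryFourier ψ).measurable.comp measurable_snd)),
    ?_, fun x => le_rfl⟩
  have h : MemLp (fun y => ((1 / (2 * Real.pi) ^ d : ℝ) : ℂ) * unitaryFourier ψ y) 2 volume := by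
    refine MemLp.const_mul ?_ _
    have h : unitaryFourier ψ = fun y => (𝓕 ψ) ((2 * Real.pi)⁻¹ • y) :=
      funext (unitaryFourier_eq ψ)
    refine memLp_two_iff.2 ⟨(continuous_unitaryFourier ψ).aestronglyMeasurable, ?_⟩
    simp only [h]
    rw [lintegral_comp_smul' (fun y => ‖(𝓕 ψ : 𝓢(Space d, ℂ)) y‖ₑ ^ 2) (c := (2 * Real.pi)⁻¹) (by positivity)]
    exact ENNReal.mul_lt_top ENNReal.ofReal_lt_top (memLp_two_iff.1 ((𝓕 ψ).memLp 2)).2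
  exact (memLp_two_iff.1 h).2.ne

/-- The weight of the velocity average in the momentum representation and interaction picture. -/
noncomputable def momentumWeight (ħ : ℝ) (χ : 𝓢(Space d, ℂ)) (s : ℝ) (z : Space d × Space d) : ℂ :=
  phase s z.2 * conj (phase s (z.2 - z.1)) *
    χ ((2 * Real.pi * ħ) • (z.2 - (1 / 2 : ℝ) • z.1))

theorem lintegral_momentum {ħ : ℝ} (hħ : 0 < ħ) (f : Space d → ℝ≥0∞) (ξ : Space d) :
    ∫⁻ p, f ((2 * Real.pi * ħ) • (p - (1 / 2 : ℝ) • ξ)) =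
      ENNReal.ofReal ((2 * Real.pi * ħ) ^ d)⁻¹ * ∫⁻ v, f v := by
  rw [lintegral_sub_right_eq_self (fun p => f ((2 * Real.pi * ħ) • p)) ((1 / 2 : ℝ) • ξ),
    lintegral_comp_smul' f (by positivity)]

theorem enorm_phase (s : ℝ) (p : Space d) : ‖phase s p‖ₑ = 1 := by
  rw [← ofReal_norm, norm_phase, ENNReal.ofReal_one]

theorem continuous_momentumWeight (ħ : ℝ) (χ : 𝓢(Space d, ℂ)) :
    Continuous fun q : ℝ × (Space d × Space d) => momentumWeight ħ χ q.1 q.2 := by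
  unfold momentumWeight phase
  have := χ.continuous
  fun_prop

/-- The phases have modulus one, so the bound is the same for all ξ and s. The Jacobian (2πħ)^(-d)
of p ↦ v appearing here is what the trace hypothesis compensates. -/
theorem isSliceWeight_momentum {ħ : ℝ} (hħ : 0 < ħ) (χ : 𝓢(Space d, ℂ)) (s : ℝ) :
    IsSliceWeight (momentumWeight ħ χ s)
      (ENNReal.ofReal ((2 * Real.pi * ħ) ^ d)⁻¹ * ∫⁻ v, ‖χ v‖ₑ ^ 2) := by
  refine ⟨((continuous_momentumWeight ħ χ).comp (Continuous.prodMk_right s)).measurable,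
    ENNReal.mul_ne_top ENNReal.ofReal_ne_top (memLp_two_iff.1 (χ.memLp 2)).2.ne, fun ξ => ?_⟩
  rw [← lintegral_momentum hħ (fun v => ‖χ v‖ₑ ^ 2) ξ]
  refine le_of_eq (lintegral_congr fun p => ?_)
  rw [momentumWeight, enorm_mul, enorm_mul, enorm_phase, RCLike.enorm_conj, enorm_phase, one_mul,
    one_mul]

end Averaging

/-! ### The velocity average in Fourier space -/

section FourierLink
variable {d : ℕ}

theorem continuous_fourier_of_integrable {f : Space d → ℂ} (hf : Integrable f) :
    Continuous (𝓕 f : Space d → ℂ) :=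
  VectorFourier.fourierIntegral_continuous Real.continuous_fourierChar
    (by exact continuous_inner) hf

/-- On integrable functions, the Fourier transform of `L²` is the integral. -/
theorem coeFn_fourier_of_integrable (f : L2 d) (hf : Integrable (f : Space d → ℂ)) :
    ((𝓕 f : L2 d) : Space d → ℂ) =ᵐ[volume] 𝓕 (f : Space d → ℂ) := by
  have hF : Continuous (𝓕 (f : Space d → ℂ)) := continuous_fourier_of_integrable hf
  have hL : LocallyIntegrable (((𝓕 f : L2 d) : Space d → ℂ)) :=
    (Lp.memLp (𝓕 f : L2 d)).locallyIntegrable (by norm_num)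
  -- Tested against real smooth compactly supported functions, the L² transform is handled by
  -- Plancherel and the integral transform by the multiplication formula; both yield the same
  -- integral against f.
  have key : ∀ᵐ x, ((𝓕 f : L2 d) : Space d → ℂ) x - 𝓕 (f : Space d → ℂ) x = 0 := by
    refine ae_eq_zero_of_integral_contDiff_smul_eq_zero (hL.sub hF.locallyIntegrable) ?_
    intro g hg hgc
    have hgc' : HasCompactSupport fun x => (g x : ℂ) := hgc.comp_left Complex.ofReal_zero
    have hg' : ContDiff ℝ ∞ fun x => (g x : ℂ) := Complex.ofRealCLM.contDiff.comp hg
    set χ : 𝓢(Space d, ℂ) := hgc'.toSchwartzMap hg' with hχ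
    have hχx : ∀ x, χ x = (g x : ℂ) := fun x => rfl
    set φ : 𝓢(Space d, ℂ) := 𝓕⁻ χ with hφ
    have hφχ : 𝓕 φ = χ := fourier_fourierInv_eq χ
    have e1 : ∫ x, g x • ((𝓕 f : L2 d) : Space d → ℂ) x = ∫ x, conj (φ x) * f x := by
      have h := Lp.inner_fourier_eq (φ.toLp 2 volume) f
      rw [SchwartzMap.toLp_fourier_eq, hφχ, L2.inner_def, L2.inner_def] at h
      have h' : ∫ x, ⟪φ.toLp 2 volume x, f x⟫_ℂ = ∫ x, conj (φ x) * f x := by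
        refine integral_congr_ae ((φ.coeFn_toLp 2 volume).mono fun x hx => ?_)
        simp only [RCLike.inner_apply]
        rw [hx, mul_comm]
      rw [← h', ← h]
      refine integral_congr_ae ((χ.coeFn_toLp 2 volume).mono fun x hx => ?_)
      simp only [RCLike.inner_apply]
      rw [hx, hχx, Complex.conj_ofReal, Complex.real_smul, mul_comm]
    have e2 : ∫ x, g x • 𝓕 (f : Space d → ℂ) x = ∫ x, conj (φ x) * f x := by
      have h := VectorFourier.integral_fourierIntegral_smul_eq_flip (μ := (volume : Measure (Space d)))
        (ν := (volume : Measure (Space d))) (L := innerₗ (Space d)) (f := (f : Space d → ℂ))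
        (g := (χ : Space d → ℂ)) Real.continuous_fourierChar (by exact continuous_inner) hf χ.integrable
      have h3 : ∀ x, VectorFourier.fourierIntegral 𝐞 volume (innerₗ (Space d)).flip (χ : Space d → ℂ) x
          = conj (φ x) := fun x => by
        rw [hφ, SchwartzMap.fourierInv_coe, Real.fourierInv_eq, ← integral_conj,
          VectorFourier.fourierIntegral]
        refine integral_congr_ae (ae_of_all _ fun y => ?_)
        simp only [Circle.smul_def, smul_eq_mul, map_mul, hχx, Complex.conj_ofReal]
        rw [← Circle.coe_inv_eq_conj, ← AddChar.map_neg_eq_inv]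
        congr 4
        show ⟪x, y⟫_ℝ = ⟪y, x⟫_ℝ
        exact real_inner_comm _ _
      calc ∫ x, g x • 𝓕 (f : Space d → ℂ) x
          = ∫ x, VectorFourier.fourierIntegral 𝐞 volume (innerₗ (Space d)) (f : Space d → ℂ) x • χ x := by
            refine integral_congr_ae (ae_of_all _ fun x => ?_)
            simp only [hχx, Complex.real_smul, smul_eq_mul]
            rw [mul_comm]
            rfl
        _ = _ := h
        _ = _ := by
            refine integral_congr_ae (ae_of_all _ fun x => ?_)
            simp only [h3, smul_eq_mul]
            rw [mul_comm]
    have i1 : Integrable fun x => g x • ((𝓕 f : L2 d) : Space d → ℂ) x :=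
      hL.integrable_smul_left_of_hasCompactSupport hg.continuous hgc
    have i2 : Integrable fun x => g x • 𝓕 (f : Space d → ℂ) x :=
      hF.locallyIntegrable.integrable_smul_left_of_hasCompactSupport hg.continuous hgc
    simp_rw [smul_sub]
    rw [integral_sub i1 i2, e1, e2, sub_self]
  filter_upwards [key] with x hx
  exact sub_eq_zero.1 hx

theorem fourierChar_add_coe (a b : ℝ) : (𝐞 (a + b) : ℂ) = (𝐞 a : ℂ) * (𝐞 b : ℂ) := by
  rw [AddChar.map_add_eq_mul, Circle.coe_mul]

theorem conj_fourierChar (a : ℝ) : conj (𝐞 a : ℂ) = (𝐞 (-a) : ℂ) := by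
  rw [← Circle.coe_inv_eq_conj, ← AddChar.map_neg_eq_inv]

theorem fourier_eq_integral_mul (f : Space d → ℂ) (ξ : Space d) :
    𝓕 f ξ = ∫ x, (𝐞 (-⟪x, ξ⟫_ℝ) : ℂ) * f x := by
  rw [Real.fourier_eq]
  rfl

theorem fourier_shift (a : 𝓢(Space d, ℂ)) (c η : Space d) :
    ∫ x, (𝐞 (-⟪x, η⟫_ℝ) : ℂ) * a (x + c) = (𝐞 ⟪c, η⟫_ℝ : ℂ) * (𝓕 a) η := by
  rw [← integral_sub_right_eq_self (fun x => (𝐞 (-⟪x, η⟫_ℝ) : ℂ) * a (x + c)) c,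
    SchwartzMap.fourier_coe, fourier_eq_integral_mul, ← integral_const_mul]
  refine integral_congr_ae (ae_of_all _ fun x => ?_)
  simp only [sub_add_cancel]
  rw [← mul_assoc, ← fourierChar_add_coe, inner_sub_left]
  congr 3
  ring

theorem schwartz_eq_integral_fourier (b : 𝓢(Space d, ℂ)) (x : Space d) :
    b x = ∫ q, (𝐞 ⟪q, x⟫_ℝ : ℂ) * (𝓕 b) q := by
  conv_lhs => rw [← fourierInv_fourier_eq (F := 𝓢(Space d, ℂ)) b, SchwartzMap.fourierInv_coe,
    Real.fourierInv_eq]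
  rfl

theorem continuous_fourierChar_coe : Continuous fun t : ℝ => (𝐞 t : ℂ) :=
  continuous_subtype_val.comp Real.continuous_fourierChar

theorem norm_fourierChar_coe (t : ℝ) : ‖(𝐞 t : ℂ)‖ = 1 := Circle.norm_coe _

/-- The Fourier transform of a correlation of Schwartz functions. -/
theorem fourier_correlation (a b : 𝓢(Space d, ℂ)) (c ξ : Space d) :
    ∫ x, (𝐞 (-⟪x, ξ⟫_ℝ) : ℂ) * (a (x + c) * conj (b (x - c))) =
      ∫ p, (𝓕 a) p * conj ((𝓕 b) (p - ξ)) * (𝐞 (⟪c, (2 : ℝ) • p - ξ⟫_ℝ) : ℂ) := by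
  -- Only b is expanded by Fourier inversion; the x-integral then becomes the transform of a shifted
  -- copy of a.
  have h1 : ∀ x, (𝐞 (-⟪x, ξ⟫_ℝ) : ℂ) * (a (x + c) * conj (b (x - c))) =
      ∫ q, (𝐞 (-⟪x, ξ + q⟫_ℝ + ⟪c, q⟫_ℝ) : ℂ) * (a (x + c) * conj ((𝓕 b) q)) := fun x => by
    rw [schwartz_eq_integral_fourier b (x - c), ← integral_conj, ← integral_const_mul,
      ← integral_const_mul]
    refine integral_congr_ae (ae_of_all _ fun q => ?_)
    simp only [map_mul, conj_fourierChar]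
    have : -⟪x, ξ + q⟫_ℝ + ⟪c, q⟫_ℝ = -⟪x, ξ⟫_ℝ + -⟪q, x - c⟫_ℝ := by
      rw [inner_add_right, inner_sub_right, real_inner_comm x q, real_inner_comm c q]
      ring
    rw [this, fourierChar_add_coe]
    ring
  simp_rw [h1]
  rw [integral_integral_swap]
  -- The substitution q = p - ξ makes p the argument of the transform of a.
  · rw [← integral_sub_right_eq_self _ ξ]
    refine integral_congr_ae (ae_of_all _ fun p => ?_)
    simp only [add_sub_cancel]
    have h2 : ∀ x, (𝐞 (-⟪x, p⟫_ℝ + ⟪c, p - ξ⟫_ℝ) : ℂ) * (a (x + c) * conj ((𝓕 b) (p - ξ))) =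
        (𝐞 ⟪c, p - ξ⟫_ℝ : ℂ) * conj ((𝓕 b) (p - ξ)) * ((𝐞 (-⟪x, p⟫_ℝ) : ℂ) * a (x + c)) :=
      fun x => by
        rw [fourierChar_add_coe]
        ring
    simp_rw [h2]
    rw [integral_const_mul, fourier_shift]
    have : ⟪c, (2 : ℝ) • p - ξ⟫_ℝ = ⟪c, p - ξ⟫_ℝ + ⟪c, p⟫_ℝ := by
      rw [← inner_add_right, two_smul]
      congr 1
      abel
    rw [this, fourierChar_add_coe]
    ring
  · have h0 : Integrable (fun q => conj ((𝓕 b : 𝓢(Space d, ℂ)) q)) :=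
      memLp_one_iff_integrable.1 (memLp_one_iff_integrable.2 (𝓕 b).integrable).star
    have h3 : Integrable (fun z : Space d × Space d => a (z.1 + c) * conj ((𝓕 b : 𝓢(Space d, ℂ)) z.2))
        (volume.prod volume) :=
      (a.integrable.comp_add_right c).mul_prod h0
    have hc : Continuous fun z : Space d × Space d => -⟪z.1, ξ + z.2⟫_ℝ + ⟪c, z.2⟫_ℝ := by fun_prop
    have h4 := (continuous_fourierChar_coe.comp hc).aestronglyMeasurable
      (μ := (volume : Measure (Space d)).prod (volume : Measure (Space d)))
    have h5 := Integrable.bdd_mul h3 h4 (c := 1) (ae_of_all _ fun z => (norm_fourierChar_coe _).le)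
    exact h5

/-- The velocity average of a kernel. -/
noncomputable def positionAverage {ħ : ℝ} (hħ : 0 < ħ) (ψ : 𝓢(Space d, ℂ)) :
    KernelSpace d →L[ℂ] L2 d :=
  averageCLM (scalesVolume_weyl hħ) (isSliceWeight_position ψ)

/-- The velocity average in the momentum representation and the interaction picture. -/
noncomputable def momentumAverage {ħ : ℝ} (hħ : 0 < ħ) (χ : 𝓢(Space d, ℂ)) (s : ℝ) :
    KernelSpace d →L[ℂ] L2 d :=
  averageCLM scalesVolume_sub (isSliceWeight_momentum hħ χ s)

theorem integrable_conj {α : Type*} [MeasurableSpace α] {μ : Measure α} {f : α → ℂ}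
    (hf : Integrable f μ) : Integrable (fun x => conj (f x)) μ :=
  memLp_one_iff_integrable.1 (memLp_one_iff_integrable.2 hf).star

theorem integrable_position {ħ : ℝ} (hħ : 0 < ħ) (ψ a b : 𝓢(Space d, ℂ)) :
    Integrable (fun z : Space d × Space d => (a (z.1 + (ħ / 2) • z.2) *
      conj (b (z.1 - (ħ / 2) • z.2))) * (((1 / (2 * Real.pi) ^ d : ℝ) : ℂ) * unitaryFourier ψ z.2))
      (volume.prod volume) := by
  have h1 : Integrable (fun z : Space d × Space d => a z.1 * conj (b z.2)) volume :=
    Integrable.mul_prod (f := fun x => a x) (g := fun q => conj (b q)) a.integrable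
      (integrable_conj b.integrable)
  have h2 : Integrable (fun z : Space d × Space d => a z.1 * conj (b z.2))
      (Measure.map (fun z : Space d × Space d => (z.1 + (ħ / 2) • z.2, z.1 - (ħ / 2) • z.2))
        volume) := by
    rw [map_weyl hħ]
    exact h1.smul_measure ENNReal.ofReal_ne_top
  have h3 := h2.comp_measurable (by fun_prop)
  have hc : Continuous fun z : Space d × Space d =>
      ((1 / (2 * Real.pi) ^ d : ℝ) : ℂ) * unitaryFourier ψ z.2 :=
    continuous_const.mul ((continuous_unitaryFourier ψ).comp continuous_snd)
  refine (h3.bdd_mul hc.aestronglyMeasurable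
    (c := |1 / (2 * Real.pi) ^ d| * ∫ v, ‖ψ v‖) (ae_of_all _ fun z => ?_)).congr
    (ae_of_all _ fun z => mul_comm _ _)
  rw [norm_mul, Complex.norm_real, Real.norm_eq_abs]
  refine mul_le_mul_of_nonneg_left ((norm_integral_le_integral_norm _).trans
    (le_of_eq (integral_congr_ae (ae_of_all _ fun v => ?_)))) (abs_nonneg _)
  simp only [norm_mul]
  rw [show -Complex.I * ((⟪v, z.2⟫_ℝ : ℝ) : ℂ) = ((-⟪v, z.2⟫_ℝ : ℝ) : ℂ) * Complex.I by
    push_cast; ring, Complex.norm_exp_ofReal_mul_I, one_mul]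

/-- After Fubini the x-integral is a correlation, whose transform depends on y only through a
character with frequency ħ(p - ξ/2). Integrating that character against the symbol of ψ returns ψ at
2πħ(p - ξ/2). -/
theorem fourier_position_eq {ħ : ℝ} (hħ : 0 < ħ) (ψ a b : 𝓢(Space d, ℂ)) (ξ : Space d) :
    𝓕 (fun x : Space d => ∫ y, (a (x + (ħ / 2) • y) * conj (b (x - (ħ / 2) • y))) *
      (((1 / (2 * Real.pi) ^ d : ℝ) : ℂ) * unitaryFourier ψ y)) ξ =
    ∫ p, ((𝓕 a) p * conj ((𝓕 b) (p - ξ))) * momentumWeight ħ ψ 0 (ξ, p) := by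
  rw [fourier_eq_integral_mul]
  simp_rw [← integral_const_mul]
  rw [integral_integral_swap]
  · have h1 : ∀ y, ∫ x, (𝐞 (-⟪x, ξ⟫_ℝ) : ℂ) * ((a (x + (ħ / 2) • y) * conj (b (x - (ħ / 2) • y))) *
        (((1 / (2 * Real.pi) ^ d : ℝ) : ℂ) * unitaryFourier ψ y)) =
        ∫ p, ((1 / (2 * Real.pi) ^ d : ℝ) : ℂ) * unitaryFourier ψ y *
          ((𝓕 a) p * conj ((𝓕 b) (p - ξ)) * (𝐞 ⟪(ħ / 2) • y, (2 : ℝ) • p - ξ⟫_ℝ : ℂ)) := fun y => by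
      rw [integral_const_mul, ← fourier_correlation, ← integral_const_mul]
      refine integral_congr_ae (ae_of_all _ fun x => ?_)
      simp only
      ring
    simp_rw [h1]
    rw [integral_integral_swap]
    · refine integral_congr_ae (ae_of_all _ fun p => ?_)
      simp only
      have h2 : ∀ y, ((1 / (2 * Real.pi) ^ d : ℝ) : ℂ) * unitaryFourier ψ y *
          ((𝓕 a) p * conj ((𝓕 b) (p - ξ)) * (𝐞 ⟪(ħ / 2) • y, (2 : ℝ) • p - ξ⟫_ℝ : ℂ)) =
          ((𝓕 a) p * conj ((𝓕 b) (p - ξ))) * (((1 / (2 * Real.pi) ^ d : ℝ) : ℂ) *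
            unitaryFourier ψ y * (𝐞 ⟪y, ħ • (p - (1 / 2 : ℝ) • ξ)⟫_ℝ : ℂ)) := fun y => by
        have : ⟪(ħ / 2) • y, (2 : ℝ) • p - ξ⟫_ℝ = ⟪y, ħ • (p - (1 / 2 : ℝ) • ξ)⟫_ℝ := by
          simp only [inner_sub_right, inner_smul_left, inner_smul_right, conj_trivial]
          ring
        rw [this]
        ring
      simp_rw [h2]
      rw [integral_const_mul, integral_unitaryFourier, smul_smul, momentumWeight, phase_zero,
        phase_zero, map_one, one_mul, one_mul]
    · have i1 : Integrable fun p =>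
          (𝓕 a : 𝓢(Space d, ℂ)) p * conj ((𝓕 b : 𝓢(Space d, ℂ)) (p - ξ)) := by
        have hb : Integrable fun p => conj ((𝓕 b) (p - ξ)) :=
          integrable_conj ((𝓕 b).integrable.comp_sub_right ξ)
        obtain ⟨K, hK⟩ := (𝓕 a).decay 0 0
        refine hb.bdd_mul (c := K) (𝓕 a).continuous.aestronglyMeasurable (ae_of_all _ fun p => ?_)
        simpa using hK.2 p
      have i2 : Integrable (fun z : Space d × Space d => (((1 / (2 * Real.pi) ^ d : ℝ) : ℂ) *
          unitaryFourier ψ z.1) * ((𝓕 a : 𝓢(Space d, ℂ)) z.2 * conj ((𝓕 b : 𝓢(Space d, ℂ)) (z.2 - ξ)))) (volume.prod volume) :=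
        ((integrable_unitaryFourier ψ).const_mul _).mul_prod i1
      have hc : Continuous fun z : Space d × Space d => ⟪(ħ / 2) • z.1, (2 : ℝ) • z.2 - ξ⟫_ℝ := by
        fun_prop
      have h4 := (continuous_fourierChar_coe.comp hc).aestronglyMeasurable
        (μ := (volume : Measure (Space d)).prod (volume : Measure (Space d)))
      have h5 := Integrable.bdd_mul i2 h4 (c := 1)
        (ae_of_all _ fun z => (norm_fourierChar_coe _).le)
      refine h5.congr (ae_of_all _ fun z => ?_)
      simp only [Function.comp_apply, Function.uncurry]
      ring
  · have hc : Continuous fun z : Space d × Space d => -⟪z.1, ξ⟫_ℝ := by fun_prop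
    have h4 := (continuous_fourierChar_coe.comp hc).aestronglyMeasurable
      (μ := (volume : Measure (Space d)).prod (volume : Measure (Space d)))
    exact Integrable.bdd_mul (integrable_position hħ ψ a b) h4 (c := 1)
      (ae_of_all _ fun z => (norm_fourierChar_coe _).le)

theorem fourier_positionAverage_schwartz {ħ : ℝ} (hħ : 0 < ħ) (ψ a b : 𝓢(Space d, ℂ)) :
    𝓕 (positionAverage hħ ψ (tens (a.toLp 2 volume) (b.toLp 2 volume))) =
      momentumAverage hħ ψ 0 (tens ((𝓕 a).toLp 2 volume) ((𝓕 b).toLp 2 volume)) := by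
  have ht : ∀ a b : 𝓢(Space d, ℂ), tens (a.toLp 2 volume) (b.toLp 2 volume) =ᵐ[volume]
      fun z : Space d × Space d => a z.1 * conj (b z.2) := fun a b => by
    have h1 := (Measure.quasiMeasurePreserving_fst (μ := (volume : Measure (Space d)))
      (ν := (volume : Measure (Space d)))).ae (a.coeFn_toLp 2 volume)
    have h2 := (Measure.quasiMeasurePreserving_snd (μ := (volume : Measure (Space d)))
      (ν := (volume : Measure (Space d)))).ae (b.coeFn_toLp 2 volume)
    filter_upwards [h1, h2, coeFn_tens (a.toLp 2 volume) (b.toLp 2 volume)] with z e1 e2 e3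
    rw [e3, e1, e2]
  have h1 : positionAverage hħ ψ (tens (a.toLp 2 volume) (b.toLp 2 volume)) =ᵐ[volume]
      fun x : Space d => ∫ y, (a (x + (ħ / 2) • y) * conj (b (x - (ħ / 2) • y))) *
        (((1 / (2 * Real.pi) ^ d : ℝ) : ℂ) * unitaryFourier ψ y) :=
    by
    filter_upwards [coeFn_averageCLM (scalesVolume_weyl hħ) (isSliceWeight_position ψ)
      (tens (a.toLp 2 volume) (b.toLp 2 volume)), average_congr (scalesVolume_weyl hħ)
      (fun z : Space d × Space d => ((1 / (2 * Real.pi) ^ d : ℝ) : ℂ) * unitaryFourier ψ z.2)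
      (ht a b)] with x e1 e2
    exact e1.trans e2
  have h2 : momentumAverage hħ ψ 0 (tens ((𝓕 a).toLp 2 volume) ((𝓕 b).toLp 2 volume)) =ᵐ[volume]
      fun ξ : Space d => ∫ p, ((𝓕 a) p * conj ((𝓕 b) (p - ξ))) * momentumWeight ħ ψ 0 (ξ, p) :=
    by
    filter_upwards [coeFn_averageCLM scalesVolume_sub (isSliceWeight_momentum hħ ψ 0)
      (tens ((𝓕 a).toLp 2 volume) ((𝓕 b).toLp 2 volume)), average_congr scalesVolume_sub
      (momentumWeight ħ ψ 0) (ht (𝓕 a) (𝓕 b))] with x e1 e2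
    exact e1.trans e2
  have h3 : Integrable (positionAverage hħ ψ (tens (a.toLp 2 volume) (b.toLp 2 volume)) :
      Space d → ℂ) := (integrable_position hħ ψ a b).integral_prod_left.congr h1.symm
  refine Lp.ext ((coeFn_fourier_of_integrable _ h3).trans ?_)
  refine EventuallyEq.trans (ae_of_all _ fun ξ => ?_) h2.symm
  rw [← fourier_position_eq hħ, fourier_eq_integral_mul, fourier_eq_integral_mul]
  refine integral_congr_ae ?_
  filter_upwards [h1] with x hx
  rw [hx]

/-- Both sides are continuous in (a, b) and agree on Schwartz functions, which are dense. -/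
theorem fourier_positionAverage_tens {ħ : ℝ} (hħ : 0 < ħ) (ψ : 𝓢(Space d, ℂ)) (a b : L2 d) :
    𝓕 (positionAverage hħ ψ (tens a b)) = momentumAverage hħ ψ 0 (tens (𝓕 a) (𝓕 b)) := by
  have hF : Continuous fun f : L2 d => (𝓕 f : L2 d) :=
    (Lp.fourierTransformₗᵢ (Space d) ℂ).continuous
  have hd : DenseRange (fun f : 𝓢(Space d, ℂ) => (f.toLp 2 volume : L2 d)) :=
    SchwartzMap.denseRange_toLpCLM (by norm_num)
  have h := hd.prodMap hd
  have := h.equalizer (g := fun p : L2 d × L2 d => (𝓕 (positionAverage hħ ψ (tens p.1 p.2)) : L2 d))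
    (h := fun p : L2 d × L2 d => momentumAverage hħ ψ 0 (tens (𝓕 p.1) (𝓕 p.2)))
    (hF.comp ((positionAverage hħ ψ).continuous.comp continuous_tens))
    ((momentumAverage hħ ψ 0).continuous.comp (continuous_tens.comp
      ((hF.comp continuous_fst).prodMk (hF.comp continuous_snd))))
    (funext fun q => by
      simp only [Function.comp_apply, Prod.map]
      rw [fourier_positionAverage_schwartz, SchwartzMap.toLp_fourier_eq,
        SchwartzMap.toLp_fourier_eq])
  exact congrFun this (a, b)

/-- The phases built into the weight undo those put on the two vectors, so a freely evolved kernel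
can be used in place of the original one. -/
theorem momentumAverage_phase {ħ : ℝ} (hħ : 0 < ħ) (ψ : 𝓢(Space d, ℂ)) (s : ℝ) (a b : L2 d) :
    momentumAverage hħ ψ s (tens (phaseMul (-s) a) (phaseMul (-s) b)) =
      momentumAverage hħ ψ 0 (tens a b) := by
  refine Lp.ext ?_
  have h1 := (Measure.quasiMeasurePreserving_fst (μ := (volume : Measure (Space d)))
    (ν := (volume : Measure (Space d)))).ae (coeFn_phaseMul (-s) a)
  have h2 := (Measure.quasiMeasurePreserving_snd (μ := (volume : Measure (Space d)))
    (ν := (volume : Measure (Space d)))).ae (coeFn_phaseMul (-s) b)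
  have h3 : tens (phaseMul (-s) a) (phaseMul (-s) b) =ᵐ[volume] fun z : Space d × Space d =>
      (phase (-s) z.1 * conj (phase (-s) z.2)) * tens a b z := by
    filter_upwards [h1, h2, coeFn_tens (phaseMul (-s) a) (phaseMul (-s) b), coeFn_tens a b]
      with z e1 e2 e3 e4
    rw [e3, e1, e2, e4, map_mul]
    ring
  refine ((coeFn_averageCLM scalesVolume_sub (isSliceWeight_momentum hħ ψ s) _).trans
      (average_congr scalesVolume_sub _ h3)).trans ?_
  refine EventuallyEq.trans (ae_of_all _ fun ξ => ?_)
    (coeFn_averageCLM scalesVolume_sub (isSliceWeight_momentum hħ ψ 0) _).symm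
  refine integral_congr_ae (ae_of_all _ fun p => ?_)
  have e : ∀ q : Space d, phase (-s) q * phase s q = 1 := fun q => by
    rw [← phase_add, neg_add_cancel, phase_zero]
  have e' : ∀ q : Space d, conj (phase (-s) q) * conj (phase s q) = 1 := fun q => by
    rw [← map_mul, e, map_one]
  simp only [momentumWeight, phase_zero, map_one, one_mul]
  calc _ = (phase (-s) p * phase s p) * (conj (phase (-s) (p - ξ)) * conj (phase s (p - ξ))) *
        (tens a b (p, p - ξ) * ψ ((2 * Real.pi * ħ) • (p - (1 / 2 : ℝ) • ξ))) := by ring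
    _ = _ := by rw [e, e', one_mul, one_mul]

/-- In Fourier space, the velocity average is given by the kernel in the interaction picture. -/
theorem InteractionData.fourier_positionAverage {R : L2 d →L[ℂ] L2 d} {s : ℝ} {κ F : KernelSpace d}
    (h : InteractionData R s κ F) {ħ : ℝ} (hħ : 0 < ħ) (ψ : 𝓢(Space d, ℂ)) :
    𝓕 (positionAverage hħ ψ κ) = momentumAverage hħ ψ s F := by
  obtain ⟨ι, g, hκ, hF⟩ := h.exists_hasSum
  have h1 := (positionAverage hħ ψ).hasSum hκ
  have h2 := ((Lp.fourierTransformₗᵢ (Space d) ℂ).toContinuousLinearEquiv :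
    L2 d →L[ℂ] L2 d).hasSum h1
  refine h2.unique (((momentumAverage hħ ψ s).hasSum hF).congr_fun fun i => ?_)
  rw [freeEvolInv, momentumAverage_phase, ← fourier_positionAverage_tens]
  rfl

end FourierLink

/-! ### The velocity average of an arbitrary density matrix -/

section VelocityAverage
variable {d : ℕ}

theorem integrable_wigner_integrand {W : Space d → ℂ} (hW : Integrable W) (ψ : 𝓢(Space d, ℂ)) :
    Integrable (fun z : Space d × Space d =>
      Complex.exp (-Complex.I * ((⟪z.1, z.2⟫_ℝ : ℝ) : ℂ)) * (ψ z.1 * W z.2))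
      (volume.prod volume) := by
  have hc : Continuous fun z : Space d × Space d =>
      Complex.exp (-Complex.I * ((⟪z.1, z.2⟫_ℝ : ℝ) : ℂ)) := by fun_prop
  refine Integrable.bdd_mul (ψ.integrable.mul_prod hW) hc.aestronglyMeasurable (c := 1)
    (ae_of_all _ fun z => ?_)
  rw [show -Complex.I * ((⟪z.1, z.2⟫_ℝ : ℝ) : ℂ) = ((-⟪z.1, z.2⟫_ℝ : ℝ) : ℂ) * Complex.I by
    push_cast; ring, Complex.norm_exp_ofReal_mul_I]

theorem wigner_mul_eq (ħ : ℝ) (k : Space d × Space d → ℂ) (ψ : 𝓢(Space d, ℂ)) (x v : Space d) :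
    wigner ħ k x v * ψ v = ((1 / (2 * Real.pi) ^ d : ℝ) : ℂ) *
      ∫ y, Complex.exp (-Complex.I * ((⟪v, y⟫_ℝ : ℝ) : ℂ)) * (ψ v * weylKernel ħ k x y) := by
  rw [wigner, mul_assoc, ← integral_mul_const]
  congr 1
  refine integral_congr_ae (ae_of_all _ fun y => ?_)
  simp only
  ring

theorem integrable_wigner_mul {ħ : ℝ} {k : Space d × Space d → ℂ} {x : Space d}
    (h : Integrable (fun y => weylKernel ħ k x y)) (ψ : 𝓢(Space d, ℂ)) :
    Integrable (fun v => wigner ħ k x v * ψ v) := by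
  simp_rw [wigner_mul_eq]
  exact (integrable_wigner_integrand h ψ).integral_prod_left.const_mul _

/-- Fubini, licensed by integrability in y along the antidiagonal and in v of ψ, carries the
v-integral onto ψ. -/
theorem integral_wigner_mul {ħ : ℝ} {k : Space d × Space d → ℂ} {x : Space d}
    (h : Integrable (fun y => weylKernel ħ k x y)) (ψ : 𝓢(Space d, ℂ)) :
    ∫ v, wigner ħ k x v * ψ v =
      ∫ y, weylKernel ħ k x y * (((1 / (2 * Real.pi) ^ d : ℝ) : ℂ) * unitaryFourier ψ y) := by
  simp_rw [wigner_mul_eq]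
  rw [integral_const_mul, integral_integral_swap (integrable_wigner_integrand h ψ),
    ← integral_const_mul]
  refine integral_congr_ae (ae_of_all _ fun y => ?_)
  simp only [unitaryFourier]
  rw [mul_left_comm, ← integral_const_mul (weylKernel ħ k x y)]
  congr 1
  refine integral_congr_ae (ae_of_all _ fun v => ?_)
  simp only
  ring

theorem IsDensityOperator.average_ae_eq {R : L2 d →L[ℂ] L2 d} (hR : IsDensityOperator R)
    {k : Space d × Space d → ℂ} (hk : IsIntegralKernel R k) {κ : KernelSpace d}
    (hκ : ∀ a b, ⟪tens a b, κ⟫_ℂ = ⟪a, R b⟫_ℂ) {ħ : ℝ} (hħ : 0 < ħ) (ψ : 𝓢(Space d, ℂ)) :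
    (fun x => ∫ v, wigner ħ k x v * ψ v) =ᵐ[volume] positionAverage hħ ψ κ := by
  filter_upwards [hR.ae_integrable_weylKernel hk hħ,
    coeFn_averageCLM (scalesVolume_weyl hħ) (isSliceWeight_position ψ) κ,
    average_congr (scalesVolume_weyl hħ)
      (fun z : Space d × Space d => ((1 / (2 * Real.pi) ^ d : ℝ) : ℂ) * unitaryFourier ψ z.2)
      (hk.ae_eq (isIntegralKernel_of_inner_tens hκ))] with x h1 h2 h3
  rw [integral_wigner_mul h1]
  exact h3.trans h2.symm

theorem averageConverges {T ħ : ℝ} (hħ : 0 < ħ) {R : ℝ → L2 d →L[ℂ] L2 d}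
    (hR : ∀ t ∈ Icc (-T) T, IsDensityOperator (R t)) {k : ℝ → Space d × Space d → ℂ}
    (hk : IsDensityMatrix T R k) (ψ : 𝓢(Space d, ℂ)) : AverageConverges T ħ ψ k := by
  intro t ht
  filter_upwards [(hR t ht).ae_integrable_weylKernel (hk.2 t ht) hħ] with x hx
  exact ⟨hx, integrable_wigner_mul hx ψ⟩

theorem aestronglyMeasurable_velocityAverage {T ħ : ℝ} (hħ : 0 < ħ) {R : ℝ → L2 d →L[ℂ] L2 d}
    {k : ℝ → Space d × Space d → ℂ} (hk : IsDensityMatrix T R k) (ψ : 𝓢(Space d, ℂ)) :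
    AEStronglyMeasurable (velocityAverage ħ ψ k) (volume.restrict (slab T d)) := by
  -- The density matrix is measurable only up to a null set of (t, X, Y), so each change of
  -- variables must pull null sets back to null sets.
  have hq : Measure.QuasiMeasurePreserving
      (fun q : ℝ × (Space d × Space d) =>
        (q.1, (q.2.1 + (ħ / 2) • q.2.2, q.2.1 - (ħ / 2) • q.2.2)))
      ((volume.restrict (Icc (-T) T)).prod volume) ((volume.restrict (Icc (-T) T)).prod volume) :=
    QuasiMeasurePreserving.prodMap (Measure.QuasiMeasurePreserving.id _)
      (quasiMeasurePreserving_weyl hħ)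
  have h1 : AEStronglyMeasurable (fun q : ℝ × (Space d × Space d) => weylKernel ħ (k q.1) q.2.1 q.2.2)
      ((volume.restrict (Icc (-T) T)).prod (volume.prod volume)) :=
    hk.1.comp_quasiMeasurePreserving hq
  have h2 : AEStronglyMeasurable (fun q : (ℝ × Space d) × Space d => weylKernel ħ (k q.1.1) q.1.2 q.2)
      (((volume.restrict (Icc (-T) T)).prod volume).prod volume) :=
    h1.comp_measurePreserving (measurePreserving_prodAssoc _ _ _)
  have h3 : AEStronglyMeasurable
      (fun q : ((ℝ × Space d) × Space d) × Space d => weylKernel ħ (k q.1.1.1) q.1.1.2 q.2)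
      ((((volume.restrict (Icc (-T) T)).prod volume).prod volume).prod volume) := by
    have hq2 : Measure.QuasiMeasurePreserving
        (fun q : ((ℝ × Space d) × Space d) × Space d => (q.1.1, q.2))
        ((((volume.restrict (Icc (-T) T)).prod (volume : Measure (Space d))).prod
          (volume : Measure (Space d))).prod (volume : Measure (Space d)))
        (((volume.restrict (Icc (-T) T)).prod volume).prod volume) :=
      QuasiMeasurePreserving.prodMap Measure.quasiMeasurePreserving_fst
        (Measure.QuasiMeasurePreserving.id _)
    exact h2.comp_quasiMeasurePreserving hq2
  have h4 : AEStronglyMeasurable (fun q : (ℝ × Space d) × Space d => wigner ħ (k q.1.1) q.1.2 q.2)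
      (((volume.restrict (Icc (-T) T)).prod volume).prod volume) := by
    have he : Continuous fun q : ((ℝ × Space d) × Space d) × Space d =>
        Complex.exp (-Complex.I * ((⟪q.1.2, q.2⟫_ℝ : ℝ) : ℂ)) := by fun_prop
    exact ((he.aestronglyMeasurable.mul h3).integral_prod_right').const_mul _
  have h5 : AEStronglyMeasurable (velocityAverage ħ ψ k)
      ((volume.restrict (Icc (-T) T)).prod volume) :=
    (h4.mul (ψ.continuous.comp continuous_snd).aestronglyMeasurable).integral_prod_right'
  have h6 : volume.restrict (slab T d) =
      (volume.restrict (Ioo (-T) T)).prod (volume : Measure (Space d)) := by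
    rw [slab, Measure.volume_eq_prod, ← Measure.prod_restrict, Measure.restrict_univ]
  rw [h6]
  exact h5.mono_ac (Measure.AbsolutelyContinuous.prod
    (Measure.restrict_mono Ioo_subset_Icc_self le_rfl).absolutelyContinuous
    Measure.AbsolutelyContinuous.rfl)

end VelocityAverage

/-! ### An abstract dispersion estimate by TT* -/

section Dispersion
variable {d : ℕ}

/-- The oscillation `e^{-i t a}`. -/
noncomputable def osc (x : ℝ) : ℂ := Complex.exp (((-x : ℝ) : ℂ) * Complex.I)

theorem norm_osc (x : ℝ) : ‖osc x‖ = 1 := Complex.norm_exp_ofReal_mul_I _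

theorem continuous_osc : Continuous osc := by unfold osc; fun_prop

theorem osc_mul_conj (x y : ℝ) : osc x * conj (osc y) = osc (x - y) := by
  rw [osc, osc, osc, ← Complex.exp_conj, ← Complex.exp_add]
  congr 1
  simp only [map_mul, Complex.conj_ofReal, Complex.conj_I]
  push_cast
  ring

theorem osc_add (x y : ℝ) : osc (x + y) = osc x * osc y := by
  rw [osc, osc, osc, ← Complex.exp_add]
  congr 1
  push_cast
  ring

/-- Schur's test: ab ≤ a² + b² decouples the two times and translation invariance evaluates the
kernel. Both Θ(r) and Θ(-r) remain since Θ need not be even. -/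
theorem schur_bound (I : Set ℝ) (u : ℝ → ℝ≥0∞) (hu : Measurable u)
    (Θ : ℝ → ℝ≥0∞) (hΘ : Measurable Θ) :
    ∫⁻ t in I, ∫⁻ s in I, u t * u s * Θ (t - s) ≤
      (∫⁻ t in I, u t ^ 2) * ((∫⁻ r, Θ r) + ∫⁻ r, Θ (-r)) := by
  have h1 : ∀ a b : ℝ≥0∞, a * b ≤ a ^ 2 + b ^ 2 := fun a b => by
    rcases le_total a b with h | h
    · exact (mul_le_mul_left h b).trans (by rw [← sq]; exact le_add_self)
    · exact (mul_le_mul_right h a).trans (by rw [← sq]; exact le_self_add)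
  have hm1 : Measurable fun z : ℝ × ℝ => u z.1 ^ 2 * Θ (z.1 - z.2) := by fun_prop
  have hm2 : Measurable fun z : ℝ × ℝ => u z.2 ^ 2 * Θ (z.1 - z.2) := by fun_prop
  calc ∫⁻ t in I, ∫⁻ s in I, u t * u s * Θ (t - s)
      ≤ ∫⁻ t in I, ∫⁻ s in I, (u t ^ 2 * Θ (t - s) + u s ^ 2 * Θ (t - s)) := by
        gcongr with t s
        rw [← add_mul]
        exact mul_le_mul_left (h1 _ _) _
    _ = (∫⁻ t in I, ∫⁻ s in I, u t ^ 2 * Θ (t - s)) +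
        ∫⁻ t in I, ∫⁻ s in I, u s ^ 2 * Θ (t - s) := by
        rw [← lintegral_add_left hm1.lintegral_prod_right']
        refine lintegral_congr fun t => ?_
        rw [lintegral_add_left (by fun_prop)]
    _ ≤ (∫⁻ t in I, u t ^ 2) * (∫⁻ r, Θ r) + (∫⁻ t in I, u t ^ 2) * ∫⁻ r, Θ (-r) := by
        refine add_le_add ?_ ?_
        · rw [← lintegral_mul_const _ (by fun_prop)]
          refine lintegral_mono fun t => ?_
          refine (setLIntegral_le_lintegral _ _).trans ?_
          rw [lintegral_const_mul _ (by fun_prop), lintegral_sub_left_eq_self Θ t]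
        · rw [lintegral_lintegral_swap hm2.aemeasurable, ← lintegral_mul_const _ (by fun_prop)]
          refine lintegral_mono fun s => ?_
          refine (setLIntegral_le_lintegral _ _).trans ?_
          rw [lintegral_const_mul _ (by fun_prop), lintegral_sub_right_eq_self Θ s,
            ← lintegral_neg_eq_self Θ]
    _ = _ := by rw [mul_add]

section
variable {α : Type*} [MeasurableSpace α] {μ : Measure α}

theorem lintegral_enorm_sq_eq_enorm_integral {f : α → ℂ} (hf : MemLp f 2 μ) :
    ∫⁻ x, ‖f x‖ₑ ^ 2 ∂μ = ‖∫ x, f x * conj (f x) ∂μ‖ₑ := by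
  have h1 : ∫ x, f x * conj (f x) ∂μ = ((∫ x, ‖f x‖ ^ 2 ∂μ : ℝ) : ℂ) := by
    rw [← integral_complex_ofReal]
    refine integral_congr_ae (ae_of_all _ fun x => ?_)
    simp only
    rw [Complex.mul_conj, Complex.normSq_eq_norm_sq]
  have h2 : Integrable (fun x => ‖f x‖ ^ 2) μ := hf.integrable_norm_pow (by norm_num)
  rw [h1, ← ofReal_norm, Complex.norm_real, Real.norm_of_nonneg (by positivity),
    ofReal_integral_eq_lintegral_ofReal h2 (ae_of_all _ fun x => by positivity)]
  refine lintegral_congr fun x => ?_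
  rw [ENNReal.ofReal_pow (norm_nonneg _), ofReal_norm]

theorem integrable_mul_self_conj {χ : α → ℂ} (hχ : MemLp χ 2 μ) :
    Integrable (fun v => χ v * conj (χ v)) μ :=
  hχ.integrable_mul hχ.star

/-- The dispersion estimate: the `L²` norm in time of an oscillating integral. -/
theorem lintegral_oscillation_le [SFinite μ] {a : α → ℝ} (ha : Measurable a) {F χ : α → ℂ}
    (hF : MemLp F 2 μ) (hχ : MemLp χ 2 μ) {I : Set ℝ} (hI : volume I ≠ ⊤) :
    ∫⁻ t in I, ‖∫ v, F v * χ v * osc (t * a v) ∂μ‖ₑ ^ 2 ≤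
      (∫⁻ v, ‖F v‖ₑ ^ 2 ∂μ) * ((∫⁻ r, ‖∫ v, χ v * conj (χ v) * osc (r * a v) ∂μ‖ₑ) +
        ∫⁻ r, ‖∫ v, χ v * conj (χ v) * osc (-r * a v) ∂μ‖ₑ) := by
  have hoscm : ∀ t, AEStronglyMeasurable (fun v => osc (t * a v)) μ := fun t =>
    (continuous_osc.measurable.comp (ha.const_mul t)).aestronglyMeasurable
  have hcont : ∀ f : α → ℂ, Integrable f μ → Continuous fun t => ∫ v, f v * osc (t * a v) ∂μ :=
    fun f hf => continuous_of_dominated (bound := fun v => ‖f v‖) (fun t => hf.1.mul (hoscm t))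
      (fun t => ae_of_all _ fun v => by rw [norm_mul, norm_osc, mul_one]) hf.norm
      (ae_of_all _ fun v => continuous_const.mul
        (continuous_osc.comp (continuous_id.mul continuous_const)))
  set u : ℝ → ℂ := fun t => ∫ v, F v * χ v * osc (t * a v) ∂μ with hu
  set Θ : ℝ → ℂ := fun t => ∫ v, χ v * conj (χ v) * osc (t * a v) ∂μ with hΘ
  have hFχ : Integrable (fun v => F v * χ v) μ := hF.integrable_mul hχ
  have huc : Continuous u := hcont _ hFχ
  have hΘc : Continuous Θ := hcont _ (integrable_mul_self_conj hχ)
  have hub : ∀ t, ‖u t‖ ≤ ∫ v, ‖F v * χ v‖ ∂μ := fun t => by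
    refine (norm_integral_le_integral_norm _).trans (le_of_eq (integral_congr_ae
      (ae_of_all _ fun v => ?_)))
    simp only
    rw [norm_mul (F v * χ v), norm_osc, mul_one]
  set ν : Measure ℝ := volume.restrict I with hν
  have : IsFiniteMeasure ν := ⟨by rw [hν, Measure.restrict_apply_univ]; exact hI.lt_top⟩
  have hu2 : MemLp u 2 ν := MemLp.of_bound huc.aestronglyMeasurable _ (ae_of_all _ hub)
  have hu1 : Integrable u ν := memLp_one_iff_integrable.1
    (MemLp.of_bound huc.aestronglyMeasurable _ (ae_of_all _ hub))
  have hu1' : Integrable (fun t => conj (u t)) ν := integrable_conj hu1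
  set A := ∫⁻ t in I, ‖u t‖ₑ ^ 2 with hA
  set B := (∫⁻ r, ‖Θ r‖ₑ) + ∫⁻ r, ‖Θ (-r)‖ₑ with hB
  -- Finiteness of A, which rests on the finite length of I and the boundedness of u, is what
  -- permits cancelling a factor A at the end.
  have hAtop : A ≠ ⊤ := (memLp_two_iff.1 hu2).2.ne
  -- The adjoint of the oscillating integral, applied to u: pairing u with its conjugate gives A as
  -- the integral of F χ g.
  set g : α → ℂ := fun v => ∫ t, conj (u t) * osc (t * a v) ∂ν with hg
  have hosc2 : Measurable fun z : ℝ × α => osc (z.1 * a z.2) :=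
    continuous_osc.measurable.comp (measurable_fst.mul (ha.comp measurable_snd))
  have hgm : AEStronglyMeasurable g μ := by
    have h1 : StronglyMeasurable fun z : α × ℝ => conj (u z.2) * osc (z.2 * a z.1) :=
      ((Complex.continuous_conj.comp (huc.comp continuous_snd)).stronglyMeasurable (α := ℝ × ℝ)
        |>.comp_measurable (g := fun z : α × ℝ => ((0 : ℝ), z.2)) (by fun_prop)).mul
        (hosc2.comp measurable_swap).stronglyMeasurable
    exact h1.integral_prod_right'.aestronglyMeasurable
  have e1 : ∫ t, u t * conj (u t) ∂ν = ∫ v, F v * (χ v * g v) ∂μ := by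
    calc ∫ t, u t * conj (u t) ∂ν = ∫ t, ∫ v, conj (u t) * (F v * χ v) * osc (t * a v) ∂μ ∂ν := by
          refine integral_congr_ae (ae_of_all _ fun t => ?_)
          simp only [mul_assoc]
          rw [integral_const_mul, mul_comm, hu]
          simp only [mul_assoc]
      _ = ∫ v, ∫ t, conj (u t) * (F v * χ v) * osc (t * a v) ∂ν ∂μ := by
          refine integral_integral_swap ?_
          have h := Integrable.bdd_mul (hu1'.mul_prod hFχ) hosc2.aestronglyMeasurable (c := 1)
            (ae_of_all _ fun z => (norm_osc _).le)
          exact h.congr (ae_of_all _ fun z => mul_comm _ _)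
      _ = ∫ v, F v * (χ v * g v) ∂μ := by
          refine integral_congr_ae (ae_of_all _ fun v => ?_)
          simp only [hg]
          rw [← mul_assoc, ← integral_const_mul]
          refine integral_congr_ae (ae_of_all _ fun t => ?_)
          simp only
          ring
  have e2 : A ^ 2 ≤ (∫⁻ v, ‖F v‖ₑ ^ 2 ∂μ) * ∫⁻ v, ‖χ v * g v‖ₑ ^ 2 ∂μ := by
    rw [hA, lintegral_enorm_sq_eq_enorm_integral hu2, e1]
    exact enorm_integral_mul_sq_le hF.1 (hχ.1.mul hgm)
  have hgb : ∀ v, ‖g v‖ ≤ ∫ t, ‖u t‖ ∂ν := fun v => by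
    refine (norm_integral_le_integral_norm _).trans (le_of_eq (integral_congr_ae
      (ae_of_all _ fun t => ?_)))
    simp only
    rw [norm_mul, norm_osc, mul_one, RCLike.norm_conj]
  have hχg : MemLp (fun v => χ v * g v) 2 μ :=
    hχ.of_le_mul (c := ∫ t, ‖u t‖ ∂ν) (hχ.1.mul hgm) (ae_of_all _ fun v => by
      rw [norm_mul, mul_comm]
      exact mul_le_mul_of_nonneg_right (hgb v) (norm_nonneg _))
  -- The composite TT* is convolution in time with Θ, the oscillating integral of |χ|².
  have e3 : ∫ v, χ v * g v * conj (χ v * g v) ∂μ =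
      ∫ z, conj (u z.1) * u z.2 * Θ (z.1 - z.2) ∂(ν.prod ν) := by
    have h1 : ∀ v, g v * conj (g v) =
        ∫ z, conj (u z.1) * u z.2 * osc ((z.1 - z.2) * a v) ∂(ν.prod ν) := fun v => by
      rw [hg]
      simp only
      rw [← integral_conj, ← integral_prod_mul]
      refine integral_congr_ae (ae_of_all _ fun z => ?_)
      simp only [map_mul, Complex.conj_conj]
      rw [sub_mul, ← osc_mul_conj]
      ring
    calc ∫ v, χ v * g v * conj (χ v * g v) ∂μ
        = ∫ v, ∫ z, χ v * conj (χ v) * (conj (u z.1) * u z.2) * osc ((z.1 - z.2) * a v)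
            ∂(ν.prod ν) ∂μ := by
          refine integral_congr_ae (ae_of_all _ fun v => ?_)
          simp only [mul_assoc]
          rw [integral_const_mul, integral_const_mul]
          simp only [← mul_assoc]
          rw [← h1, map_mul]
          ring
      _ = ∫ z, ∫ v, χ v * conj (χ v) * (conj (u z.1) * u z.2) * osc ((z.1 - z.2) * a v)
            ∂μ ∂(ν.prod ν) := by
          refine integral_integral_swap ?_
          have hm : Measurable fun q : α × (ℝ × ℝ) => osc ((q.2.1 - q.2.2) * a q.1) :=
            hosc2.comp ((measurable_fst.comp measurable_snd |>.sub
              (measurable_snd.comp measurable_snd)).prodMk measurable_fst)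
          have h := Integrable.bdd_mul ((integrable_mul_self_conj hχ).mul_prod
            (hu1'.mul_prod hu1)) hm.aestronglyMeasurable (c := 1)
            (ae_of_all _ fun z => (norm_osc _).le)
          exact h.congr (ae_of_all _ fun z => mul_comm _ _)
      _ = _ := by
          refine integral_congr_ae (ae_of_all _ fun z => ?_)
          refine Eq.trans ?_ (integral_const_mul (conj (u z.1) * u z.2) _)
          refine integral_congr_ae (ae_of_all _ fun v => ?_)
          simp only
          ring
  have e4 : ∫⁻ v, ‖χ v * g v‖ₑ ^ 2 ∂μ ≤ A * B := by
    rw [lintegral_enorm_sq_eq_enorm_integral hχg, e3]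
    refine (enorm_integral_le_lintegral_enorm _).trans ?_
    have hm : Measurable fun z : ℝ × ℝ => ‖conj (u z.1) * u z.2 * Θ (z.1 - z.2)‖ₑ := by
      have : Continuous fun z : ℝ × ℝ => conj (u z.1) * u z.2 * Θ (z.1 - z.2) := by fun_prop
      exact this.measurable.enorm
    rw [lintegral_prod _ hm.aemeasurable]
    refine le_trans (le_of_eq ?_) (schur_bound I (fun t => ‖u t‖ₑ) huc.measurable.enorm
      (fun r => ‖Θ r‖ₑ) hΘc.measurable.enorm)
    refine lintegral_congr fun t => lintegral_congr fun s => ?_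
    rw [enorm_mul, enorm_mul, RCLike.enorm_conj]
  -- Cauchy–Schwarz bounds A² by ‖F‖² ‖χ g‖², and Schur's test bounds ‖χ g‖² by A B.
  have e5 : A * A ≤ A * ((∫⁻ v, ‖F v‖ₑ ^ 2 ∂μ) * B) := by
    rw [← sq]
    refine (e2.trans (mul_le_mul_right e4 _)).trans (le_of_eq ?_)
    ring
  rcases eq_or_ne A 0 with h0 | h0
  · rw [h0]; exact bot_le
  · exact (ENNReal.mul_le_mul_iff_right h0 hAtop).1 e5

end

end Dispersion

/-! ### Half a derivative for frozen kernels, frequency by frequency -/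

section MomentumDispersion
variable {d : ℕ}

theorem exists_schwartz_mul_conj (χ : 𝓢(Space d, ℂ)) :
    ∃ g : 𝓢(Space d, ℂ), ∀ v, g v = χ v * conj (χ v) := by
  refine ⟨SchwartzMap.pairing (ContinuousLinearMap.mul ℝ ℂ) χ
    (SchwartzMap.postcompCLM (Complex.conjCLE : ℂ →L[ℝ] ℂ) χ), fun v => ?_⟩
  rfl

theorem exists_schwartz_coord_mul (χ : 𝓢(Space d, ℂ)) (i : Fin d) :
    ∃ g : 𝓢(Space d, ℂ), ∀ v, g v = (v i : ℂ) * χ v := by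
  have h : (fun v : Space d => v i).HasTemperateGrowth := by
    exact (EuclideanSpace.proj (𝕜 := ℝ) i).hasTemperateGrowth
  refine ⟨SchwartzMap.smulLeftCLM ℂ (fun v : Space d => v i) χ, fun v => ?_⟩
  rw [SchwartzMap.smulLeftCLM_apply_apply h, Complex.real_smul]

theorem exists_schwartz_decay (g : 𝓢(Space d, ℂ)) :
    ∃ K : ℝ, 0 ≤ K ∧ ∀ η, ‖g η‖ ≤ K * (1 + ‖η‖ ^ 2)⁻¹ := by
  obtain ⟨K0, hK0, h0⟩ := g.decay 0 0
  obtain ⟨K2, hK2, h2⟩ := g.decay 2 0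
  refine ⟨K0 + K2, by positivity, fun η => ?_⟩
  rw [← div_eq_mul_inv, le_div_iff₀ (by positivity)]
  have e0 := h0 η
  have e2 := h2 η
  rw [norm_iteratedFDeriv_zero] at e0 e2
  rw [pow_zero, one_mul] at e0
  nlinarith

theorem lintegral_comp_mul_real (f : ℝ → ℝ≥0∞) {c : ℝ} (hc : 0 < c) :
    ∫⁻ r, f (c * r) = ENNReal.ofReal c⁻¹ * ∫⁻ r, f r := by
  have h2 : ∫⁻ r, f (c * r) = ∫⁻ r, f r ∂(Measure.map (fun r : ℝ => c * r) volume) :=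
    ((Homeomorph.mulLeft₀ c hc.ne').measurableEmbedding.lintegral_map f).symm
  rw [h2, Real.map_volume_mul_left hc.ne', lintegral_smul_measure, smul_eq_mul,
    abs_of_pos (by positivity)]

/-- The Fourier transform of a Schwartz function is integrable along lines. -/
theorem lintegral_line_le (g : 𝓢(Space d, ℂ)) : ∃ c : ℝ≥0∞, c ≠ ⊤ ∧ ∀ η : Space d, η ≠ 0 →
    ∫⁻ r : ℝ, ‖g (r • η)‖ₑ ≤ c * ‖η‖ₑ⁻¹ := by
  obtain ⟨K, hK, h⟩ := exists_schwartz_decay g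
  have hi : Integrable fun s : ℝ => K * (1 + s ^ 2)⁻¹ := integrable_inv_one_add_sq.const_mul K
  refine ⟨∫⁻ s : ℝ, ENNReal.ofReal (K * (1 + s ^ 2)⁻¹), ?_, fun η hη => ?_⟩
  · exact (hi.lintegral_lt_top).ne
  · have hη' : 0 < ‖η‖ := norm_pos_iff.2 hη
    have h1 : ∫⁻ r : ℝ, ‖g (r • η)‖ₑ ≤
        ∫⁻ r : ℝ, ENNReal.ofReal (K * (1 + (‖η‖ * r) ^ 2)⁻¹) := by
      refine lintegral_mono fun r => ?_
      rw [← ofReal_norm]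
      refine ENNReal.ofReal_le_ofReal ((h _).trans (le_of_eq ?_))
      rw [norm_smul, mul_pow, mul_pow, Real.norm_eq_abs, sq_abs, mul_comm (r ^ 2)]
    refine h1.trans (le_of_eq ?_)
    rw [lintegral_comp_mul_real (fun s : ℝ => ENNReal.ofReal (K * (1 + s ^ 2)⁻¹)) hη', mul_comm,
      ENNReal.ofReal_inv_of_pos hη', ofReal_norm]

/-- Since ‖p‖² - ‖p - ξ‖² = 2⟨p - ξ/2, ξ⟩, the two quadratic phases combine into one that is linear
in v = 2πħ(p - ξ/2). In this variable ħ disappears from the phase: it is the Fourier multiplier of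
transport with velocity v/m. -/
theorem momentumWeight_freeRate {m ħ : ℝ} (hm : m ≠ 0) (hħ : ħ ≠ 0) (χ : 𝓢(Space d, ℂ)) (t : ℝ)
    (ξ p : Space d) : momentumWeight ħ χ (freeRate m ħ * t) (ξ, p) =
      χ ((2 * Real.pi * ħ) • (p - (1 / 2 : ℝ) • ξ)) *
        osc (t * (2 * Real.pi / m * ⟪(2 * Real.pi * ħ) • (p - (1 / 2 : ℝ) • ξ), ξ⟫_ℝ)) := by
  have h : freeRate m ħ * t * ‖p‖ ^ 2 - freeRate m ħ * t * ‖p - ξ‖ ^ 2 =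
      t * (2 * Real.pi / m * ⟪(2 * Real.pi * ħ) • (p - (1 / 2 : ℝ) • ξ), ξ⟫_ℝ) := by
    rw [norm_sub_sq_real, inner_smul_left, inner_sub_left, inner_smul_left,
      real_inner_self_eq_norm_sq, freeRate]
    simp only [conj_trivial]
    field_simp
    ring
  have e : ∀ q : Space d, phase (freeRate m ħ * t) q = osc (freeRate m ħ * t * ‖q‖ ^ 2) := by
    intro q
    rw [phase, osc]
    congr 1
    push_cast
    ring
  rw [momentumWeight, e, e, osc_mul_conj, h, mul_comm]

theorem integral_momentum {ħ : ℝ} (hħ : 0 < ħ) (f : Space d → ℂ) (ξ : Space d) :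
    ∫ p, f ((2 * Real.pi * ħ) • (p - (1 / 2 : ℝ) • ξ)) =
      (((2 * Real.pi * ħ) ^ d)⁻¹ : ℝ) • ∫ v, f v := by
  rw [integral_sub_right_eq_self (fun p => f ((2 * Real.pi * ħ) • p)) ((1 / 2 : ℝ) • ξ),
    Measure.integral_comp_smul, finrank_euclideanSpace, Fintype.card_fin,
    abs_of_pos (by positivity)]

/-- The velocity average of a free evolution gains half a derivative. -/
theorem exists_dispersion_bound {m : ℝ} (hm : 0 < m) (χ : 𝓢(Space d, ℂ)) :
    ∃ c : ℝ≥0∞, c ≠ ⊤ ∧ ∀ ħ : ℝ, 0 < ħ → ∀ ξ : Space d, ξ ≠ 0 → ∀ F : Space d → ℂ,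
      MemLp F 2 volume → ∀ I : Set ℝ, volume I ≠ ⊤ →
      ∫⁻ t in I, ‖∫ p, F p * momentumWeight ħ χ (freeRate m ħ * t) (ξ, p)‖ₑ ^ 2 ≤
        (∫⁻ p, ‖F p‖ₑ ^ 2) * (c * ENNReal.ofReal ((2 * Real.pi * ħ) ^ d)⁻¹ * ‖ξ‖ₑ⁻¹) := by
  obtain ⟨g, hg⟩ := exists_schwartz_mul_conj χ
  obtain ⟨c, hc, hcb⟩ := lintegral_line_le (𝓕 g)
  refine ⟨2 * (c * ENNReal.ofReal m), by finiteness, fun ħ hħ ξ hξ F hF I hI => ?_⟩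
  set a : Space d → ℝ := fun p =>
    2 * Real.pi / m * ⟪(2 * Real.pi * ħ) • (p - (1 / 2 : ℝ) • ξ), ξ⟫_ℝ with ha
  set X : Space d → ℂ := fun p => χ ((2 * Real.pi * ħ) • (p - (1 / 2 : ℝ) • ξ)) with hX
  have hac : Continuous a := by rw [ha]; fun_prop
  have hXc : Continuous X := by rw [hX]; exact χ.continuous.comp (by fun_prop)
  have hX2 : MemLp X 2 volume := by
    refine memLp_two_iff.2 ⟨hXc.aestronglyMeasurable, ?_⟩
    rw [hX, lintegral_momentum hħ (fun v => ‖χ v‖ₑ ^ 2)]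
    exact ENNReal.mul_lt_top ENNReal.ofReal_lt_top (memLp_two_iff.1 (χ.memLp 2)).2
  -- The autocorrelation in time is the Fourier transform of |χ|² at the point rξ/m; its integral
  -- over r is of order m/|ξ|.
  have hΘ : ∀ r : ℝ, ∫ p, X p * conj (X p) * osc (r * a p) =
      (((2 * Real.pi * ħ) ^ d)⁻¹ : ℝ) • (𝓕 g) (r • (m⁻¹ • ξ)) := fun r => by
    have h1 := integral_momentum hħ
      (fun v => χ v * conj (χ v) * osc (r * (2 * Real.pi / m * ⟪v, ξ⟫_ℝ))) ξ
    refine h1.trans ?_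
    congr 1
    rw [SchwartzMap.fourier_coe, Real.fourier_eq']
    refine integral_congr_ae (ae_of_all _ fun v => ?_)
    simp only [smul_eq_mul, hg, inner_smul_right, osc]
    rw [mul_comm]
    congr 3
    push_cast
    field_simp
  have hb : ∀ σ : ℝ, |σ| = 1 → ∫⁻ r : ℝ, ‖∫ p, X p * conj (X p) * osc (σ * r * a p)‖ₑ ≤
      c * ENNReal.ofReal m * ENNReal.ofReal ((2 * Real.pi * ħ) ^ d)⁻¹ * ‖ξ‖ₑ⁻¹ := by
    intro σ hσ
    have hne : (σ * m⁻¹) • ξ ≠ 0 := smul_ne_zero (mul_ne_zero (by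
      rintro rfl; simp at hσ) (inv_ne_zero hm.ne')) hξ
    have hn : ‖(σ * m⁻¹) • ξ‖ₑ⁻¹ = ENNReal.ofReal m * ‖ξ‖ₑ⁻¹ := by
      rw [← ofReal_norm, norm_smul, norm_mul, Real.norm_eq_abs, hσ, one_mul, norm_inv,
        Real.norm_of_nonneg hm.le, ENNReal.ofReal_mul (by positivity), ENNReal.mul_inv
          (Or.inr ENNReal.ofReal_ne_top) (Or.inl ENNReal.ofReal_ne_top),
        ENNReal.ofReal_inv_of_pos hm, inv_inv, ofReal_norm]
    have h2 : ∀ r : ℝ, ‖∫ p, X p * conj (X p) * osc (σ * r * a p)‖ₑ =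
        ENNReal.ofReal ((2 * Real.pi * ħ) ^ d)⁻¹ * ‖(𝓕 g) (r • ((σ * m⁻¹) • ξ))‖ₑ := fun r => by
      rw [hΘ, enorm_smul, Real.enorm_of_nonneg (by positivity), smul_smul, smul_smul]
      congr 4
      ring
    simp_rw [h2]
    rw [lintegral_const_mul' _ _ ENNReal.ofReal_ne_top]
    calc _ ≤ ENNReal.ofReal ((2 * Real.pi * ħ) ^ d)⁻¹ * (c * ‖(σ * m⁻¹) • ξ‖ₑ⁻¹) :=
          mul_le_mul_right (hcb _ hne) _
      _ = _ := by rw [hn]; ring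
  have key := lintegral_oscillation_le hac.measurable hF hX2 hI
  have hl : ∫⁻ t in I, ‖∫ p, F p * momentumWeight ħ χ (freeRate m ħ * t) (ξ, p)‖ₑ ^ 2 =
      ∫⁻ t in I, ‖∫ p, F p * X p * osc (t * a p)‖ₑ ^ 2 := by
    simp only [momentumWeight_freeRate hm.ne' hħ.ne', ha, hX, mul_assoc]
  rw [hl]
  refine key.trans (mul_le_mul_right ?_ _)
  have h1 := hb 1 (by simp)
  have h2 := hb (-1) (by simp)
  simp only [one_mul] at h1
  simp only [neg_one_mul] at h2
  calc _ ≤ _ := add_le_add h1 h2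
    _ = _ := by ring

theorem norm_osc_sub_one_le (x : ℝ) : ‖osc x - 1‖ ≤ |x| := by
  have h := Real.norm_exp_I_mul_ofReal_sub_one_le (x := -x)
  rw [Real.norm_eq_abs, abs_neg] at h
  rwa [osc, mul_comm]

theorem norm_momentumWeight (ħ : ℝ) (χ : 𝓢(Space d, ℂ)) (s : ℝ) (ξ p : Space d) :
    ‖momentumWeight ħ χ s (ξ, p)‖ = ‖χ ((2 * Real.pi * ħ) • (p - (1 / 2 : ℝ) • ξ))‖ := by
  rw [momentumWeight, norm_mul, norm_mul, norm_phase, RCLike.norm_conj, norm_phase, one_mul,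
    one_mul]

theorem continuous_integral_momentumWeight {ħ : ℝ} (hħ : 0 < ħ) (χ : 𝓢(Space d, ℂ))
    {F : Space d → ℂ} (hF : MemLp F 2 volume) (ξ : Space d) :
    Continuous fun s => ∫ p, F p * momentumWeight ħ χ s (ξ, p) := by
  have hint : ∀ s, Integrable fun p => F p * momentumWeight ħ χ s (ξ, p) := fun s =>
    hF.integrable_mul ((isSliceWeight_momentum hħ χ s).memLp ξ)
  have hc : ∀ p, Continuous fun s => F p * momentumWeight ħ χ s (ξ, p) := fun p => by
    have h := (continuous_momentumWeight ħ χ).comp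
      (Continuous.prodMk_left (X := ℝ) ((ξ, p) : Space d × Space d))
    exact continuous_const.mul h
  refine continuous_of_dominated (F := fun s p => F p * momentumWeight ħ χ s (ξ, p))
    (bound := fun p => ‖F p * momentumWeight ħ χ 0 (ξ, p)‖)
    (fun s => (hint s).1) (fun s => ae_of_all _ fun p => le_of_eq ?_) (hint 0).norm
    (ae_of_all _ hc)
  rw [norm_mul, norm_mul, norm_momentumWeight, norm_momentumWeight]

theorem momentumWeight_increment {m ħ : ℝ} (hm : m ≠ 0) (hħ : ħ ≠ 0) (χ : 𝓢(Space d, ℂ))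
    (t r : ℝ) (ξ p : Space d) :
    momentumWeight ħ χ (freeRate m ħ * (t + r)) (ξ, p) -
      momentumWeight ħ χ (freeRate m ħ * t) (ξ, p) =
    (osc (r * (2 * Real.pi / m * ⟪(2 * Real.pi * ħ) • (p - (1 / 2 : ℝ) • ξ), ξ⟫_ℝ)) - 1) *
      momentumWeight ħ χ (freeRate m ħ * t) (ξ, p) := by
  rw [momentumWeight_freeRate hm hħ, momentumWeight_freeRate hm hħ, add_mul, osc_add]
  ring

/-- A time shift multiplies the integrand by an oscillation minus one, bounded by 2 and independent
of t, so it can be absorbed into F at the price of a factor 4. -/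
theorem exists_large_increment_bound {m : ℝ} (hm : 0 < m) (χ : 𝓢(Space d, ℂ)) :
    ∃ c : ℝ≥0∞, c ≠ ⊤ ∧ ∀ ħ : ℝ, 0 < ħ → ∀ ξ : Space d, ξ ≠ 0 → ∀ F : Space d → ℂ,
      MemLp F 2 volume → ∀ I : Set ℝ, volume I ≠ ⊤ → ∀ r : ℝ,
      ∫⁻ t in I, ‖∫ p, F p * (momentumWeight ħ χ (freeRate m ħ * (t + r)) (ξ, p) -
          momentumWeight ħ χ (freeRate m ħ * t) (ξ, p))‖ₑ ^ 2 ≤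
        (∫⁻ p, ‖F p‖ₑ ^ 2) * (c * ENNReal.ofReal ((2 * Real.pi * ħ) ^ d)⁻¹ * ‖ξ‖ₑ⁻¹) := by
  obtain ⟨c0, hc0, hb0⟩ := exists_dispersion_bound hm χ
  refine ⟨4 * c0, by finiteness, fun ħ hħ ξ hξ F hF I hI r => ?_⟩
  set o : Space d → ℂ := fun p =>
    osc (r * (2 * Real.pi / m * ⟪(2 * Real.pi * ħ) • (p - (1 / 2 : ℝ) • ξ), ξ⟫_ℝ)) - 1 with ho
  have hoc : Continuous o := (continuous_osc.comp (by fun_prop)).sub continuous_const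
  have heq : ∀ t, ∫ p, F p * (momentumWeight ħ χ (freeRate m ħ * (t + r)) (ξ, p) -
      momentumWeight ħ χ (freeRate m ħ * t) (ξ, p)) =
      ∫ p, F p * o p * momentumWeight ħ χ (freeRate m ħ * t) (ξ, p) := fun t => by
    refine integral_congr_ae (ae_of_all _ fun p => ?_)
    simp only [ho]
    rw [momentumWeight_increment hm.ne' hħ.ne']
    ring
  simp_rw [heq]
  have h2 : ∀ p, ‖o p‖ ≤ 2 := fun p => by
    refine (norm_sub_le _ _).trans ?_
    rw [norm_osc, norm_one]
    norm_num
  have hF' : MemLp (fun p => F p * o p) 2 volume :=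
    hF.of_le_mul (c := 2) (hF.1.mul hoc.aestronglyMeasurable) (ae_of_all _ fun p => by
      rw [norm_mul, mul_comm]
      exact mul_le_mul_of_nonneg_right (h2 p) (norm_nonneg _))
  have h3 : ∫⁻ p, ‖F p * o p‖ₑ ^ 2 ≤ 4 * ∫⁻ p, ‖F p‖ₑ ^ 2 := by
    rw [← lintegral_const_mul' _ _ (by norm_num)]
    refine lintegral_mono fun p => ?_
    rw [enorm_mul, mul_pow, mul_comm]
    refine mul_le_mul_left ?_ _
    have h4 : ‖o p‖ₑ ≤ 2 := by
      rw [← ofReal_norm]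
      exact (ENNReal.ofReal_le_ofReal (h2 p)).trans (by simp)
    exact (pow_le_pow_left' h4 2).trans (by norm_num)
  refine (hb0 ħ hħ ξ hξ _ hF' I hI).trans ((mul_le_mul_left h3 _).trans (le_of_eq ?_))
  ring

theorem enorm_sum_coord_mul_sq_le (ξ : Space d) (r : ℝ) (x : Fin d → ℂ) :
    ‖∑ i, ((r * ξ i : ℝ) : ℂ) * x i‖ₑ ^ 2 ≤ (‖r‖ₑ * ‖ξ‖ₑ) ^ 2 * ∑ i, ‖x i‖ₑ ^ 2 := by
  have h6 : ‖∑ i, ((r * ξ i : ℝ) : ℂ) * x i‖ ^ 2 ≤ (|r| * ‖ξ‖) ^ 2 * ∑ i, ‖x i‖ ^ 2 := by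
    have h7 : ‖∑ i, ((r * ξ i : ℝ) : ℂ) * x i‖ ≤ ∑ i, |r * ξ i| * ‖x i‖ := by
      refine (norm_sum_le _ _).trans (le_of_eq (Finset.sum_congr rfl fun i _ => ?_))
      rw [norm_mul, Complex.norm_real, Real.norm_eq_abs]
    refine (pow_le_pow_left₀ (norm_nonneg _) h7 2).trans
      ((Finset.sum_mul_sq_le_sq_mul_sq _ _ _).trans (le_of_eq ?_))
    congr 1
    rw [mul_pow _ ‖ξ‖, EuclideanSpace.norm_sq_eq, Finset.mul_sum]
    refine Finset.sum_congr rfl fun i _ => ?_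
    rw [sq_abs, Real.norm_eq_abs, sq_abs, mul_pow _ (ξ i), sq_abs]
  have h8 := ENNReal.ofReal_le_ofReal h6
  rw [ENNReal.ofReal_mul (by positivity), ENNReal.ofReal_pow (norm_nonneg _),
    ENNReal.ofReal_pow (by positivity), ENNReal.ofReal_mul (abs_nonneg _),
    ENNReal.ofReal_sum_of_nonneg (fun i _ => by positivity), ← Real.norm_eq_abs] at h8
  simp_rw [ENNReal.ofReal_pow (norm_nonneg _), ofReal_norm] at h8
  exact h8

/-- The quotient by a p is measurable and bounded by 1; where a p = 0 both sides vanish by the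
convention for the inverse of zero. -/
theorem exists_osc_sub_one_eq_mul {a : Space d → ℝ} (ha : Measurable a) :
    ∃ b : Space d → ℂ, Measurable b ∧ (∀ p, ‖b p‖ ≤ 1) ∧ ∀ p, osc (a p) - 1 = b p * (a p : ℂ) := by
  refine ⟨fun p => (osc (a p) - 1) * (a p : ℂ)⁻¹, ?_, fun p => ?_, fun p => ?_⟩
  · exact ((continuous_osc.measurable.comp ha).sub_const 1).mul
      (Complex.measurable_ofReal.comp ha).inv
  · rw [norm_mul, norm_inv, Complex.norm_real, Real.norm_eq_abs, ← div_eq_mul_inv]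
    exact div_le_one_of_le₀ (norm_osc_sub_one_le _) (abs_nonneg _)
  · rcases eq_or_ne (a p) 0 with h0 | h0
    · simp [h0, osc]
    · rw [inv_mul_cancel_right₀ (Complex.ofReal_ne_zero.2 h0)]

/-- The oscillation minus one is b times its phase, which is proportional to r v·ξ with |b| ≤ 1. The
factor b goes into F, the coordinates of v go into the profile, which stays Schwartz, and the
dispersion bound applies to each coordinate. What remains is the gain (|r||ξ|)². -/
theorem exists_small_increment_bound {m : ℝ} (hm : 0 < m) (χ : 𝓢(Space d, ℂ)) :
    ∃ c : ℝ≥0∞, c ≠ ⊤ ∧ ∀ ħ : ℝ, 0 < ħ → ∀ ξ : Space d, ξ ≠ 0 → ∀ F : Space d → ℂ,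
      MemLp F 2 volume → ∀ I : Set ℝ, volume I ≠ ⊤ → ∀ r : ℝ,
      ∫⁻ t in I, ‖∫ p, F p * (momentumWeight ħ χ (freeRate m ħ * (t + r)) (ξ, p) -
          momentumWeight ħ χ (freeRate m ħ * t) (ξ, p))‖ₑ ^ 2 ≤
        (∫⁻ p, ‖F p‖ₑ ^ 2) * (c * ENNReal.ofReal ((2 * Real.pi * ħ) ^ d)⁻¹ * ‖ξ‖ₑ⁻¹ *
          (‖r‖ₑ * ‖ξ‖ₑ) ^ 2) := by
  choose χ' hχ' using exists_schwartz_coord_mul χ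
  choose c1 hc1 hb1 using fun i => exists_dispersion_bound hm (χ' i)
  set K : ℝ := 2 * Real.pi / m with hK
  refine ⟨‖K‖ₑ ^ 2 * ∑ i, c1 i, ENNReal.mul_ne_top (ENNReal.pow_ne_top enorm_ne_top)
    (ENNReal.sum_ne_top.2 fun i _ => hc1 i), fun ħ hħ ξ hξ F hF I hI r => ?_⟩
  set v : Space d → Space d := fun p => (2 * Real.pi * ħ) • (p - (1 / 2 : ℝ) • ξ) with hv
  have hvc : Continuous v := by rw [hv]; fun_prop
  obtain ⟨b, hbm, hb1', hbosc⟩ := exists_osc_sub_one_eq_mul (a := fun p => r * (K * ⟪v p, ξ⟫_ℝ))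
    (by fun_prop)
  have hF' : MemLp (fun p => F p * b p) 2 volume :=
    hF.of_le (hF.1.mul hbm.aestronglyMeasurable) (ae_of_all _ fun p => by
      rw [norm_mul]
      exact mul_le_of_le_one_right (norm_nonneg _) (hb1' p))
  have hN' : ∫⁻ p, ‖F p * b p‖ₑ ^ 2 ≤ ∫⁻ p, ‖F p‖ₑ ^ 2 := by
    refine lintegral_mono fun p => pow_le_pow_left' ?_ 2
    rw [enorm_mul]
    refine mul_le_of_le_one_right' ?_
    rw [← ofReal_norm, ← ENNReal.ofReal_one]
    exact ENNReal.ofReal_le_ofReal (hb1' p)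
  have hsum : ∀ t p, F p * (momentumWeight ħ χ (freeRate m ħ * (t + r)) (ξ, p) -
      momentumWeight ħ χ (freeRate m ħ * t) (ξ, p)) = ∑ i, ((r * K * ξ i : ℝ) : ℂ) *
        ((F p * b p) * momentumWeight ħ (χ' i) (freeRate m ħ * t) (ξ, p)) := fun t p => by
    have h4 := hbosc p
    simp only [hv, hK] at h4
    have h5 : ⟪v p, ξ⟫_ℝ = ∑ i, ξ i * (v p) i := by
      rw [PiLp.inner_apply]
      exact Finset.sum_congr rfl fun i _ => by simp only [RCLike.inner_apply, conj_trivial]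
    have h6 : ∀ i, momentumWeight ħ (χ' i) (freeRate m ħ * t) (ξ, p) =
        ((v p) i : ℂ) * momentumWeight ħ χ (freeRate m ħ * t) (ξ, p) := fun i => by
      rw [momentumWeight, momentumWeight, hχ']
      ring
    rw [momentumWeight_increment hm.ne' hħ.ne', h4]
    simp only [h6]
    change F p * (b p * ((r * (K * ⟪v p, ξ⟫_ℝ) : ℝ) : ℂ) * _) = _
    rw [h5]
    push_cast
    rw [Finset.mul_sum, Finset.mul_sum, Finset.mul_sum, Finset.sum_mul, Finset.mul_sum]
    refine Finset.sum_congr rfl fun i _ => ?_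
    ring
  have hint : ∀ t i, Integrable fun p =>
      (F p * b p) * momentumWeight ħ (χ' i) (freeRate m ħ * t) (ξ, p) := fun t i =>
    hF'.integrable_mul ((isSliceWeight_momentum hħ (χ' i) (freeRate m ħ * t)).memLp ξ)
  have hpt : ∀ t, ‖∫ p, F p * (momentumWeight ħ χ (freeRate m ħ * (t + r)) (ξ, p) -
      momentumWeight ħ χ (freeRate m ħ * t) (ξ, p))‖ₑ ^ 2 ≤ (‖r * K‖ₑ * ‖ξ‖ₑ) ^ 2 *
      ∑ i, ‖∫ p, (F p * b p) * momentumWeight ħ (χ' i) (freeRate m ħ * t) (ξ, p)‖ₑ ^ 2 := by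
    intro t
    simp_rw [hsum]
    rw [integral_finsetSum _ fun i _ => (hint t i).const_mul _]
    simp_rw [integral_const_mul]
    exact enorm_sum_coord_mul_sq_le ξ (r * K) _
  have hm' : ∀ i, Measurable fun t =>
      ‖∫ p, (F p * b p) * momentumWeight ħ (χ' i) (freeRate m ħ * t) (ξ, p)‖ₑ ^ 2 := fun i =>
    ((continuous_integral_momentumWeight hħ (χ' i) hF' ξ).comp
      (continuous_const.mul continuous_id)).measurable.enorm.pow_const 2
  refine (lintegral_mono hpt).trans ?_
  rw [lintegral_const_mul _ (Finset.measurable_sum _ fun i _ => hm' i),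
    lintegral_finsetSum _ fun i _ => hm' i]
  calc _ ≤ (‖r * K‖ₑ * ‖ξ‖ₑ) ^ 2 * ∑ i, (∫⁻ p, ‖F p‖ₑ ^ 2) *
        (c1 i * ENNReal.ofReal ((2 * Real.pi * ħ) ^ d)⁻¹ * ‖ξ‖ₑ⁻¹) := by
        gcongr with i
        exact (hb1 i ħ hħ ξ hξ _ hF' I hI).trans (mul_le_mul_left hN' _)
    _ = _ := by
        rw [← Finset.mul_sum, ← Finset.sum_mul, ← Finset.sum_mul, enorm_mul]
        ring

/-- The time increments of the velocity average of a free evolution. -/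
theorem exists_increment_bound {m : ℝ} (hm : 0 < m) (χ : 𝓢(Space d, ℂ)) :
    ∃ c : ℝ≥0∞, c ≠ ⊤ ∧ ∀ ħ : ℝ, 0 < ħ → ∀ ξ : Space d, ξ ≠ 0 → ∀ F : Space d → ℂ,
      MemLp F 2 volume → ∀ I : Set ℝ, volume I ≠ ⊤ → ∀ r : ℝ,
      ∫⁻ t in I, ‖∫ p, F p * (momentumWeight ħ χ (freeRate m ħ * (t + r)) (ξ, p) -
          momentumWeight ħ χ (freeRate m ħ * t) (ξ, p))‖ₑ ^ 2 ≤
        (∫⁻ p, ‖F p‖ₑ ^ 2) * (c * ENNReal.ofReal ((2 * Real.pi * ħ) ^ d)⁻¹ * ‖ξ‖ₑ⁻¹ *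
          min 1 (‖r‖ₑ * ‖ξ‖ₑ) ^ 2) := by
  obtain ⟨c0, hc0, hb0⟩ := exists_large_increment_bound hm χ
  obtain ⟨c1, hc1, hb1⟩ := exists_small_increment_bound hm χ
  refine ⟨c0 + c1, by finiteness, fun ħ hħ ξ hξ F hF I hI r => ?_⟩
  rcases le_total 1 (‖r‖ₑ * ‖ξ‖ₑ) with h | h
  · rw [min_eq_left h, one_pow, mul_one]
    refine (hb0 ħ hħ ξ hξ F hF I hI r).trans ?_
    gcongr
    exact le_self_add
  · rw [min_eq_right h]
    refine (hb1 ħ hħ ξ hξ F hF I hI r).trans ?_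
    gcongr
    exact le_add_self

end MomentumDispersion

/-! ### Chaining: from frozen to slowly varying arguments -/

section Dyadic

theorem tsum_ofReal_geometric {r : ℝ} (h0 : 0 ≤ r) (h1 : r < 1) :
    ∑' n : ℕ, ENNReal.ofReal (r ^ n) = ENNReal.ofReal (1 - r)⁻¹ := by
  rw [← ENNReal.ofReal_tsum_of_nonneg (fun n => pow_nonneg h0 n) (summable_geometric_of_lt_one h0 h1),
    tsum_geometric_of_lt_one h0 h1]

/-- Cauchy–Schwarz with weights (4/5)^n, whose squares sum to 25/9 ≤ 3. The growth rate 25/16 is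
chosen below 2, so the factor 2^(-n) from the Lipschitz bound still makes the final series converge.
-/
theorem tsum_sq_le_weighted (b : ℕ → ℝ≥0∞) :
    (∑' n, b n) ^ 2 ≤ 3 * ∑' n, ENNReal.ofReal ((25 / 16) ^ n) * b n ^ 2 := by
  have h := lintegral_mul_sq_le (μ := (Measure.count : Measure ℕ))
    (f := fun n => ENNReal.ofReal ((4 / 5) ^ n)) (g := fun n => ENNReal.ofReal ((5 / 4) ^ n) * b n)
    (measurable_of_countable _).aemeasurable (measurable_of_countable _).aemeasurable
  simp only [lintegral_count] at h
  have e1 : ∀ n : ℕ, ENNReal.ofReal ((4 / 5) ^ n) * (ENNReal.ofReal ((5 / 4) ^ n) * b n) = b n := by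
    intro n
    rw [← mul_assoc, ← ENNReal.ofReal_mul (by positivity), ← mul_pow]
    norm_num
  have e2 : ∀ n : ℕ, ENNReal.ofReal ((4 / 5) ^ n) ^ 2 = ENNReal.ofReal ((16 / 25) ^ n) := by
    intro n
    rw [← ENNReal.ofReal_pow (by positivity), ← pow_mul, mul_comm, pow_mul]
    norm_num
  have e3 : ∀ n : ℕ, (ENNReal.ofReal ((5 / 4) ^ n) * b n) ^ 2 =
      ENNReal.ofReal ((25 / 16) ^ n) * b n ^ 2 := by
    intro n
    rw [mul_pow, ← ENNReal.ofReal_pow (by positivity), ← pow_mul, mul_comm n, pow_mul]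
    norm_num
  simp_rw [e1, e2, e3] at h
  rw [tsum_ofReal_geometric (by norm_num) (by norm_num)] at h
  refine h.trans (mul_le_mul_left ?_ _)
  rw [← ENNReal.ofReal_ofNat]
  exact ENNReal.ofReal_le_ofReal (by norm_num)

theorem add_sq_le_two_mul (a b : ℝ≥0∞) : (a + b) ^ 2 ≤ 2 * a ^ 2 + 2 * b ^ 2 := by
  have h := ENNReal.rpow_add_le_mul_rpow_add_rpow a b (p := 2) (by norm_num)
  norm_num at h
  rwa [mul_add] at h

/-- The points of the dyadic refinements of a grid on `[-T, T]`. -/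
noncomputable def gridPoint (T : ℝ) (N n j : ℕ) : ℝ := -T + 2 * T * j / (N * 2 ^ n)

/-- The index of the grid point to the left of `τ`. -/
noncomputable def gridIndex (T : ℝ) (N n : ℕ) (τ : ℝ) : ℕ := ⌊(τ + T) / (2 * T) * N * 2 ^ n⌋₊

variable {T : ℝ} {N : ℕ}

/-- The half-open interval matters: at τ = T the index would be N 2^n, outside the ranges summed
over below. -/
theorem gridIndex_lt (hT : 0 < T) (hN : 1 ≤ N) (n : ℕ) {τ : ℝ} (hτ : τ ∈ Ico (-T) T) :
    gridIndex T N n τ < N * 2 ^ n := by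
  have hN' : (0 : ℝ) < N := by exact_mod_cast hN
  have h0 : 0 ≤ (τ + T) / (2 * T) := div_nonneg (by linarith [hτ.1]) (by linarith)
  rw [gridIndex, Nat.floor_lt (by positivity)]
  push_cast
  have h1 : (τ + T) / (2 * T) < 1 := by
    rw [div_lt_one (by linarith)]
    linarith [hτ.2]
  have h2 : (0 : ℝ) < N * 2 ^ n := by positivity
  calc (τ + T) / (2 * T) * N * 2 ^ n = (τ + T) / (2 * T) * (N * 2 ^ n) := by ring
    _ < 1 * (N * 2 ^ n) := by gcongr
    _ = _ := one_mul _

theorem gridIndex_succ_div_two (T : ℝ) (N n : ℕ) (τ : ℝ) :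
    gridIndex T N (n + 1) τ / 2 = gridIndex T N n τ := by
  rw [gridIndex, gridIndex, ← Nat.floor_div_ofNat]
  congr 1
  rw [pow_succ]
  ring

theorem gridPoint_mem (hT : 0 < T) (hN : 1 ≤ N) {n j : ℕ} (hj : j ≤ N * 2 ^ n) :
    gridPoint T N n j ∈ Icc (-T) T := by
  have hN' : (0 : ℝ) < N := by exact_mod_cast hN
  have hj' : (j : ℝ) ≤ N * 2 ^ n := by exact_mod_cast hj
  have h1 : 2 * T * j / (N * 2 ^ n) ≤ 2 * T := by
    rw [div_le_iff₀ (by positivity)]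
    gcongr
  have h2 : 0 ≤ 2 * T * j / (N * 2 ^ n) := by positivity
  constructor <;> rw [gridPoint] <;> linarith

theorem abs_sub_gridPoint_le (hT : 0 < T) (hN : 1 ≤ N) (n : ℕ) {τ : ℝ} (hτ : τ ∈ Ico (-T) T) :
    |τ - gridPoint T N n (gridIndex T N n τ)| ≤ 2 * T / N * (1 / 2) ^ n := by
  have hN' : (0 : ℝ) < N := by exact_mod_cast hN
  have h0 : 0 ≤ (τ + T) / (2 * T) := div_nonneg (by linarith [hτ.1]) (by linarith)
  have h1 := Nat.floor_le (a := (τ + T) / (2 * T) * N * 2 ^ n) (by positivity)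
  have h2 := Nat.lt_floor_add_one ((τ + T) / (2 * T) * N * 2 ^ n)
  set x := (τ + T) / (2 * T) * N * 2 ^ n with hx
  have h3 : τ - gridPoint T N n (gridIndex T N n τ) =
      (x - (⌊x⌋₊ : ℝ)) * (2 * T / N * (1 / 2) ^ n) := by
    rw [gridPoint, gridIndex, ← hx, sub_mul]
    have : x * (2 * T / N * (1 / 2) ^ n) = τ + T := by
      rw [hx, one_div, inv_pow]
      field_simp
    rw [this, one_div, inv_pow]
    field_simp
    ring
  rw [h3, abs_mul, abs_of_nonneg (show 0 ≤ 2 * T / N * (1 / 2) ^ n by positivity),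
    abs_of_nonneg (by linarith)]
  refine mul_le_of_le_one_left (by positivity) (by linarith)

/-- A point of the finer grid coincides with its parent when j is even and lies one fine step to its
right when j is odd. -/
theorem abs_gridPoint_succ_sub_le (hT : 0 < T) (hN : 1 ≤ N) (n j : ℕ) :
    |gridPoint T N (n + 1) j - gridPoint T N n (j / 2)| ≤ T / N * (1 / 2) ^ n := by
  have hN' : (0 : ℝ) < N := by exact_mod_cast hN
  have h1 : (j : ℝ) = 2 * ((j / 2 : ℕ) : ℝ) + ((j % 2 : ℕ) : ℝ) := by
    exact_mod_cast (Nat.div_add_mod j 2).symm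
  have h2 : ((j % 2 : ℕ) : ℝ) ≤ 1 := by exact_mod_cast Nat.le_of_lt_succ (Nat.mod_lt j two_pos)
  have h3 : gridPoint T N (n + 1) j - gridPoint T N n (j / 2) =
      ((j % 2 : ℕ) : ℝ) * (T / N * (1 / 2) ^ n) := by
    rw [gridPoint, gridPoint, h1, one_div, inv_pow, pow_succ]
    field_simp
    ring
  rw [h3, abs_of_nonneg (by positivity)]
  exact mul_le_of_le_one_left (by positivity) h2

variable {H E : Type*} [NormedAddCommGroup H] [NormedSpace ℂ H] [NormedAddCommGroup E]
  [NormedSpace ℂ E]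

/-- The difference of `F` between two successive dyadic approximations. -/
noncomputable def gridDiff {H : Type*} [NormedAddCommGroup H] (T : ℝ) (N : ℕ) (F : ℝ → H) (n j : ℕ) : H :=
  F (gridPoint T N (n + 1) j) - F (gridPoint T N n (j / 2))

theorem norm_gridDiff_le {H : Type*} [NormedAddCommGroup H] (hT : 0 < T) (hN : 1 ≤ N) {F : ℝ → H} {G : ℝ} (hG0 : 0 ≤ G)
    (hG : ∀ s ∈ Icc (-T) T, ∀ t ∈ Icc (-T) T, ‖F t - F s‖ ≤ G * |t - s|) {n j : ℕ}
    (hj : j < N * 2 ^ (n + 1)) : ‖gridDiff T N F n j‖ ≤ G * (T / N * (1 / 2) ^ n) := by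
  have h2 : j / 2 ≤ N * 2 ^ n := by
    have : N * 2 ^ (n + 1) = 2 * (N * 2 ^ n) := by ring
    omega
  exact (hG _ (gridPoint_mem hT hN h2) _ (gridPoint_mem hT hN hj.le)).trans
    (mul_le_mul_of_nonneg_left (abs_gridPoint_succ_sub_le hT hN n j) hG0)

/-- F(τ) telescopes along the grid points to the left of τ. The one index selected by τ at each
level is then dominated by the sum over all indices of that level, so the right side involves only
vectors that do not depend on τ. -/
theorem enorm_apply_sq_le_dyadic (hT : 0 < T) (hN : 1 ≤ N) {F : ℝ → H} {G : ℝ}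
    (hG : ∀ s ∈ Icc (-T) T, ∀ t ∈ Icc (-T) T, ‖F t - F s‖ ≤ G * |t - s|) (L : H →L[ℂ] E) {τ : ℝ}
    (hτ : τ ∈ Ico (-T) T) :
    ‖L (F τ)‖ₑ ^ 2 ≤ 2 * ∑ j ∈ Finset.range N, ‖L (F (gridPoint T N 0 j))‖ₑ ^ 2 +
      6 * ∑' n : ℕ, ENNReal.ofReal ((25 / 16) ^ n) *
        ∑ j ∈ Finset.range (N * 2 ^ (n + 1)), ‖L (gridDiff T N F n j)‖ₑ ^ 2 := by
  set J : ℕ → ℕ := fun n => gridIndex T N n τ with hJ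
  set f : ℕ → H := fun n => F (gridPoint T N n (J n)) with hf
  have hfd : ∀ n, f (n + 1) = f n + gridDiff T N F n (J (n + 1)) := fun n => by
    rw [gridDiff, hJ]
    simp only [gridIndex_succ_div_two]
    rw [hf]
    simp only
    abel
  have hpart : ∀ n, ‖L (f n)‖ₑ ≤ ‖L (f 0)‖ₑ + ∑' n, ‖L (gridDiff T N F n (J (n + 1)))‖ₑ := by
    have h : ∀ n, ‖L (f n)‖ₑ ≤
        ‖L (f 0)‖ₑ + ∑ k ∈ Finset.range n, ‖L (gridDiff T N F k (J (k + 1)))‖ₑ := by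
      intro n
      induction n with
      | zero => simp
      | succ n ih =>
        rw [hfd, map_add, Finset.sum_range_succ, ← add_assoc]
        exact (enorm_add_le _ _).trans (by gcongr)
    exact fun n => (h n).trans (by gcongr; exact ENNReal.sum_le_tsum _)
  have hlim : Tendsto f atTop (𝓝 (F τ)) := by
    rw [tendsto_iff_norm_sub_tendsto_zero]
    refine squeeze_zero (g := fun n => |G| * (2 * T / N * (1 / 2) ^ n)) (fun n => norm_nonneg _)
      (fun n => ?_) ?_
    · rw [norm_sub_rev]
      refine (hG _ (gridPoint_mem hT hN (gridIndex_lt hT hN n hτ).le) _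
        ⟨hτ.1, hτ.2.le⟩).trans ?_
      refine mul_le_mul (le_abs_self G) (abs_sub_gridPoint_le hT hN n hτ) (abs_nonneg _)
        (abs_nonneg _)
    · have h := (tendsto_pow_atTop_nhds_zero_of_lt_one (r := (1 / 2 : ℝ)) (by norm_num)
        (by norm_num)).const_mul (2 * T / N) |>.const_mul |G|
      simpa using h
  have hle : ‖L (F τ)‖ₑ ≤ ‖L (f 0)‖ₑ + ∑' n, ‖L (gridDiff T N F n (J (n + 1)))‖ₑ :=
    le_of_tendsto' (((L.continuous.tendsto _).comp hlim).enorm) hpart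
  have h0 : ‖L (f 0)‖ₑ ^ 2 ≤ ∑ j ∈ Finset.range N, ‖L (F (gridPoint T N 0 j))‖ₑ ^ 2 :=
    Finset.single_le_sum (f := fun j => ‖L (F (gridPoint T N 0 j))‖ₑ ^ 2)
      (fun _ _ => bot_le) (Finset.mem_range.2 (by simpa using gridIndex_lt hT hN 0 hτ))
  have hn : ∀ n, ‖L (gridDiff T N F n (J (n + 1)))‖ₑ ^ 2 ≤
      ∑ j ∈ Finset.range (N * 2 ^ (n + 1)), ‖L (gridDiff T N F n j)‖ₑ ^ 2 := fun n =>
    Finset.single_le_sum (f := fun j => ‖L (gridDiff T N F n j)‖ₑ ^ 2)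
      (fun _ _ => bot_le) (Finset.mem_range.2 (gridIndex_lt hT hN (n + 1) hτ))
  calc ‖L (F τ)‖ₑ ^ 2
      ≤ (‖L (f 0)‖ₑ + ∑' n, ‖L (gridDiff T N F n (J (n + 1)))‖ₑ) ^ 2 := pow_le_pow_left' hle 2
    _ ≤ 2 * ‖L (f 0)‖ₑ ^ 2 + 2 * (∑' n, ‖L (gridDiff T N F n (J (n + 1)))‖ₑ) ^ 2 :=
        add_sq_le_two_mul _ _
    _ ≤ 2 * ‖L (f 0)‖ₑ ^ 2 + 2 * (3 * ∑' n, ENNReal.ofReal ((25 / 16) ^ n) *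
        ‖L (gridDiff T N F n (J (n + 1)))‖ₑ ^ 2) := by
        gcongr
        exact tsum_sq_le_weighted _
    _ ≤ _ := by
        rw [← mul_assoc, show (2 : ℝ≥0∞) * 3 = 6 by norm_num]
        gcongr with n
        exact hn n

/-- A bound for frozen arguments extends to slowly varying arguments. -/
theorem lintegral_varying_le {Ω : Type*} [MeasurableSpace Ω] {μ : Measure Ω} {S : Ω → H →L[ℂ] E}
    {ρ : Ω → ℝ≥0∞} {τ : Ω → ℝ} {c : ℝ≥0∞}
    (hm : ∀ f, AEMeasurable (fun z => ρ z * ‖S z f‖ₑ ^ 2) μ)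
    (hS : ∀ f, ∫⁻ z, ρ z * ‖S z f‖ₑ ^ 2 ∂μ ≤ c * ‖f‖ₑ ^ 2) (hT : 0 < T) (hN : 1 ≤ N) {F : ℝ → H}
    {M G : ℝ} (hM : ∀ t ∈ Icc (-T) T, ‖F t‖ ≤ M) (hG0 : 0 ≤ G)
    (hG : ∀ s ∈ Icc (-T) T, ∀ t ∈ Icc (-T) T, ‖F t - F s‖ ≤ G * |t - s|)
    (hτ : ∀ᵐ z ∂μ, τ z ∈ Ico (-T) T) :
    ∫⁻ z, ρ z * ‖S z (F (τ z))‖ₑ ^ 2 ∂μ ≤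
      c * ENNReal.ofReal (2 * N * M ^ 2 + 60 * (G * T) ^ 2 / N) := by
  have hN' : (0 : ℝ) < N := by exact_mod_cast hN
  have hbd : ∀ f : H, ∀ B : ℝ, ‖f‖ ≤ B →
      ∫⁻ z, ρ z * ‖S z f‖ₑ ^ 2 ∂μ ≤ c * ENNReal.ofReal (B ^ 2) := fun f B hB => by
    refine (hS f).trans (mul_le_mul_right ?_ _)
    rw [← ofReal_norm, ← ENNReal.ofReal_pow (norm_nonneg _)]
    exact ENNReal.ofReal_le_ofReal (pow_le_pow_left₀ (norm_nonneg _) hB 2)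
  have hm1 : AEMeasurable (fun z => ∑ j ∈ Finset.range N,
      ρ z * ‖S z (F (gridPoint T N 0 j))‖ₑ ^ 2) μ := Finset.aemeasurable_fun_sum _ fun j _ => hm _
  have hm2 : ∀ n, AEMeasurable (fun z => ∑ j ∈ Finset.range (N * 2 ^ (n + 1)),
      ρ z * ‖S z (gridDiff T N F n j)‖ₑ ^ 2) μ := fun n =>
    Finset.aemeasurable_fun_sum _ fun j _ => hm _
  have hI1 : ∫⁻ z, ∑ j ∈ Finset.range N, ρ z * ‖S z (F (gridPoint T N 0 j))‖ₑ ^ 2 ∂μ ≤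
      c * ENNReal.ofReal (N * M ^ 2) := by
    rw [lintegral_finsetSum' _ fun j _ => hm _]
    refine (Finset.sum_le_sum fun j hj => hbd _ M (hM _ (gridPoint_mem hT hN
      (by simpa using (Finset.mem_range.1 hj).le)))).trans (le_of_eq ?_)
    rw [Finset.sum_const, Finset.card_range, nsmul_eq_mul, ENNReal.ofReal_mul (by positivity),
      ENNReal.ofReal_natCast]
    ring
  -- There are N 2^(n+1) differences, each of norm at most GT/(N 2^n); their squares add up to
  -- 2(GT)²/N times 2^(-n).
  have hI2 : ∀ n, ∫⁻ z, ∑ j ∈ Finset.range (N * 2 ^ (n + 1)),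
      ρ z * ‖S z (gridDiff T N F n j)‖ₑ ^ 2 ∂μ ≤
        c * ENNReal.ofReal (2 * (G * T) ^ 2 / N * (1 / 2) ^ n) := fun n => by
    rw [lintegral_finsetSum' _ fun j _ => hm _]
    refine (Finset.sum_le_sum fun j hj => hbd _ _ (norm_gridDiff_le hT hN hG0 hG
      (Finset.mem_range.1 hj))).trans (le_of_eq ?_)
    rw [Finset.sum_const, Finset.card_range, nsmul_eq_mul, ← ENNReal.ofReal_natCast, mul_left_comm,
      ← ENNReal.ofReal_mul (by positivity)]
    congr 2
    push_cast
    rw [one_div, inv_pow, pow_succ]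
    field_simp
  calc ∫⁻ z, ρ z * ‖S z (F (τ z))‖ₑ ^ 2 ∂μ
      ≤ ∫⁻ z, (2 * (∑ j ∈ Finset.range N, ρ z * ‖S z (F (gridPoint T N 0 j))‖ₑ ^ 2) +
          6 * ∑' n : ℕ, ENNReal.ofReal ((25 / 16) ^ n) * ∑ j ∈ Finset.range (N * 2 ^ (n + 1)),
            ρ z * ‖S z (gridDiff T N F n j)‖ₑ ^ 2) ∂μ := by
        refine lintegral_mono_ae ?_
        filter_upwards [hτ] with z hz
        refine (mul_le_mul_right (enorm_apply_sq_le_dyadic hT hN hG (S z) hz) _).trans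
          (le_of_eq ?_)
        simp_rw [← Finset.mul_sum]
        rw [mul_add, mul_left_comm, mul_left_comm _ (6 : ℝ≥0∞), ← ENNReal.tsum_mul_left]
        simp_rw [mul_left_comm (ρ z)]
    _ = 2 * (∫⁻ z, ∑ j ∈ Finset.range N, ρ z * ‖S z (F (gridPoint T N 0 j))‖ₑ ^ 2 ∂μ) +
        6 * ∑' n : ℕ, ENNReal.ofReal ((25 / 16) ^ n) *
          ∫⁻ z, ∑ j ∈ Finset.range (N * 2 ^ (n + 1)),
            ρ z * ‖S z (gridDiff T N F n j)‖ₑ ^ 2 ∂μ := by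
        rw [lintegral_add_left' (hm1.const_mul 2), lintegral_const_mul'' _ hm1,
          lintegral_const_mul' _ _ (by norm_num), lintegral_tsum fun n => (hm2 n).const_mul _]
        congr 3
        funext n
        rw [lintegral_const_mul'' _ (hm2 n)]
    _ ≤ 2 * (c * ENNReal.ofReal (N * M ^ 2)) + 6 * ∑' n : ℕ, ENNReal.ofReal ((25 / 16) ^ n) *
        (c * ENNReal.ofReal (2 * (G * T) ^ 2 / N * (1 / 2) ^ n)) := by
        gcongr with n
        exact hI2 n
    -- Weights 25/16 against decay 1/2 leave the ratio 25/32, with sum 32/7; the resulting 6 · 2 ·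
    -- 32/7 is below 60.
    _ = 2 * (c * ENNReal.ofReal (N * M ^ 2)) + 6 * (c * ENNReal.ofReal (2 * (G * T) ^ 2 / N *
        (32 / 7))) := by
        have e : ∀ n : ℕ, ENNReal.ofReal ((25 / 16) ^ n) *
            (c * ENNReal.ofReal (2 * (G * T) ^ 2 / N * (1 / 2) ^ n)) =
            (c * ENNReal.ofReal (2 * (G * T) ^ 2 / N)) * ENNReal.ofReal ((25 / 32) ^ n) := by
          intro n
          rw [mul_left_comm, ← ENNReal.ofReal_mul (by positivity), mul_assoc,
            ← ENNReal.ofReal_mul (by positivity)]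
          congr 2
          rw [mul_left_comm, ← mul_pow]
          norm_num
        simp_rw [e]
        rw [ENNReal.tsum_mul_left, tsum_ofReal_geometric (by norm_num) (by norm_num), mul_assoc,
          ← ENNReal.ofReal_mul (by positivity)]
        norm_num
    _ = c * ENNReal.ofReal (2 * (N * M ^ 2) + 6 * (2 * (G * T) ^ 2 / N * (32 / 7))) := by
        rw [ENNReal.ofReal_add (by positivity) (by positivity), ENNReal.ofReal_mul (p := 2) (by norm_num),
          ENNReal.ofReal_mul (p := 6) (by norm_num), ENNReal.ofReal_ofNat, ENNReal.ofReal_ofNat]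
        ring
    _ ≤ _ := by
        refine mul_le_mul_right (ENNReal.ofReal_le_ofReal ?_) _
        have : 0 ≤ (G * T) ^ 2 / N := by positivity
        have e : 60 * (G * T) ^ 2 / N = 60 * ((G * T) ^ 2 / N) := by ring
        have e' : 2 * (G * T) ^ 2 / N = 2 * ((G * T) ^ 2 / N) := by ring
        rw [e, e']
        linarith

end Dyadic

/-! ### Homogeneous singular integrals -/

section SingularIntegrals
variable {E : Type*} [NormedAddCommGroup E] [NormedSpace ℝ E] [FiniteDimensional ℝ E]
  [MeasurableSpace E] [BorelSpace E] (μ : Measure E) [μ.IsAddHaarMeasure]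

theorem lintegral_comp_smul_pos (f : E → ℝ≥0∞) {c : ℝ} (hc : 0 < c) :
    ∫⁻ y, f (c • y) ∂μ = ENNReal.ofReal (c ^ Module.finrank ℝ E)⁻¹ * ∫⁻ y, f y ∂μ := by
  have h2 : ∫⁻ y, f (c • y) ∂μ = ∫⁻ y, f y ∂(Measure.map (fun y : E => c • y) μ) :=
    ((Homeomorph.smulOfNeZero c hc.ne').measurableEmbedding.lintegral_map f).symm
  rw [h2, Measure.map_addHaar_smul μ hc.ne', lintegral_smul_measure, smul_eq_mul,
    abs_of_pos (by positivity)]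

/-- In polar coordinates the integrand is min(1, y)²/y², dominated by 2/(1 + y²): the minimum tames
the origin and the extra power tames infinity. -/
theorem lintegral_singular_lt_top [Nontrivial E] :
    ∫⁻ h, (‖h‖ₑ ^ (Module.finrank ℝ E + 1))⁻¹ * min 1 ‖h‖ₑ ^ 2 ∂μ < ⊤ := by
  set n := Module.finrank ℝ E with hn
  have hn1 : 1 ≤ n := Module.finrank_pos
  set f : ℝ → ℝ := fun y => (y ^ (n + 1))⁻¹ * min 1 y ^ 2 with hf
  have h1 : Integrable (fun x : E => f ‖x‖) μ := by
    rw [integrable_fun_norm_addHaar]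
    have hi : IntegrableOn (fun s : ℝ => 2 * (1 + s ^ 2)⁻¹) (Ioi 0) :=
      (integrable_inv_one_add_sq.const_mul 2).integrableOn
    have hfm : Measurable fun y : ℝ => y ^ (n - 1) • f y := by
      rw [hf]
      fun_prop
    refine Integrable.mono hi hfm.aestronglyMeasurable ?_
    refine (ae_restrict_mem measurableSet_Ioi).mono fun y (hy : 0 < y) => ?_
    have e : y ^ (n - 1) • f y = (y ^ 2)⁻¹ * min 1 y ^ 2 := by
      have : y ^ (n + 1) = y ^ (n - 1) * y ^ 2 := by rw [← pow_add]; congr 1; omega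
      rw [hf, smul_eq_mul]
      simp only
      rw [this]
      field_simp
    rw [← hn, e, Real.norm_of_nonneg (by positivity), Real.norm_of_nonneg (by positivity)]
    rcases le_total 1 y with h | h
    · rw [min_eq_left h, one_pow, mul_one, ← div_eq_mul_inv, inv_eq_one_div,
        div_le_div_iff₀ (by positivity) (by positivity)]
      nlinarith
    · rw [min_eq_right h, inv_mul_cancel₀ (by positivity), ← div_eq_mul_inv,
        le_div_iff₀ (by positivity)]
      nlinarith
  refine lt_of_le_of_lt (lintegral_mono_ae ?_) h1.lintegral_lt_top
  have h0 : ∀ᵐ x ∂μ, x ≠ 0 := Measure.ae_ne μ 0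
  filter_upwards [h0] with x hx
  have hx' : 0 < ‖x‖ := norm_pos_iff.2 hx
  rw [hf]
  simp only
  rw [ENNReal.ofReal_mul (by positivity), ENNReal.ofReal_inv_of_pos (by positivity),
    ENNReal.ofReal_pow (by positivity), ENNReal.ofReal_pow (by positivity), ofReal_norm]
  gcongr
  rw [ENNReal.ofReal_min, ENNReal.ofReal_one, ofReal_norm]

/-- The weight has degree -(n + 1) and the measure degree n, so dilation by c produces exactly one
power of c. That power of |ξ| will cancel the 1/|ξ| of the dispersion bound. -/
theorem lintegral_singular_scale {c : ℝ} (hc : 0 < c) :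
    ∫⁻ h, (‖h‖ₑ ^ (Module.finrank ℝ E + 1))⁻¹ * min 1 (‖h‖ₑ * ENNReal.ofReal c) ^ 2 ∂μ =
      ENNReal.ofReal c * ∫⁻ h, (‖h‖ₑ ^ (Module.finrank ℝ E + 1))⁻¹ * min 1 ‖h‖ₑ ^ 2 ∂μ := by
  set n := Module.finrank ℝ E with hn
  have h1 := lintegral_comp_smul_pos μ
    (fun h => (‖h‖ₑ ^ (n + 1))⁻¹ * min 1 ‖h‖ₑ ^ 2) hc
  have hc0 : ENNReal.ofReal c ≠ 0 := by simpa using hc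
  have hct : ENNReal.ofReal c ≠ ⊤ := ENNReal.ofReal_ne_top
  have e : ∀ h : E, (‖h‖ₑ ^ (n + 1))⁻¹ * min 1 (‖h‖ₑ * ENNReal.ofReal c) ^ 2 =
      ENNReal.ofReal c ^ (n + 1) * ((‖c • h‖ₑ ^ (n + 1))⁻¹ * min 1 ‖c • h‖ₑ ^ 2) := by
    intro h
    rw [enorm_smul, Real.enorm_of_nonneg hc.le, mul_pow, ENNReal.mul_inv
      (Or.inl (pow_ne_zero _ hc0)) (Or.inl (ENNReal.pow_ne_top hct)), ← mul_assoc, ← mul_assoc,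
      ENNReal.mul_inv_cancel (pow_ne_zero _ hc0) (ENNReal.pow_ne_top hct), one_mul, mul_comm ‖h‖ₑ]
  simp_rw [e]
  rw [lintegral_const_mul' _ _ (ENNReal.pow_ne_top hct), h1, ← mul_assoc]
  congr 1
  rw [← hn, ENNReal.ofReal_inv_of_pos (by positivity), ENNReal.ofReal_pow hc.le, pow_succ', mul_assoc,
    ENNReal.mul_inv_cancel (pow_ne_zero _ hc0) (ENNReal.pow_ne_top hct), mul_one]

theorem lintegral_bracket_lt_top {p : ℝ} (hp : Module.finrank ℝ E < 2 * p) :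
    ∫⁻ h, (ENNReal.ofReal ((1 + ‖h‖ ^ 2) ^ p))⁻¹ ∂μ < ⊤ := by
  have h1 : Integrable (fun x : E => ((1 : ℝ) + ‖x‖ ^ 2) ^ (-(2 * p) / 2)) μ :=
    integrable_rpow_neg_one_add_norm_sq hp
  refine lt_of_le_of_lt (lintegral_mono fun x => ?_) h1.lintegral_lt_top
  rw [← ENNReal.ofReal_inv_of_pos (by positivity), ← Real.rpow_neg (by positivity)]
  refine ENNReal.ofReal_le_ofReal (le_of_eq ?_)
  congr 1
  ring

theorem lintegral_bracket_scale (p : ℝ) {c : ℝ} (hc : 0 < c) :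
    ∫⁻ h, (ENNReal.ofReal ((c ^ 2 + ‖h‖ ^ 2) ^ p))⁻¹ ∂μ =
      ENNReal.ofReal (c ^ ((Module.finrank ℝ E : ℝ) - 2 * p)) *
        ∫⁻ h, (ENNReal.ofReal ((1 + ‖h‖ ^ 2) ^ p))⁻¹ ∂μ := by
  generalize hn : Module.finrank ℝ E = n
  have h1 := lintegral_comp_smul_pos μ
    (fun h => (ENNReal.ofReal ((c ^ 2 + ‖h‖ ^ 2) ^ p))⁻¹) hc
  have e : ∀ h : E, (ENNReal.ofReal ((c ^ 2 + ‖c • h‖ ^ 2) ^ p))⁻¹ =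
      ENNReal.ofReal (c ^ (-(2 * p))) * (ENNReal.ofReal ((1 + ‖h‖ ^ 2) ^ p))⁻¹ := by
    intro h
    rw [norm_smul, Real.norm_of_nonneg hc.le, mul_pow, ← mul_one_add, Real.mul_rpow (by positivity)
      (by positivity), ENNReal.ofReal_mul (by positivity), ENNReal.mul_inv
      (Or.inr ENNReal.ofReal_ne_top) (Or.inl ENNReal.ofReal_ne_top),
      ← ENNReal.ofReal_inv_of_pos (by positivity), Real.rpow_neg hc.le, Real.rpow_mul hc.le]
    norm_num
  simp_rw [e, hn] at h1
  rw [lintegral_const_mul' _ _ ENNReal.ofReal_ne_top] at h1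
  have h2 : ENNReal.ofReal (c ^ (n : ℝ)) * ENNReal.ofReal (c ^ n)⁻¹ = 1 := by
    rw [← ENNReal.ofReal_mul (by positivity), Real.rpow_natCast,
      mul_inv_cancel₀ (by positivity), ENNReal.ofReal_one]
  rw [← one_mul (∫⁻ h, (ENNReal.ofReal ((c ^ 2 + ‖h‖ ^ 2) ^ p))⁻¹ ∂μ), ← h2, mul_assoc]
  rw [← h1, ← mul_assoc, ← ENNReal.ofReal_mul (by positivity), ← Real.rpow_add hc, ← sub_eq_add_neg]

end SingularIntegrals

/-! ### Space and time regularity for frozen kernels -/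

section FrozenBounds
variable {d : ℕ}

/-- The Fourier transform of the velocity average of the free evolution of the kernel `f`. -/
noncomputable def freeAverage (m ħ : ℝ) (χ : 𝓢(Space d, ℂ)) (f : KernelSpace d)
    (z : ℝ × Space d) : ℂ :=
  ∫ p, f (p, p - z.2) * momentumWeight ħ χ (freeRate m ħ * z.1) (z.2, p)

theorem stronglyMeasurable_freeAverage (m ħ : ℝ) (χ : 𝓢(Space d, ℂ)) (f : KernelSpace d) :
    StronglyMeasurable (freeAverage m ħ χ f) := by
  have h1 : StronglyMeasurable fun q : (ℝ × Space d) × Space d => f (q.2, q.2 - q.1.2) :=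
    (Lp.stronglyMeasurable f).comp_measurable (by fun_prop)
  have h0 : Continuous fun q : (ℝ × Space d) × Space d =>
      (freeRate m ħ * q.1.1, (q.1.2, q.2)) := by fun_prop
  have h2 := (continuous_momentumWeight ħ χ).comp h0
  simp only [Function.comp_def] at h2
  have h3 : StronglyMeasurable fun q : (ℝ × Space d) × Space d => f (q.2, q.2 - q.1.2) *
      momentumWeight ħ χ (freeRate m ħ * q.1.1) (q.1.2, q.2) := h1.mul h2.stronglyMeasurable
  exact h3.integral_prod_right' (ν := (volume : Measure (Space d)))

theorem coeFn_momentumAverage {ħ : ℝ} (hħ : 0 < ħ) (m : ℝ) (χ : 𝓢(Space d, ℂ))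
    (f : KernelSpace d) (t : ℝ) :
    momentumAverage hħ χ (freeRate m ħ * t) f =ᵐ[volume] fun ξ => freeAverage m ħ χ f (t, ξ) :=
  coeFn_averageCLM _ _ f

theorem ae_memLp_momentumSlice (f : KernelSpace d) :
    ∀ᵐ ξ : Space d, MemLp (fun p => f (p, p - ξ)) 2 volume :=
  ae_memLp_slice (scalesVolume_sub.memLp_comp (Lp.memLp f))

/-- The map (ξ, p) ↦ (p, p - ξ) preserves volume, so the slicewise dispersion bounds add up to the
full Hilbert–Schmidt norm. -/
theorem lintegral_momentumSlice (f : KernelSpace d) :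
    ∫⁻ ξ : Space d, ∫⁻ p, ‖f (p, p - ξ)‖ₑ ^ 2 = ‖f‖ₑ ^ 2 := by
  have hm : AEMeasurable (fun z : Space d × Space d => ‖f (z.2, z.2 - z.1)‖ₑ ^ 2)
      ((volume : Measure (Space d)).prod (volume : Measure (Space d))) :=
    (scalesVolume_sub.memLp_comp (Lp.memLp f)).1.enorm.pow_const 2
  rw [← lintegral_enorm_sq_eq, ← one_mul (∫⁻ x, ‖f x‖ₑ ^ 2),
    ← scalesVolume_sub.lintegral_comp (f := fun z => ‖f z‖ₑ ^ 2)
      ((Lp.memLp f).1.enorm.pow_const 2)]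
  exact (lintegral_prod _ hm).symm

theorem norm_fourierChar_sub_one_le_two (h ξ : Space d) : ‖(𝐞 ⟪h, ξ⟫_ℝ : ℂ) - 1‖ ≤ 2 := by
  refine (norm_sub_le _ _).trans ?_
  rw [Circle.norm_coe, norm_one]
  norm_num

theorem enorm_fourierChar_sub_one_le (h ξ : Space d) :
    ‖(𝐞 ⟪h, ξ⟫_ℝ : ℂ) - 1‖ₑ ≤ 7 * min 1 (‖h‖ₑ * ‖ξ‖ₑ) := by
  have h2 : ‖(𝐞 ⟪h, ξ⟫_ℝ : ℂ) - 1‖ₑ ≤ 2 := by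
    rw [← ofReal_norm]
    exact (ENNReal.ofReal_le_ofReal (norm_fourierChar_sub_one_le_two h ξ)).trans (by simp)
  have h3 : ‖(𝐞 ⟪h, ξ⟫_ℝ : ℂ) - 1‖ₑ ≤ 7 * (‖h‖ₑ * ‖ξ‖ₑ) := by
    have h4 : ‖(𝐞 ⟪h, ξ⟫_ℝ : ℂ) - 1‖ ≤ 7 * (‖h‖ * ‖ξ‖) := by
      have h5 := Real.norm_exp_I_mul_ofReal_sub_one_le (x := 2 * Real.pi * ⟪h, ξ⟫_ℝ)
      rw [Real.fourierChar_apply, mul_comm _ Complex.I]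
      refine h5.trans ?_
      rw [norm_mul, Real.norm_of_nonneg (by positivity)]
      -- The constant 7 is any convenient bound above 2π.
      exact mul_le_mul (by linarith [Real.pi_lt_d2]) (norm_inner_le_norm _ _) (norm_nonneg _)
        (by norm_num)
    have h6 := ENNReal.ofReal_le_ofReal h4
    rw [ENNReal.ofReal_mul (by norm_num), ENNReal.ofReal_mul (norm_nonneg _)] at h6
    simpa only [ofReal_norm, ENNReal.ofReal_ofNat] using h6
  rcases le_total 1 (‖h‖ₑ * ‖ξ‖ₑ) with h | h
  · rw [min_eq_left h, mul_one]
    exact h2.trans (by norm_num)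
  · rwa [min_eq_right h]

theorem continuous_fourierChar_sub_one :
    Continuous fun q : Space d × Space d => (𝐞 ⟪q.1, q.2⟫_ℝ : ℂ) - 1 :=
  (continuous_fourierChar_coe.comp (by fun_prop)).sub continuous_const

/-- The space difference operator `f ↦ f(· + h) - f` in the momentum representation. -/
noncomputable def shiftMul (h : Space d) : L2 d →L[ℂ] L2 d :=
  mulCLM (fun ξ => (𝐞 ⟪h, ξ⟫_ℝ : ℂ) - 1)
    (continuous_fourierChar_sub_one.comp (Continuous.prodMk_right h)).aestronglyMeasurable 2
    (norm_fourierChar_sub_one_le_two h)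

theorem coeFn_shiftMul (h : Space d) (f : L2 d) :
    shiftMul h f =ᵐ[volume] fun ξ => ((𝐞 ⟪h, ξ⟫_ℝ : ℂ) - 1) * f ξ := coeFn_mulCLM _ _ f

theorem exists_singular_bound (hd : 1 ≤ d) : ∃ B : ℝ≥0∞, B ≠ ⊤ ∧ ∀ ξ : Space d, ξ ≠ 0 →
    ∫⁻ h : Space d, (‖h‖ₑ ^ (d + 1))⁻¹ * min 1 (‖h‖ₑ * ‖ξ‖ₑ) ^ 2 ≤ B * ‖ξ‖ₑ := by
  have : Nonempty (Fin d) := ⟨⟨0, hd⟩⟩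
  have h1 := lintegral_singular_lt_top (volume : Measure (Space d))
  refine ⟨_, h1.ne, fun ξ hξ => ?_⟩
  have h2 := lintegral_singular_scale (volume : Measure (Space d)) (norm_pos_iff.2 hξ)
  rw [finrank_euclideanSpace, Fintype.card_fin, ofReal_norm] at h2
  rw [h2, finrank_euclideanSpace, Fintype.card_fin, mul_comm]

theorem exists_singular_bound_real : ∃ B : ℝ≥0∞, B ≠ ⊤ ∧ ∀ ξ : Space d, ξ ≠ 0 →
    ∫⁻ r : ℝ, (‖r‖ₑ ^ 2)⁻¹ * min 1 (‖r‖ₑ * ‖ξ‖ₑ) ^ 2 ≤ B * ‖ξ‖ₑ := by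
  have h1 := lintegral_singular_lt_top (volume : Measure ℝ)
  refine ⟨_, h1.ne, fun ξ hξ => ?_⟩
  have h2 := lintegral_singular_scale (volume : Measure ℝ) (norm_pos_iff.2 hξ)
  rw [Module.finrank_self, ofReal_norm] at h2
  rw [Module.finrank_self, mul_comm, ← h2]

theorem ae_ne_zero (hd : 1 ≤ d) : ∀ᵐ ξ : Space d, ξ ≠ 0 := by
  have : Nonempty (Fin d) := ⟨⟨0, hd⟩⟩
  exact Measure.ae_ne volume 0

theorem enorm_shiftMul_sq {ħ : ℝ} (hħ : 0 < ħ) (m : ℝ) (χ : 𝓢(Space d, ℂ)) (f : KernelSpace d)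
    (t : ℝ) (h : Space d) : ‖(shiftMul h ∘L momentumAverage hħ χ (freeRate m ħ * t)) f‖ₑ ^ 2 =
      ∫⁻ ξ, ‖(𝐞 ⟪h, ξ⟫_ℝ : ℂ) - 1‖ₑ ^ 2 * ‖freeAverage m ħ χ f (t, ξ)‖ₑ ^ 2 := by
  rw [← lintegral_enorm_sq_eq]
  refine lintegral_congr_ae ?_
  filter_upwards [coeFn_shiftMul h (momentumAverage hħ χ (freeRate m ħ * t) f),
    coeFn_momentumAverage hħ m χ f t] with ξ h1 h2
  rw [ContinuousLinearMap.comp_apply, h1, h2, enorm_mul, mul_pow]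

theorem measurable_lintegral_mul {a : Space d × Space d → ℝ≥0∞} (ha : Measurable a)
    {u : ℝ × Space d → ℝ≥0∞} (hu : Measurable u) :
    Measurable fun z : ℝ × Space d => ∫⁻ ξ, a (z.2, ξ) * u (z.1, ξ) := by
  have h : Measurable fun q : (ℝ × Space d) × Space d => a (q.1.2, q.2) * u (q.1.1, q.2) := by
    fun_prop
  exact h.lintegral_prod_right'

theorem measurable_shift (m : ℝ) {ħ : ℝ} (hħ : 0 < ħ) (χ : 𝓢(Space d, ℂ)) (f : KernelSpace d) :
    Measurable fun z : ℝ × Space d => (‖z.2‖ₑ ^ (d + 1))⁻¹ *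
      ‖(shiftMul z.2 ∘L momentumAverage hħ χ (freeRate m ħ * z.1)) f‖ₑ ^ 2 := by
  simp_rw [enorm_shiftMul_sq]
  exact (measurable_snd.enorm.pow_const _).inv.mul (measurable_lintegral_mul
    (continuous_fourierChar_sub_one.measurable.enorm.pow_const 2)
    ((stronglyMeasurable_freeAverage m ħ χ f).measurable.enorm.pow_const 2))

/-- Tonelli, so that the t-integral is taken at fixed ξ, where the dispersion estimate lives. -/
theorem lintegral_shift_swap {a : Space d × Space d → ℝ≥0∞} (ha : Measurable a)
    {u : ℝ × Space d → ℝ≥0∞} (hu : Measurable u) {ρ : Space d → ℝ≥0∞} (hρ : Measurable ρ)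
    (I : Set ℝ) : ∫⁻ t in I, ∫⁻ h, ρ h * ∫⁻ ξ, a (h, ξ) * u (t, ξ) =
      ∫⁻ ξ, (∫⁻ t in I, u (t, ξ)) * ∫⁻ h, ρ h * a (h, ξ) := by
  have hK : Measurable fun ξ => ∫⁻ h, ρ h * a (h, ξ) := by
    have h1 : Measurable fun q : Space d × Space d => ρ q.2 * a (q.2, q.1) := by fun_prop
    exact h1.lintegral_prod_right'
  calc ∫⁻ t in I, ∫⁻ h, ρ h * ∫⁻ ξ, a (h, ξ) * u (t, ξ)
      = ∫⁻ t in I, ∫⁻ h, ∫⁻ ξ, ρ h * (a (h, ξ) * u (t, ξ)) := by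
        refine lintegral_congr fun t => lintegral_congr fun h => ?_
        rw [lintegral_const_mul _ (by fun_prop)]
    _ = ∫⁻ t in I, ∫⁻ ξ, ∫⁻ h, ρ h * (a (h, ξ) * u (t, ξ)) :=
        lintegral_congr fun t => lintegral_lintegral_swap (by fun_prop)
    _ = ∫⁻ t in I, ∫⁻ ξ, u (t, ξ) * ∫⁻ h, ρ h * a (h, ξ) := by
        refine lintegral_congr fun t => lintegral_congr fun ξ => ?_
        rw [← lintegral_const_mul _ (by fun_prop)]
        refine lintegral_congr fun h => ?_
        ring
    _ = _ := by
        rw [lintegral_lintegral_swap (by fun_prop)]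
        refine lintegral_congr fun ξ => ?_
        rw [lintegral_mul_const _ (by fun_prop)]

/-- The space regularity of the velocity averages of free evolutions. -/
theorem exists_free_shift_bound (hd : 1 ≤ d) {m : ℝ} (hm : 0 < m) (χ : 𝓢(Space d, ℂ)) :
    ∃ c : ℝ≥0∞, c ≠ ⊤ ∧ ∀ (ħ : ℝ) (hħ : 0 < ħ) (I : Set ℝ), volume I ≠ ⊤ → ∀ f : KernelSpace d,
      ∫⁻ z : ℝ × Space d, (‖z.2‖ₑ ^ (d + 1))⁻¹ *
        ‖(shiftMul z.2 ∘L momentumAverage hħ χ (freeRate m ħ * z.1)) f‖ₑ ^ 2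
          ∂((volume.restrict I).prod volume) ≤
        c * ENNReal.ofReal ((2 * Real.pi * ħ) ^ d)⁻¹ * ‖f‖ₑ ^ 2 := by
  obtain ⟨c, hc, hb⟩ := exists_dispersion_bound hm χ
  obtain ⟨B, hB, hBb⟩ := exists_singular_bound hd
  refine ⟨49 * B * c, by finiteness, fun ħ hħ I hI f => ?_⟩
  rw [lintegral_prod _ (measurable_shift m hħ χ f).aemeasurable]
  simp_rw [enorm_shiftMul_sq]
  have hb' : ∀ ξ : Space d, ξ ≠ 0 →
      ∫⁻ h : Space d, (‖h‖ₑ ^ (d + 1))⁻¹ * ‖(𝐞 ⟪h, ξ⟫_ℝ : ℂ) - 1‖ₑ ^ 2 ≤ 49 * B * ‖ξ‖ₑ := by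
    intro ξ hξ
    calc ∫⁻ h : Space d, (‖h‖ₑ ^ (d + 1))⁻¹ * ‖(𝐞 ⟪h, ξ⟫_ℝ : ℂ) - 1‖ₑ ^ 2
        ≤ ∫⁻ h : Space d, 49 * ((‖h‖ₑ ^ (d + 1))⁻¹ * min 1 (‖h‖ₑ * ‖ξ‖ₑ) ^ 2) := by
          refine lintegral_mono fun h => ?_
          rw [mul_left_comm]
          refine mul_le_mul_right ((pow_le_pow_left' (enorm_fourierChar_sub_one_le h ξ)
            2).trans (le_of_eq ?_)) _
          rw [mul_pow]
          norm_num
      _ ≤ 49 * B * ‖ξ‖ₑ := by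
          rw [lintegral_const_mul' _ _ (by norm_num), mul_assoc]
          exact mul_le_mul_right (hBb ξ hξ) _
  calc ∫⁻ t in I, ∫⁻ h : Space d, (‖h‖ₑ ^ (d + 1))⁻¹ *
        ∫⁻ ξ, ‖(𝐞 ⟪h, ξ⟫_ℝ : ℂ) - 1‖ₑ ^ 2 * ‖freeAverage m ħ χ f (t, ξ)‖ₑ ^ 2
      = ∫⁻ ξ : Space d, (∫⁻ t in I, ‖freeAverage m ħ χ f (t, ξ)‖ₑ ^ 2) *
          ∫⁻ h : Space d, (‖h‖ₑ ^ (d + 1))⁻¹ * ‖(𝐞 ⟪h, ξ⟫_ℝ : ℂ) - 1‖ₑ ^ 2 :=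
        lintegral_shift_swap (continuous_fourierChar_sub_one.measurable.enorm.pow_const 2)
          ((stronglyMeasurable_freeAverage m ħ χ f).measurable.enorm.pow_const 2)
          (ρ := fun h => (‖h‖ₑ ^ (d + 1))⁻¹) (measurable_enorm.pow_const _).inv I
    _ ≤ ∫⁻ ξ : Space d, (∫⁻ p, ‖f (p, p - ξ)‖ₑ ^ 2) *
          (49 * B * c * ENNReal.ofReal ((2 * Real.pi * ħ) ^ d)⁻¹) := by
        refine lintegral_mono_ae ?_
        filter_upwards [ae_ne_zero hd, ae_memLp_momentumSlice f] with ξ hξ hf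
        refine (mul_le_mul' (hb ħ hħ ξ hξ _ hf I hI) (hb' ξ hξ)).trans (le_of_eq ?_)
        -- The half derivative gained by dispersion is exactly what the singular weight in h spends.
        have hξ0 : ‖ξ‖ₑ⁻¹ * ‖ξ‖ₑ = 1 :=
          ENNReal.inv_mul_cancel (enorm_ne_zero.2 hξ) enorm_ne_top
        calc _ = (∫⁻ p, ‖f (p, p - ξ)‖ₑ ^ 2) *
              (49 * B * c * ENNReal.ofReal ((2 * Real.pi * ħ) ^ d)⁻¹) * (‖ξ‖ₑ⁻¹ * ‖ξ‖ₑ) := by ring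
          _ = _ := by rw [hξ0, mul_one]
    _ = _ := by
        rw [lintegral_mul_const' _ _ (by finiteness), lintegral_momentumSlice, mul_comm]

theorem enorm_increment_sq {ħ : ℝ} (hħ : 0 < ħ) (m : ℝ) (χ : 𝓢(Space d, ℂ)) (f : KernelSpace d)
    (t t' : ℝ) : ‖(momentumAverage hħ χ (freeRate m ħ * t') -
      momentumAverage hħ χ (freeRate m ħ * t)) f‖ₑ ^ 2 =
      ∫⁻ ξ, ‖freeAverage m ħ χ f (t', ξ) - freeAverage m ħ χ f (t, ξ)‖ₑ ^ 2 := by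
  rw [← lintegral_enorm_sq_eq, sub_apply]
  refine lintegral_congr_ae ?_
  filter_upwards [coeFn_momentumAverage hħ m χ f t, coeFn_momentumAverage hħ m χ f t',
    Lp.coeFn_sub (momentumAverage hħ χ (freeRate m ħ * t') f)
      (momentumAverage hħ χ (freeRate m ħ * t) f)] with ξ h1 h2 h3
  rw [h3, Pi.sub_apply, h1, h2]

/-- The substitution t' = t + r, with r enlarged to the whole line, and Tonelli isolate the
increment by r at fixed ξ. -/
theorem lintegral_increment_le {v : ℝ × Space d → ℂ} (hv : Measurable v) {ρ : ℝ → ℝ≥0∞}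
    (hρ : Measurable ρ) (I : Set ℝ) :
    ∫⁻ t in I, ∫⁻ t' in I, ρ (t' - t) * ∫⁻ ξ, ‖v (t', ξ) - v (t, ξ)‖ₑ ^ 2 ≤
      ∫⁻ ξ, ∫⁻ r, ρ r * ∫⁻ t in I, ‖v (t + r, ξ) - v (t, ξ)‖ₑ ^ 2 := by
  calc ∫⁻ t in I, ∫⁻ t' in I, ρ (t' - t) * ∫⁻ ξ, ‖v (t', ξ) - v (t, ξ)‖ₑ ^ 2
      ≤ ∫⁻ t in I, ∫⁻ r : ℝ, ρ r * ∫⁻ ξ, ‖v (t + r, ξ) - v (t, ξ)‖ₑ ^ 2 := by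
        refine lintegral_mono fun t => (setLIntegral_le_lintegral _ _).trans (le_of_eq ?_)
        rw [← lintegral_add_left_eq_self _ t]
        simp only [add_sub_cancel_left]
    _ = ∫⁻ t in I, ∫⁻ r : ℝ, ∫⁻ ξ, ρ r * ‖v (t + r, ξ) - v (t, ξ)‖ₑ ^ 2 := by
        refine lintegral_congr fun t => lintegral_congr fun r => ?_
        rw [lintegral_const_mul _ (by fun_prop)]
    _ = ∫⁻ t in I, ∫⁻ ξ, ∫⁻ r : ℝ, ρ r * ‖v (t + r, ξ) - v (t, ξ)‖ₑ ^ 2 :=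
        lintegral_congr fun t => lintegral_lintegral_swap (by fun_prop)
    _ = ∫⁻ ξ, ∫⁻ t in I, ∫⁻ r : ℝ, ρ r * ‖v (t + r, ξ) - v (t, ξ)‖ₑ ^ 2 := by
        refine lintegral_lintegral_swap (Measurable.aemeasurable ?_)
        have h1 : Measurable fun q : (ℝ × Space d) × ℝ =>
            ρ q.2 * ‖v (q.1.1 + q.2, q.1.2) - v (q.1.1, q.1.2)‖ₑ ^ 2 := by fun_prop
        exact h1.lintegral_prod_right'
    _ = _ := by
        refine lintegral_congr fun ξ => ?_
        rw [lintegral_lintegral_swap (by fun_prop)]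
        refine lintegral_congr fun r => ?_
        rw [lintegral_const_mul _ (by fun_prop)]

theorem measurable_lintegral_increment {v : ℝ × Space d → ℂ} (hv : Measurable v) :
    Measurable fun z : ℝ × ℝ => ∫⁻ ξ, ‖v (z.2, ξ) - v (z.1, ξ)‖ₑ ^ 2 := by
  have h1 : Measurable fun q : (ℝ × ℝ) × Space d =>
    ‖v (q.1.2, q.2) - v (q.1.1, q.2)‖ₑ ^ 2 := by fun_prop
  exact h1.lintegral_prod_right'

theorem measurable_increment (m : ℝ) {ħ : ℝ} (hħ : 0 < ħ) (χ : 𝓢(Space d, ℂ))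
    (f : KernelSpace d) : Measurable fun z : ℝ × ℝ => (‖z.2 - z.1‖ₑ ^ 2)⁻¹ *
      ‖(momentumAverage hħ χ (freeRate m ħ * z.2) -
        momentumAverage hħ χ (freeRate m ħ * z.1)) f‖ₑ ^ 2 := by
  simp_rw [enorm_increment_sq]
  exact ((measurable_snd.sub measurable_fst).enorm.pow_const _).inv.mul
    (measurable_lintegral_increment (stronglyMeasurable_freeAverage m ħ χ f).measurable)

theorem freeAverage_sub {m ħ : ℝ} (hħ : 0 < ħ) (χ : 𝓢(Space d, ℂ)) {f : KernelSpace d}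
    {ξ : Space d} (hf : MemLp (fun p => f (p, p - ξ)) 2 volume) (t t' : ℝ) :
    freeAverage m ħ χ f (t', ξ) - freeAverage m ħ χ f (t, ξ) =
      ∫ p, f (p, p - ξ) * (momentumWeight ħ χ (freeRate m ħ * t') (ξ, p) -
        momentumWeight ħ χ (freeRate m ħ * t) (ξ, p)) := by
  rw [freeAverage, freeAverage, ← integral_sub]
  · refine integral_congr_ae (ae_of_all _ fun p => ?_)
    simp only [mul_sub]
  · exact hf.integrable_mul ((isSliceWeight_momentum hħ χ (freeRate m ħ * t')).memLp ξ)
  · exact hf.integrable_mul ((isSliceWeight_momentum hħ χ (freeRate m ħ * t)).memLp ξ)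

theorem singular_lintegral_le {B K A : ℝ≥0∞} (hK : K ≠ ⊤) (hA : A ≠ ⊤) {ξ : Space d} (hξ : ξ ≠ 0)
    (hB : ∫⁻ r : ℝ, (‖r‖ₑ ^ 2)⁻¹ * min 1 (‖r‖ₑ * ‖ξ‖ₑ) ^ 2 ≤ B * ‖ξ‖ₑ) {g : ℝ → ℝ≥0∞}
    (hg : ∀ r, g r ≤ A * (K * ‖ξ‖ₑ⁻¹ * min 1 (‖r‖ₑ * ‖ξ‖ₑ) ^ 2)) :
    ∫⁻ r : ℝ, (‖r‖ₑ ^ 2)⁻¹ * g r ≤ A * (B * K) := by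
  have hξ0 : ‖ξ‖ₑ⁻¹ * ‖ξ‖ₑ = 1 :=
    ENNReal.inv_mul_cancel (enorm_ne_zero.2 hξ) enorm_ne_top
  have hξt : ‖ξ‖ₑ⁻¹ ≠ ⊤ := ENNReal.inv_ne_top.2 (enorm_ne_zero.2 hξ)
  calc ∫⁻ r : ℝ, (‖r‖ₑ ^ 2)⁻¹ * g r
      ≤ ∫⁻ r : ℝ, A * (K * ‖ξ‖ₑ⁻¹) * ((‖r‖ₑ ^ 2)⁻¹ * min 1 (‖r‖ₑ * ‖ξ‖ₑ) ^ 2) := by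
        refine lintegral_mono fun r => (mul_le_mul_right (hg r) _).trans (le_of_eq ?_)
        ring
    _ ≤ A * (K * ‖ξ‖ₑ⁻¹) * (B * ‖ξ‖ₑ) := by
        rw [lintegral_const_mul' _ _ (by finiteness)]
        exact mul_le_mul_right hB _
    _ = A * (B * K) * (‖ξ‖ₑ⁻¹ * ‖ξ‖ₑ) := by ring
    _ = _ := by rw [hξ0, mul_one]

/-- The time regularity of the velocity averages of free evolutions. -/
theorem exists_free_increment_bound (hd : 1 ≤ d) {m : ℝ} (hm : 0 < m) (χ : 𝓢(Space d, ℂ)) :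
    ∃ c : ℝ≥0∞, c ≠ ⊤ ∧ ∀ (ħ : ℝ) (hħ : 0 < ħ) (I : Set ℝ), volume I ≠ ⊤ → ∀ f : KernelSpace d,
      ∫⁻ z : ℝ × ℝ, (‖z.2 - z.1‖ₑ ^ 2)⁻¹ *
        ‖(momentumAverage hħ χ (freeRate m ħ * z.2) -
          momentumAverage hħ χ (freeRate m ħ * z.1)) f‖ₑ ^ 2
          ∂((volume.restrict I).prod (volume.restrict I)) ≤
        c * ENNReal.ofReal ((2 * Real.pi * ħ) ^ d)⁻¹ * ‖f‖ₑ ^ 2 := by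
  obtain ⟨c, hc, hb⟩ := exists_increment_bound hm χ
  obtain ⟨B, hB, hBb⟩ := exists_singular_bound_real (d := d)
  refine ⟨B * c, by finiteness, fun ħ hħ I hI f => ?_⟩
  rw [lintegral_prod _ (measurable_increment m hħ χ f).aemeasurable]
  simp_rw [enorm_increment_sq]
  have hN : Measurable fun r : ℝ => (‖r‖ₑ ^ 2)⁻¹ := (measurable_enorm.pow_const 2).inv
  have hswap := lintegral_increment_le (stronglyMeasurable_freeAverage m ħ χ f).measurable
    hN I
  beta_reduce at hswap
  refine hswap.trans ?_
  calc ∫⁻ ξ, ∫⁻ r : ℝ, (‖r‖ₑ ^ 2)⁻¹ * ∫⁻ t in I,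
        ‖freeAverage m ħ χ f (t + r, ξ) - freeAverage m ħ χ f (t, ξ)‖ₑ ^ 2
      ≤ ∫⁻ ξ : Space d, (∫⁻ p, ‖f (p, p - ξ)‖ₑ ^ 2) *
          (B * (c * ENNReal.ofReal ((2 * Real.pi * ħ) ^ d)⁻¹)) := by
        refine lintegral_mono_ae ?_
        filter_upwards [ae_ne_zero hd, ae_memLp_momentumSlice f] with ξ hξ hf
        simp_rw [freeAverage_sub hħ χ hf]
        exact singular_lintegral_le (by finiteness) (memLp_two_iff.1 hf).2.ne hξ (hBb ξ hξ)
          (hb ħ hħ ξ hξ _ hf I hI)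
    _ = _ := by
        rw [lintegral_mul_const' _ _ (by finiteness), lintegral_momentumSlice]
        ring

end FrozenBounds

/-! ### Splitting the space-time Gagliardo seminorm -/

section Gagliardo
variable {d : ℕ}

/-- The kernel `|(s, y)|^{-(d+2)}` of the Gagliardo seminorm. -/
noncomputable def gagliardoKernel (z : ℝ × Space d) : ℝ≥0∞ :=
  (ENNReal.ofReal ((z.1 ^ 2 + ‖z.2‖ ^ 2) ^ (((d : ℝ) + 2) / 2)))⁻¹

theorem measurable_gagliardoKernel : Measurable (gagliardoKernel (d := d)) := by
  unfold gagliardoKernel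
  fun_prop

/-- The kernel is homogeneous of degree -(d + 2); integrating out one real variable leaves degree
-(d + 1), the weight of the half-order seminorm in space. -/
theorem exists_lintegral_gagliardoKernel_time : ∃ B : ℝ≥0∞, B ≠ ⊤ ∧ ∀ y : Space d, y ≠ 0 →
    ∫⁻ s : ℝ, gagliardoKernel (s, y) ≤ B * (‖y‖ₑ ^ (d + 1))⁻¹ := by
  have h1 := lintegral_bracket_lt_top (volume : Measure ℝ) (p := ((d : ℝ) + 2) / 2)
    (by rw [Module.finrank_self]; push_cast; linarith [(Nat.cast_nonneg d : (0 : ℝ) ≤ d)])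
  refine ⟨_, h1.ne, fun y hy => ?_⟩
  have hy' := norm_pos_iff.2 hy
  have h2 := lintegral_bracket_scale (volume : Measure ℝ) (((d : ℝ) + 2) / 2) hy'
  have h3 : ENNReal.ofReal (‖y‖ ^ (((Module.finrank ℝ ℝ : ℕ) : ℝ) - 2 * (((d : ℝ) + 2) / 2))) =
      (‖y‖ₑ ^ (d + 1))⁻¹ := by
    rw [Module.finrank_self, ← ofReal_norm, ← ENNReal.ofReal_pow (norm_nonneg _),
      ← ENNReal.ofReal_inv_of_pos (by positivity), ← Real.rpow_natCast, ← Real.rpow_neg hy'.le]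
    congr 2
    push_cast
    ring
  rw [h3] at h2
  rw [mul_comm, ← h2]
  refine le_of_eq (lintegral_congr fun s => ?_)
  rw [gagliardoKernel, add_comm, Real.norm_eq_abs, sq_abs]

/-- Integrating out d variables leaves degree -2, the weight of the half-order seminorm on the time
line. -/
theorem exists_lintegral_gagliardoKernel_space : ∃ B : ℝ≥0∞, B ≠ ⊤ ∧ ∀ s : ℝ, s ≠ 0 →
    ∫⁻ y : Space d, gagliardoKernel (s, y) ≤ B * (‖s‖ₑ ^ 2)⁻¹ := by
  have h1 := lintegral_bracket_lt_top (volume : Measure (Space d)) (p := ((d : ℝ) + 2) / 2)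
    (by rw [finrank_euclideanSpace, Fintype.card_fin]; linarith)
  refine ⟨_, h1.ne, fun s hs => ?_⟩
  have hs' := norm_pos_iff.2 hs
  have h2 := lintegral_bracket_scale (volume : Measure (Space d)) (((d : ℝ) + 2) / 2) hs'
  have h3 : ENNReal.ofReal (‖s‖ ^ (((Module.finrank ℝ (Space d) : ℕ) : ℝ) -
      2 * (((d : ℝ) + 2) / 2))) = (‖s‖ₑ ^ 2)⁻¹ := by
    rw [finrank_euclideanSpace, Fintype.card_fin, ← ofReal_norm,
      ← ENNReal.ofReal_pow (norm_nonneg _), ← ENNReal.ofReal_inv_of_pos (by positivity),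
      ← Real.rpow_natCast, ← Real.rpow_neg hs'.le]
    congr 2
    push_cast
    ring
  rw [h3] at h2
  rw [mul_comm, ← h2]
  refine le_of_eq (lintegral_congr fun y => ?_)
  rw [gagliardoKernel, Real.norm_eq_abs, sq_abs]

theorem lintegral_space_part_le {B : ℝ≥0∞} (hB : ∀ y : Space d, y ≠ 0 →
    ∫⁻ s : ℝ, gagliardoKernel (s, y) ≤ B * (‖y‖ₑ ^ (d + 1))⁻¹)
    {v : Space d → ℂ} (hv : Measurable v) (t : ℝ) (I : Set ℝ) :
    ∫⁻ x, ∫⁻ t' in I, ∫⁻ x', ‖v x - v x'‖ₑ ^ 2 * gagliardoKernel (t - t', x - x') ≤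
      ∫⁻ h : Space d, (B * (‖h‖ₑ ^ (d + 1))⁻¹) * ∫⁻ x, ‖v (x + h) - v x‖ₑ ^ 2 := by
  have hW := measurable_gagliardoKernel (d := d)
  calc ∫⁻ x, ∫⁻ t' in I, ∫⁻ x', ‖v x - v x'‖ₑ ^ 2 * gagliardoKernel (t - t', x - x')
      ≤ ∫⁻ x, ∫⁻ x', ‖v x - v x'‖ₑ ^ 2 * ∫⁻ t' : ℝ, gagliardoKernel (t - t', x - x') := by
        refine lintegral_mono fun x => ?_
        rw [lintegral_lintegral_swap (by fun_prop)]
        refine lintegral_mono fun x' => (setLIntegral_le_lintegral _ _).trans (le_of_eq ?_)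
        rw [lintegral_const_mul _ (by fun_prop)]
    _ ≤ ∫⁻ x, ∫⁻ x', ‖v x' - v x‖ₑ ^ 2 * (B * (‖x' - x‖ₑ ^ (d + 1))⁻¹) := by
        refine lintegral_mono fun x => lintegral_mono fun x' => ?_
        rcases eq_or_ne x x' with rfl | hx
        · simp
        · rw [enorm_sub_rev (v x')]
          refine mul_le_mul_right ?_ _
          rw [lintegral_sub_left_eq_self (fun s => gagliardoKernel (s, x - x')) t,
            enorm_sub_rev x']
          exact hB _ (sub_ne_zero.2 hx)
    _ = ∫⁻ x, ∫⁻ h, ‖v (x + h) - v x‖ₑ ^ 2 * (B * (‖h‖ₑ ^ (d + 1))⁻¹) := by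
        refine lintegral_congr fun x => ?_
        rw [← lintegral_add_left_eq_self _ x]
        simp only [add_sub_cancel_left]
    _ = ∫⁻ h, ∫⁻ x, ‖v (x + h) - v x‖ₑ ^ 2 * (B * (‖h‖ₑ ^ (d + 1))⁻¹) :=
        lintegral_lintegral_swap (by fun_prop)
    _ = _ := by
        refine lintegral_congr fun h => ?_
        rw [lintegral_mul_const _ (by fun_prop), mul_comm]

theorem lintegral_time_part_le {B : ℝ≥0∞} (hB : ∀ s : ℝ, s ≠ 0 →
    ∫⁻ y : Space d, gagliardoKernel (s, y) ≤ B * (‖s‖ₑ ^ 2)⁻¹)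
    {u : ℝ × Space d → ℂ} (hu : Measurable u) (t : ℝ) (I : Set ℝ) :
    ∫⁻ x, ∫⁻ t' in I, ∫⁻ x', ‖u (t, x') - u (t', x')‖ₑ ^ 2 * gagliardoKernel (t - t', x - x') ≤
      ∫⁻ t' in I, (B * (‖t' - t‖ₑ ^ 2)⁻¹) * ∫⁻ x, ‖u (t', x) - u (t, x)‖ₑ ^ 2 := by
  have hW := measurable_gagliardoKernel (d := d)
  have h1 : Measurable fun q : (Space d × ℝ) × Space d =>
      ‖u (t, q.2) - u (q.1.2, q.2)‖ₑ ^ 2 * gagliardoKernel (t - q.1.2, q.1.1 - q.2) := by fun_prop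
  rw [lintegral_lintegral_swap h1.lintegral_prod_right'.aemeasurable]
  refine lintegral_mono fun t' => ?_
  rw [lintegral_lintegral_swap (by fun_prop), ← lintegral_const_mul _ (by fun_prop)]
  refine lintegral_mono fun x' => ?_
  rw [lintegral_const_mul _ (by fun_prop)]
  rcases eq_or_ne t t' with rfl | ht
  · simp
  · rw [lintegral_sub_right_eq_self (fun y => gagliardoKernel (t - t', y)) x', mul_comm,
      enorm_sub_rev (u (t, x')), enorm_sub_rev t']
    exact mul_le_mul_left (hB _ (sub_ne_zero.2 ht)) _

theorem lintegral_triple_add {a b : (Space d × ℝ) × Space d → ℝ≥0∞} (ha : Measurable a)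
    (hb : Measurable b) (I : Set ℝ) :
    ∫⁻ x, ∫⁻ t in I, ∫⁻ x', (2 * a ((x, t), x') + 2 * b ((x, t), x')) =
      2 * (∫⁻ x, ∫⁻ t in I, ∫⁻ x', a ((x, t), x')) +
        2 * ∫⁻ x, ∫⁻ t in I, ∫⁻ x', b ((x, t), x') := by
  have ha1 : Measurable fun q : Space d × ℝ => ∫⁻ x', a (q, x') := ha.lintegral_prod_right'
  have hb1 : Measurable fun q : Space d × ℝ => ∫⁻ x', b (q, x') := hb.lintegral_prod_right'
  have ha2 : Measurable fun x => ∫⁻ t in I, ∫⁻ x', a ((x, t), x') := ha1.lintegral_prod_right'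
  have hb2 : Measurable fun x => ∫⁻ t in I, ∫⁻ x', b ((x, t), x') := hb1.lintegral_prod_right'
  rw [← lintegral_const_mul _ ha2, ← lintegral_const_mul _ hb2, ← lintegral_add_left (by fun_prop)]
  refine lintegral_congr fun x => ?_
  have ha3 : Measurable fun t => ∫⁻ x', a ((x, t), x') := ha1.comp measurable_prodMk_left
  have hb3 : Measurable fun t => ∫⁻ x', b ((x, t), x') := hb1.comp measurable_prodMk_left
  rw [← lintegral_const_mul _ ha3, ← lintegral_const_mul _ hb3,
    ← lintegral_add_left (ha3.const_mul 2)]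
  refine lintegral_congr fun t => ?_
  rw [← lintegral_const_mul _ (by fun_prop), ← lintegral_const_mul _ (by fun_prop),
    ← lintegral_add_left (by fun_prop)]

/-- The Gagliardo seminorm is controlled by differences in space and differences in time. -/
theorem exists_gagliardo_bound (d : ℕ) : ∃ B : ℝ≥0∞, B ≠ ⊤ ∧ ∀ (I : Set ℝ),
    ∀ u : ℝ × Space d → ℂ, Measurable u →
    ∫⁻ z in I ×ˢ univ, ∫⁻ z' in I ×ˢ univ, ‖u z - u z'‖ₑ ^ 2 * gagliardoKernel (z - z') ≤
      B * ((∫⁻ t in I, ∫⁻ h : Space d, (‖h‖ₑ ^ (d + 1))⁻¹ * ∫⁻ x, ‖u (t, x + h) - u (t, x)‖ₑ ^ 2) +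
        ∫⁻ t in I, ∫⁻ t' in I, (‖t' - t‖ₑ ^ 2)⁻¹ * ∫⁻ x, ‖u (t', x) - u (t, x)‖ₑ ^ 2) := by
  obtain ⟨B1, hB1, hb1⟩ := exists_lintegral_gagliardoKernel_time (d := d)
  obtain ⟨B2, hB2, hb2⟩ := exists_lintegral_gagliardoKernel_space (d := d)
  refine ⟨2 * B1 + 2 * B2, by finiteness, fun I u hu => ?_⟩
  have hW := measurable_gagliardoKernel (d := d)
  have hr : (volume : Measure (ℝ × Space d)).restrict (I ×ˢ univ) =
      (volume.restrict I).prod volume := by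
    rw [Measure.volume_eq_prod, ← Measure.prod_restrict, Measure.restrict_univ]
  have hm2 : Measurable fun q : (ℝ × Space d) × (ℝ × Space d) =>
      ‖u q.1 - u q.2‖ₑ ^ 2 * gagliardoKernel (q.1 - q.2) := by fun_prop
  rw [hr, lintegral_prod _ hm2.lintegral_prod_right'.aemeasurable]
  calc ∫⁻ t in I, ∫⁻ x, ∫⁻ z', ‖u (t, x) - u z'‖ₑ ^ 2 * gagliardoKernel ((t, x) - z')
        ∂(volume.restrict I).prod volume
      = ∫⁻ t in I, ∫⁻ x, ∫⁻ t' in I, ∫⁻ x', ‖u (t, x) - u (t', x')‖ₑ ^ 2 *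
          gagliardoKernel (t - t', x - x') := by
        refine lintegral_congr fun t => lintegral_congr fun x => ?_
        rw [lintegral_prod _ (by fun_prop)]
        rfl
    -- The intermediate point (t, x') separates a pure space difference from a pure time difference;
    -- in each, the variable that no longer occurs is integrated out of the kernel.
    _ ≤ ∫⁻ t in I, ∫⁻ x, ∫⁻ t' in I, ∫⁻ x',
          (2 * (‖u (t, x) - u (t, x')‖ₑ ^ 2 * gagliardoKernel (t - t', x - x')) +
          2 * (‖u (t, x') - u (t', x')‖ₑ ^ 2 * gagliardoKernel (t - t', x - x'))) := by
        gcongr with t x t' x'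
        rw [← mul_assoc, ← mul_assoc, ← add_mul]
        refine mul_le_mul_left ?_ _
        refine le_trans ?_ (add_sq_le_two_mul _ _)
        refine pow_le_pow_left' ?_ 2
        rw [← sub_add_sub_cancel (u (t, x)) (u (t, x'))]
        exact enorm_add_le _ _
    _ = ∫⁻ t in I, (2 * (∫⁻ x, ∫⁻ t' in I, ∫⁻ x',
          ‖u (t, x) - u (t, x')‖ₑ ^ 2 * gagliardoKernel (t - t', x - x')) +
          2 * ∫⁻ x, ∫⁻ t' in I, ∫⁻ x',
            ‖u (t, x') - u (t', x')‖ₑ ^ 2 * gagliardoKernel (t - t', x - x')) := by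
        refine lintegral_congr fun t => ?_
        exact lintegral_triple_add
          (a := fun q => ‖u (t, q.1.1) - u (t, q.2)‖ₑ ^ 2 *
            gagliardoKernel (t - q.1.2, q.1.1 - q.2)) (by fun_prop)
          (b := fun q => ‖u (t, q.2) - u (q.1.2, q.2)‖ₑ ^ 2 *
            gagliardoKernel (t - q.1.2, q.1.1 - q.2)) (by fun_prop) I
    _ ≤ ∫⁻ t in I, (2 * (∫⁻ h : Space d, (B1 * (‖h‖ₑ ^ (d + 1))⁻¹) *
          ∫⁻ x, ‖u (t, x + h) - u (t, x)‖ₑ ^ 2) +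
          2 * ∫⁻ t' in I, (B2 * (‖t' - t‖ₑ ^ 2)⁻¹) * ∫⁻ x, ‖u (t', x) - u (t, x)‖ₑ ^ 2) := by
        refine lintegral_mono fun t => add_le_add (mul_le_mul_right ?_ _) (mul_le_mul_right ?_ _)
        · exact lintegral_space_part_le hb1 (v := fun x => u (t, x)) (by fun_prop) t I
        · exact lintegral_time_part_le hb2 hu t I
    _ = 2 * B1 * (∫⁻ t in I, ∫⁻ h : Space d, (‖h‖ₑ ^ (d + 1))⁻¹ *
          ∫⁻ x, ‖u (t, x + h) - u (t, x)‖ₑ ^ 2) +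
        2 * B2 * ∫⁻ t in I, ∫⁻ t' in I, (‖t' - t‖ₑ ^ 2)⁻¹ * ∫⁻ x, ‖u (t', x) - u (t, x)‖ₑ ^ 2 := by
        have e1 : Measurable fun q : ℝ × Space d => ∫⁻ x, ‖u (q.1, x + q.2) - u (q.1, x)‖ₑ ^ 2 := by
          have : Measurable fun q : (ℝ × Space d) × Space d =>
              ‖u (q.1.1, q.2 + q.1.2) - u (q.1.1, q.2)‖ₑ ^ 2 := by fun_prop
          exact this.lintegral_prod_right'
        have e2 : Measurable fun t => ∫⁻ h : Space d, (‖h‖ₑ ^ (d + 1))⁻¹ *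
            ∫⁻ x, ‖u (t, x + h) - u (t, x)‖ₑ ^ 2 := by
          have : Measurable fun q : ℝ × Space d => (‖q.2‖ₑ ^ (d + 1))⁻¹ *
            ∫⁻ x, ‖u (q.1, x + q.2) - u (q.1, x)‖ₑ ^ 2 :=
            (measurable_snd.enorm.pow_const (d + 1)).inv.mul e1
          exact this.lintegral_prod_right'
        rw [← lintegral_const_mul' _ _ (by finiteness), ← lintegral_const_mul' _ _ (by finiteness),
          ← lintegral_add_left (e2.const_mul _)]
        refine lintegral_congr fun t => ?_
        simp_rw [mul_assoc]
        rw [lintegral_const_mul' _ _ hB1, lintegral_const_mul' _ _ hB2]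
    _ ≤ _ := by
        rw [mul_add]
        gcongr
        · exact le_self_add
        · exact le_add_self

end Gagliardo

/-! ### Differences in space and time on the Fourier side -/

section Plancherel
variable {d : ℕ}

/-- The translation `f ↦ f(· + h)` of `L²(ℝ^d)`. -/
noncomputable def translation (h : Space d) : L2 d →+ L2 d :=
  Lp.compMeasurePreserving (fun x => x + h) (measurePreserving_add_right volume h)

theorem coeFn_translation (h : Space d) (f : L2 d) :
    translation h f =ᵐ[volume] fun x => f (x + h) :=
  Lp.coeFn_compMeasurePreserving f _

/-- For Schwartz functions the transforms are honest integrals and the translation rule applies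
pointwise; continuity and density do the rest. -/
theorem fourier_translation_sub (h : Space d) (f : L2 d) :
    (𝓕 (translation h f - f) : L2 d) = shiftMul h (𝓕 f) := by
  have hF : Continuous fun f : L2 d => (𝓕 f : L2 d) :=
    (Lp.fourierTransformₗᵢ (Space d) ℂ).continuous
  have hd : DenseRange (fun f : 𝓢(Space d, ℂ) => (f.toLp 2 volume : L2 d)) :=
    SchwartzMap.denseRange_toLpCLM (by norm_num)
  have ht : Continuous (translation (d := d) h) :=
    (Lp.isometry_compMeasurePreserving (measurePreserving_add_right volume h)).continuous
  have key := hd.equalizer (g := fun f : L2 d => (𝓕 (translation h f - f) : L2 d))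
    (h := fun f : L2 d => shiftMul h (𝓕 f)) (hF.comp (ht.sub continuous_id))
    ((shiftMul h).continuous.comp hF) (funext fun a => ?_)
  · exact congrFun key f
  simp only [Function.comp_apply]
  set b : L2 d := a.toLp 2 volume with hb
  have hbi : Integrable (b : Space d → ℂ) := a.integrable.congr (a.coeFn_toLp 2 volume).symm
  have hti : Integrable (fun x => b (x + h)) := hbi.comp_add_right h
  have hsub : ((translation h b - b : L2 d) : Space d → ℂ) =ᵐ[volume]
      (fun x => b (x + h)) - (b : Space d → ℂ) := by
    filter_upwards [Lp.coeFn_sub (translation h b) b, coeFn_translation h b] with x e1 e2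
    rw [e1, Pi.sub_apply, Pi.sub_apply, e2]
  refine Lp.ext ?_
  filter_upwards [coeFn_fourier_of_integrable _ ((hti.sub hbi).congr hsub.symm),
    coeFn_shiftMul h (𝓕 b), coeFn_fourier_of_integrable b hbi] with ξ e1 e2 e3
  rw [e1, e2, e3]
  have e4 : 𝓕 ((translation h b - b : L2 d) : Space d → ℂ) ξ =
      𝓕 ((fun x => b (x + h)) - (b : Space d → ℂ)) ξ := by
    rw [fourier_eq_integral_mul, fourier_eq_integral_mul]
    refine integral_congr_ae ?_
    filter_upwards [hsub] with x hx
    rw [hx]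
  have e5 : 𝓕 (fun x => b (x + h)) ξ = (𝐞 ⟪h, ξ⟫_ℝ : ℂ) * 𝓕 (b : Space d → ℂ) ξ := by
    have := congrFun (VectorFourier.fourierIntegral_comp_add_right 𝐞 volume (innerₗ (Space d))
      (b : Space d → ℂ) h) ξ
    rw [Circle.smul_def, smul_eq_mul] at this
    exact this
  have e6 : 𝓕 ((fun x => b (x + h)) - (b : Space d → ℂ)) ξ =
      𝓕 (fun x => b (x + h)) ξ - 𝓕 (b : Space d → ℂ) ξ := by
    rw [Real.fourier_eq, Real.fourier_eq, Real.fourier_eq, ← integral_sub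
      ((Real.fourierIntegral_convergent_iff ξ).2 hti) ((Real.fourierIntegral_convergent_iff ξ).2 hbi)]
    simp only [Pi.sub_apply, smul_sub]
  rw [e4, e6, e5]
  ring

theorem enorm_fourier (f : L2 d) : ‖(𝓕 f : L2 d)‖ₑ = ‖f‖ₑ := by
  rw [← ofReal_norm, Lp.norm_fourier_eq, ofReal_norm]

theorem lintegral_translation_sub {v : Space d → ℂ} {f : L2 d} (hv : v =ᵐ[volume] f) (h : Space d) :
    ∫⁻ x, ‖v (x + h) - v x‖ₑ ^ 2 = ‖shiftMul h (𝓕 f)‖ₑ ^ 2 := by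
  rw [← fourier_translation_sub, enorm_fourier, ← lintegral_enorm_sq_eq]
  refine lintegral_congr_ae ?_
  filter_upwards [hv, (measurePreserving_add_right volume h).quasiMeasurePreserving.ae hv,
    coeFn_translation h f, Lp.coeFn_sub (translation h f) f] with x e1 e2 e3 e4
  rw [e4, Pi.sub_apply, e3, e1, e2]

theorem lintegral_sub_eq {v v' : Space d → ℂ} {f f' : L2 d} (hv : v =ᵐ[volume] f)
    (hv' : v' =ᵐ[volume] f') : ∫⁻ x, ‖v' x - v x‖ₑ ^ 2 = ‖(𝓕 f' : L2 d) - 𝓕 f‖ₑ ^ 2 := by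
  have : (𝓕 f' : L2 d) - 𝓕 f = 𝓕 (f' - f) := ((Lp.fourierTransformₗᵢ (Space d) ℂ).map_sub f' f).symm
  rw [this, enorm_fourier, ← lintegral_enorm_sq_eq]
  refine lintegral_congr_ae ?_
  filter_upwards [hv, hv', Lp.coeFn_sub f' f] with x e1 e2 e3
  rw [e3, Pi.sub_apply, e1, e2]

theorem lintegral_enorm_sq_eq_fourier {v : Space d → ℂ} {f : L2 d} (hv : v =ᵐ[volume] f) :
    ∫⁻ x, ‖v x‖ₑ ^ 2 = ‖(𝓕 f : L2 d)‖ₑ ^ 2 := by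
  rw [enorm_fourier, ← lintegral_enorm_sq_eq]
  refine lintegral_congr_ae ?_
  filter_upwards [hv] with x e1
  rw [e1]

end Plancherel

/-! ### Half-order time seminorm of the interaction kernel -/

section HalfDerivative
variable {d : ℕ}

theorem enorm_momentumAverage_sq_le {ħ : ℝ} (hħ : 0 < ħ) (χ : 𝓢(Space d, ℂ)) (s : ℝ)
    (f : KernelSpace d) : ‖momentumAverage hħ χ s f‖ₑ ^ 2 ≤
      ENNReal.ofReal ((2 * Real.pi * ħ) ^ d)⁻¹ * (∫⁻ v, ‖χ v‖ₑ ^ 2) * ‖f‖ₑ ^ 2 := by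
  have h := enorm_averageCLM_sq_le scalesVolume_sub (isSliceWeight_momentum hħ χ s) f
  rwa [one_mul] at h

theorem enorm_sq_le_ofReal {E : Type*} [NormedAddCommGroup E] {x : E} {M : ℝ} (h : ‖x‖ ≤ M) :
    ‖x‖ₑ ^ 2 ≤ ENNReal.ofReal (M ^ 2) := by
  rw [← ofReal_norm, ← ENNReal.ofReal_pow (norm_nonneg _)]
  exact ENNReal.ofReal_le_ofReal (pow_le_pow_left₀ (norm_nonneg _) h 2)

/-- The singular integral of a Lipschitz and bounded family. -/
theorem exists_lintegral_lipschitz_le : ∃ B : ℝ≥0∞, B ≠ ⊤ ∧ ∀ {H : Type} [NormedAddCommGroup H]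
    {T M c : ℝ} {F : ℝ → H}, 0 ≤ M → 0 < c → (∀ t ∈ Icc (-T) T, ‖F t‖ ≤ M) →
    (∀ s ∈ Icc (-T) T, ∀ t ∈ Icc (-T) T, ‖F t - F s‖ ≤ 2 * M * c * |t - s|) →
    ∀ t ∈ Icc (-T) T, ∫⁻ t' in Ioo (-T) T, (‖t' - t‖ₑ ^ 2)⁻¹ * ‖F t' - F t‖ₑ ^ 2 ≤
      B * ENNReal.ofReal (M ^ 2 * c) := by
  have h1 := lintegral_singular_lt_top (volume : Measure ℝ)
  refine ⟨4 * ∫⁻ r : ℝ, (‖r‖ₑ ^ 2)⁻¹ * min 1 ‖r‖ₑ ^ 2, ?_, ?_⟩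
  · rw [Module.finrank_self] at h1
    exact ENNReal.mul_ne_top (by norm_num) h1.ne
  intro H _ T M c F hM hc hb hl t ht
  have h2 := lintegral_singular_scale (volume : Measure ℝ) hc
  simp only [Module.finrank_self, Nat.reduceAdd] at h2
  have hpt : ∀ t' ∈ Ioo (-T) T, ‖F t' - F t‖ₑ ^ 2 ≤
      ENNReal.ofReal (4 * M ^ 2) * min 1 (‖t' - t‖ₑ * ENNReal.ofReal c) ^ 2 := by
    intro t' ht'
    -- Boundedness serves long time differences and the Lipschitz estimate short ones; the crossover
    -- at |t' - t| = 1/c gives one power of c in the integral.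
    have h3 : ‖F t' - F t‖ ≤ 2 * M * min 1 (‖t' - t‖ * c) := by
      rcases le_total 1 (‖t' - t‖ * c) with h | h
      · rw [min_eq_left h, mul_one, two_mul]
        exact (norm_sub_le _ _).trans (add_le_add (hb _ (Ioo_subset_Icc_self ht')) (hb _ ht))
      · rw [min_eq_right h]
        refine (hl t ht t' (Ioo_subset_Icc_self ht')).trans (le_of_eq ?_)
        rw [Real.norm_eq_abs]
        ring
    refine (enorm_sq_le_ofReal h3).trans (le_of_eq ?_)
    rw [mul_pow, ENNReal.ofReal_mul (by positivity), ENNReal.ofReal_pow (p := min _ _) (by positivity),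
      ENNReal.ofReal_min, ENNReal.ofReal_one, ENNReal.ofReal_mul (norm_nonneg _), ofReal_norm]
    congr 2
    ring
  calc ∫⁻ t' in Ioo (-T) T, (‖t' - t‖ₑ ^ 2)⁻¹ * ‖F t' - F t‖ₑ ^ 2
      ≤ ∫⁻ t' in Ioo (-T) T, ENNReal.ofReal (4 * M ^ 2) * ((‖t' - t‖ₑ ^ 2)⁻¹ *
          min 1 (‖t' - t‖ₑ * ENNReal.ofReal c) ^ 2) := by
        refine setLIntegral_mono' measurableSet_Ioo fun t' ht' => ?_
        rw [mul_left_comm]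
        exact mul_le_mul_right (hpt t' ht') _
    _ ≤ ∫⁻ t', ENNReal.ofReal (4 * M ^ 2) * ((‖t' - t‖ₑ ^ 2)⁻¹ *
          min 1 (‖t' - t‖ₑ * ENNReal.ofReal c) ^ 2) := setLIntegral_le_lintegral _ _
    _ = _ := by
        rw [lintegral_const_mul' _ _ ENNReal.ofReal_ne_top, lintegral_sub_right_eq_self
          (fun r : ℝ => (‖r‖ₑ ^ 2)⁻¹ * min 1 (‖r‖ₑ * ENNReal.ofReal c) ^ 2) t, h2,
          ENNReal.ofReal_mul (by norm_num), ENNReal.ofReal_mul (by positivity),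
          ENNReal.ofReal_ofNat]
        ring

end HalfDerivative

/-! ### Frozen bounds applied to the moving kernel -/

section Regularity
variable {d : ℕ}

/-- For almost every time, `u` is the velocity average of the kernel whose Fourier transform in the
interaction picture is `F t`. -/
def RepresentsAverage (m : ℝ) {ħ : ℝ} (hħ : 0 < ħ) (T : ℝ) (χ : 𝓢(Space d, ℂ))
    (F : ℝ → KernelSpace d) (u : ℝ × Space d → ℂ) : Prop :=
  ∀ᵐ t ∂(volume.restrict (Ioo (-T) T)), ∃ f : L2 d, (fun x => u (t, x)) =ᵐ[volume] f ∧
    (𝓕 f : L2 d) = momentumAverage hħ χ (freeRate m ħ * t) (F t)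

theorem restrict_slab (I : Set ℝ) : (volume : Measure (ℝ × Space d)).restrict (I ×ˢ univ) =
    (volume.restrict I).prod volume := by
  rw [Measure.volume_eq_prod, ← Measure.prod_restrict, Measure.restrict_univ]

theorem ceil_inv_bounds {ħ : ℝ} (hħ : ħ ∈ Ioc (0 : ℝ) 1) :
    1 ≤ ⌈1 / ħ⌉₊ ∧ (⌈1 / ħ⌉₊ : ℝ) ≤ 2 / ħ ∧ (1 : ℝ) / ⌈1 / ħ⌉₊ ≤ ħ := by
  have h0 := hħ.1
  have h1 : 1 ≤ 1 / ħ := by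
    rw [le_div_iff₀ h0, one_mul]
    exact hħ.2
  have h2 := Nat.le_ceil (1 / ħ)
  have h3 := Nat.ceil_lt_add_one (show 0 ≤ 1 / ħ by positivity)
  have h4 : (1 : ℝ) ≤ ⌈1 / ħ⌉₊ := h1.trans h2
  refine ⟨by exact_mod_cast h4, ?_, ?_⟩
  · have : 2 / ħ = 1 / ħ + 1 / ħ := by ring
    linarith
  · rw [div_le_comm₀ (by linarith) h0]
    exact h2

/-- The choice N = ⌈1/ħ⌉ makes the cost N M² of the coarse grid and the cost (GT)²/N of the
refinements both at most of order M²(1 + v)²/ħ. The 4 comes from N ≤ 2/ħ, the 240 from 60 · 2². -/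
theorem dyadic_constant_le {ħ T M v : ℝ} (hħ : ħ ∈ Ioc (0 : ℝ) 1) (hv : 0 ≤ v) :
    2 * (⌈1 / ħ⌉₊ : ℝ) * M ^ 2 + 60 * (2 * M * ((1 + v) / ħ) * T) ^ 2 / ⌈1 / ħ⌉₊ ≤
      (4 + 240 * T ^ 2) * (M ^ 2 * (1 + v) ^ 2 / ħ) := by
  obtain ⟨-, h1, h2⟩ := ceil_inv_bounds hħ
  have h0 := hħ.1
  have e1 : 2 * (⌈1 / ħ⌉₊ : ℝ) * M ^ 2 ≤ 4 * (M ^ 2 * (1 + v) ^ 2 / ħ) := by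
    calc 2 * (⌈1 / ħ⌉₊ : ℝ) * M ^ 2 ≤ 2 * (2 / ħ) * M ^ 2 := by gcongr
      _ = 4 * (M ^ 2 * 1 / ħ) := by ring
      _ ≤ _ := by
        gcongr
        nlinarith
  have e2 : 60 * (2 * M * ((1 + v) / ħ) * T) ^ 2 / ⌈1 / ħ⌉₊ ≤
      240 * T ^ 2 * (M ^ 2 * (1 + v) ^ 2 / ħ) := by
    calc 60 * (2 * M * ((1 + v) / ħ) * T) ^ 2 / ⌈1 / ħ⌉₊
        = 60 * (2 * M * ((1 + v) / ħ) * T) ^ 2 * (1 / ⌈1 / ħ⌉₊) := by ring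
      _ ≤ 60 * (2 * M * ((1 + v) / ħ) * T) ^ 2 * ħ := by gcongr
      _ = _ := by
        field_simp
        ring
  linarith

variable {m ħ T M v : ℝ} {χ : 𝓢(Space d, ℂ)} {F : ℝ → KernelSpace d} {u : ℝ × Space d → ℂ}

theorem lintegral_average_sq_le (hħ : 0 < ħ) (hu : Measurable u)
    (hF : RepresentsAverage m hħ T χ F u) (hM : ∀ t ∈ Icc (-T) T, ‖F t‖ ≤ M) :
    ∫⁻ z in Ioo (-T) T ×ˢ univ, ‖u z‖ₑ ^ 2 ≤
      ENNReal.ofReal ((2 * Real.pi * ħ) ^ d)⁻¹ * (∫⁻ v, ‖χ v‖ₑ ^ 2) * ENNReal.ofReal (M ^ 2) *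
        ENNReal.ofReal (2 * T) := by
  rw [restrict_slab, lintegral_prod _ (by fun_prop)]
  calc ∫⁻ t in Ioo (-T) T, ∫⁻ x, ‖u (t, x)‖ₑ ^ 2
      ≤ ∫⁻ _ in Ioo (-T) T, ENNReal.ofReal ((2 * Real.pi * ħ) ^ d)⁻¹ * (∫⁻ v, ‖χ v‖ₑ ^ 2) *
          ENNReal.ofReal (M ^ 2) := by
        refine lintegral_mono_ae ?_
        filter_upwards [hF, ae_restrict_mem measurableSet_Ioo] with t ⟨f, hf, hf2⟩ ht
        rw [lintegral_enorm_sq_eq_fourier hf, hf2]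
        exact (enorm_momentumAverage_sq_le hħ χ _ _).trans
          (mul_le_mul_right (enorm_sq_le_ofReal (hM t (Ioo_subset_Icc_self ht))) _)
    _ = _ := by
        rw [setLIntegral_const, Real.volume_Ioo]
        congr 2
        ring

theorem measurable_spaceDifference (hu : Measurable u) : Measurable fun z : ℝ × Space d =>
    (‖z.2‖ₑ ^ (d + 1))⁻¹ * ∫⁻ x, ‖u (z.1, x + z.2) - u (z.1, x)‖ₑ ^ 2 := by
  have h : Measurable fun q : (ℝ × Space d) × Space d =>
      ‖u (q.1.1, q.2 + q.1.2) - u (q.1.1, q.2)‖ₑ ^ 2 := by fun_prop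
  exact (measurable_snd.enorm.pow_const (d + 1)).inv.mul h.lintegral_prod_right'

theorem measurable_timeDifference (hu : Measurable u) : Measurable fun z : ℝ × ℝ =>
    (‖z.2 - z.1‖ₑ ^ 2)⁻¹ * ∫⁻ x, ‖u (z.2, x) - u (z.1, x)‖ₑ ^ 2 :=
  ((measurable_snd.sub measurable_fst).enorm.pow_const 2).inv.mul (measurable_lintegral_increment hu)

/-- By Plancherel the space difference at time t is a frozen operator applied to F(t), so the
chaining bound applies with τ the time coordinate. -/
theorem lintegral_spaceDifference_le {c : ℝ≥0∞} (hħ : ħ ∈ Ioc (0 : ℝ) 1) (hT : 0 < T) (hv : 0 ≤ v)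
    (hc : ∀ f : KernelSpace d, ∫⁻ z : ℝ × Space d, (‖z.2‖ₑ ^ (d + 1))⁻¹ *
        ‖(shiftMul z.2 ∘L momentumAverage hħ.1 χ (freeRate m ħ * z.1)) f‖ₑ ^ 2
          ∂((volume.restrict (Ioo (-T) T)).prod volume) ≤ c * ‖f‖ₑ ^ 2)
    (hu : Measurable u) (hF : RepresentsAverage m hħ.1 T χ F u) (hM0 : 0 ≤ M)
    (hM : ∀ t ∈ Icc (-T) T, ‖F t‖ ≤ M) (hG : ∀ s ∈ Icc (-T) T, ∀ t ∈ Icc (-T) T,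
      ‖F t - F s‖ ≤ 2 * M * ((1 + v) / ħ) * |t - s|) :
    ∫⁻ t in Ioo (-T) T, ∫⁻ h : Space d, (‖h‖ₑ ^ (d + 1))⁻¹ *
      ∫⁻ x, ‖u (t, x + h) - u (t, x)‖ₑ ^ 2 ≤
      c * ENNReal.ofReal ((4 + 240 * T ^ 2) * (M ^ 2 * (1 + v) ^ 2 / ħ)) := by
  have h0 := hħ.1
  have hmem : ∀ᵐ z : ℝ × Space d ∂(volume.restrict (Ioo (-T) T)).prod volume,
      z.1 ∈ Ico (-T) T :=
    Measure.quasiMeasurePreserving_fst.ae ((ae_restrict_mem measurableSet_Ioo).mono fun t ht =>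
      Ioo_subset_Ico_self ht)
  have key := lintegral_varying_le (μ := (volume.restrict (Ioo (-T) T)).prod volume)
    (S := fun z : ℝ × Space d => shiftMul z.2 ∘L momentumAverage h0 χ (freeRate m ħ * z.1))
    (ρ := fun z => (‖z.2‖ₑ ^ (d + 1))⁻¹) (τ := fun z => z.1)
    (fun f => (measurable_shift m h0 χ f).aemeasurable) hc hT (ceil_inv_bounds hħ).1 hM
    (by positivity) hG hmem
  refine le_trans (le_of_eq ?_) (key.trans (mul_le_mul_right
    (ENNReal.ofReal_le_ofReal (dyadic_constant_le hħ hv)) c))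
  rw [← lintegral_prod (fun z : ℝ × Space d => (‖z.2‖ₑ ^ (d + 1))⁻¹ *
    ∫⁻ x, ‖u (z.1, x + z.2) - u (z.1, x)‖ₑ ^ 2) (measurable_spaceDifference hu).aemeasurable]
  refine lintegral_congr_ae ?_
  filter_upwards [Measure.quasiMeasurePreserving_fst.ae hF] with z ⟨f, hf, hf2⟩
  rw [lintegral_translation_sub hf, hf2, ContinuousLinearMap.comp_apply]

/-- A time difference has two sources: the free evolution moves while F(t) is held fixed, which is
covered by chaining, and F itself moves, which needs only the L² bound of the average and the
half-order regularity of F in time. -/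
theorem lintegral_timeDifference_le {c B : ℝ≥0∞} (hħ : ħ ∈ Ioc (0 : ℝ) 1) (hT : 0 < T) (hv : 0 ≤ v)
    (hc : ∀ f : KernelSpace d, ∫⁻ z : ℝ × ℝ, (‖z.2 - z.1‖ₑ ^ 2)⁻¹ *
        ‖(momentumAverage hħ.1 χ (freeRate m ħ * z.2) -
          momentumAverage hħ.1 χ (freeRate m ħ * z.1)) f‖ₑ ^ 2
          ∂((volume.restrict (Ioo (-T) T)).prod (volume.restrict (Ioo (-T) T))) ≤ c * ‖f‖ₑ ^ 2)
    (hB : ∀ t ∈ Icc (-T) T, ∫⁻ t' in Ioo (-T) T, (‖t' - t‖ₑ ^ 2)⁻¹ * ‖F t' - F t‖ₑ ^ 2 ≤ B)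
    (hu : Measurable u) (hF : RepresentsAverage m hħ.1 T χ F u) (hM0 : 0 ≤ M)
    (hM : ∀ t ∈ Icc (-T) T, ‖F t‖ ≤ M) (hG : ∀ s ∈ Icc (-T) T, ∀ t ∈ Icc (-T) T,
      ‖F t - F s‖ ≤ 2 * M * ((1 + v) / ħ) * |t - s|) :
    ∫⁻ t in Ioo (-T) T, ∫⁻ t' in Ioo (-T) T, (‖t' - t‖ₑ ^ 2)⁻¹ *
      ∫⁻ x, ‖u (t', x) - u (t, x)‖ₑ ^ 2 ≤
      2 * (c * ENNReal.ofReal ((4 + 240 * T ^ 2) * (M ^ 2 * (1 + v) ^ 2 / ħ))) +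
        2 * (ENNReal.ofReal ((2 * Real.pi * ħ) ^ d)⁻¹ * (∫⁻ v, ‖χ v‖ₑ ^ 2) * B *
          ENNReal.ofReal (2 * T)) := by
  have h0 := hħ.1
  set μ := (volume : Measure ℝ).restrict (Ioo (-T) T) with hμ
  set L : ℝ → KernelSpace d →L[ℂ] L2 d := fun t => momentumAverage h0 χ (freeRate m ħ * t) with hL
  set K := ENNReal.ofReal ((2 * Real.pi * ħ) ^ d)⁻¹ * ∫⁻ v, ‖χ v‖ₑ ^ 2 with hK
  have hmem : ∀ᵐ t ∂μ, t ∈ Icc (-T) T :=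
    (ae_restrict_mem measurableSet_Ioo).mono fun t ht => Ioo_subset_Icc_self ht
  have hKt : K ≠ ⊤ := (isSliceWeight_momentum h0 χ 0).ne_top
  have key := lintegral_varying_le (μ := μ.prod μ) (S := fun z : ℝ × ℝ => L z.2 - L z.1)
    (ρ := fun z => (‖z.2 - z.1‖ₑ ^ 2)⁻¹) (τ := fun z => z.1)
    (fun f => (measurable_increment m h0 χ f).aemeasurable) hc hT (ceil_inv_bounds hħ).1 hM
    (by positivity) hG (Measure.quasiMeasurePreserving_fst.ae
      ((ae_restrict_mem measurableSet_Ioo).mono fun t ht => Ioo_subset_Ico_self ht))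
  have key2 := key.trans (mul_le_mul_right
    (ENNReal.ofReal_le_ofReal (dyadic_constant_le hħ hv)) c)
  have hF' : ∀ᵐ t ∂μ, ∃ f : L2 d, (fun x => u (t, x)) =ᵐ[volume] f ∧ (𝓕 f : L2 d) = L t (F t) := hF
  have hae : ∀ᵐ z ∂μ.prod μ, ∫⁻ x, ‖u (z.2, x) - u (z.1, x)‖ₑ ^ 2 =
      ‖L z.2 (F z.2) - L z.1 (F z.1)‖ₑ ^ 2 := by
    filter_upwards [Measure.quasiMeasurePreserving_fst.ae hF',
      Measure.quasiMeasurePreserving_snd.ae hF'] with z ⟨f, hf, hf2⟩ ⟨f', hf', hf2'⟩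
    rw [lintegral_sub_eq hf hf', hf2, hf2']
  have hsplit : ∀ᵐ z ∂μ.prod μ, (‖z.2 - z.1‖ₑ ^ 2)⁻¹ * ∫⁻ x, ‖u (z.2, x) - u (z.1, x)‖ₑ ^ 2 ≤
      2 * ((‖z.2 - z.1‖ₑ ^ 2)⁻¹ * ‖(L z.2 - L z.1) (F z.1)‖ₑ ^ 2) +
      2 * ((‖z.2 - z.1‖ₑ ^ 2)⁻¹ * (K * ‖F z.2 - F z.1‖ₑ ^ 2)) := by
    filter_upwards [hae] with z hz
    rw [hz, mul_left_comm 2, mul_left_comm 2, ← mul_add]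
    refine mul_le_mul_right ?_ _
    have e : L z.2 (F z.2) - L z.1 (F z.1) = (L z.2 - L z.1) (F z.1) + L z.2 (F z.2 - F z.1) := by
      rw [sub_apply, map_sub]
      abel
    rw [e]
    refine (pow_le_pow_left' (enorm_add_le _ _) 2).trans ((add_sq_le_two_mul _ _).trans ?_)
    gcongr
    exact enorm_momentumAverage_sq_le h0 χ _ _
  have hmF : AEMeasurable (fun z : ℝ × ℝ => (‖z.2 - z.1‖ₑ ^ 2)⁻¹ * (K * ‖F z.2 - F z.1‖ₑ ^ 2))
      (μ.prod μ) := by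
    -- F is given with no measurability in time; the Lipschitz bound supplies it.
    have hFc : ContinuousOn F (Icc (-T) T) := by
      refine (LipschitzOnWith.of_dist_le_mul (K := (2 * M * ((1 + v) / ħ)).toNNReal)
        fun s hs t ht => ?_).continuousOn
      rw [dist_eq_norm, Real.dist_eq, Real.coe_toNNReal _ (by positivity)]
      exact hG t ht s hs
    have hFm : AEStronglyMeasurable F μ :=
      (hFc.aestronglyMeasurable measurableSet_Icc).mono_measure
        (Measure.restrict_mono Ioo_subset_Icc_self le_rfl)
    have h1 : AEMeasurable (fun z : ℝ × ℝ => ‖F z.2 - F z.1‖ₑ) (μ.prod μ) :=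
      ((hFm.comp_quasiMeasurePreserving Measure.quasiMeasurePreserving_snd).sub
        (hFm.comp_quasiMeasurePreserving Measure.quasiMeasurePreserving_fst)).enorm
    exact ((measurable_snd.sub measurable_fst).enorm.pow_const 2).inv.aemeasurable.mul
      ((h1.pow_const 2).const_mul K)
  have hm1 : AEMeasurable (fun z : ℝ × ℝ => (‖z.2 - z.1‖ₑ ^ 2)⁻¹ *
      ∫⁻ x, ‖u (z.2, x) - u (z.1, x)‖ₑ ^ 2) (μ.prod μ) := (measurable_timeDifference hu).aemeasurable
  calc ∫⁻ t, ∫⁻ t', (‖t' - t‖ₑ ^ 2)⁻¹ * ∫⁻ x, ‖u (t', x) - u (t, x)‖ₑ ^ 2 ∂volume ∂μ ∂μ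
      = ∫⁻ z, (‖z.2 - z.1‖ₑ ^ 2)⁻¹ * ∫⁻ x, ‖u (z.2, x) - u (z.1, x)‖ₑ ^ 2 ∂volume ∂μ.prod μ :=
        (lintegral_prod _ hm1).symm
    _ ≤ ∫⁻ z, (2 * ((‖z.2 - z.1‖ₑ ^ 2)⁻¹ * ‖(L z.2 - L z.1) (F z.1)‖ₑ ^ 2) +
      2 * ((‖z.2 - z.1‖ₑ ^ 2)⁻¹ * (K * ‖F z.2 - F z.1‖ₑ ^ 2))) ∂μ.prod μ := lintegral_mono_ae hsplit
    _ = 2 * (∫⁻ z, (‖z.2 - z.1‖ₑ ^ 2)⁻¹ * ‖(L z.2 - L z.1) (F z.1)‖ₑ ^ 2 ∂μ.prod μ) +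
        2 * ∫⁻ z, (‖z.2 - z.1‖ₑ ^ 2)⁻¹ * (K * ‖F z.2 - F z.1‖ₑ ^ 2) ∂μ.prod μ := by
        rw [lintegral_add_right' _ (hmF.const_mul 2), lintegral_const_mul' _ _ (by norm_num),
          lintegral_const_mul' _ _ (by norm_num)]
    _ ≤ _ := by
        refine add_le_add (mul_le_mul_right key2 _) (mul_le_mul_right ?_ _)
        rw [lintegral_prod _ hmF]
        calc ∫⁻ t, ∫⁻ t', (‖t' - t‖ₑ ^ 2)⁻¹ * (K * ‖F t' - F t‖ₑ ^ 2) ∂μ ∂μ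
            ≤ ∫⁻ _, K * B ∂μ := by
              refine lintegral_mono_ae ?_
              filter_upwards [hmem] with t ht
              simp_rw [mul_left_comm _ K]
              rw [lintegral_const_mul' _ _ hKt]
              exact mul_le_mul_right (hB t ht) _
          _ = _ := by
              rw [lintegral_const, hμ, Measure.restrict_apply_univ, Real.volume_Ioo]
              congr 2
              ring

end Regularity

/-! ### The half-order Sobolev bound -/

section MainEstimate
variable {d : ℕ}

/-- The velocity averages of slowly varying interaction kernels are bounded in `H^{1/2}`. -/
theorem exists_regularity_bound (hd : 1 ≤ d) {m T : ℝ} (hm : 0 < m) (hT : 0 < T)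
    (χ : 𝓢(Space d, ℂ)) : ∃ K : ℝ≥0∞, K ≠ ⊤ ∧ ∀ (ħ : ℝ) (hħ : ħ ∈ Ioc (0 : ℝ) 1) (M v : ℝ),
      0 ≤ M → 0 ≤ v → ∀ (F : ℝ → KernelSpace d) (u : ℝ × Space d → ℂ), Measurable u →
      RepresentsAverage m hħ.1 T χ F u → (∀ t ∈ Icc (-T) T, ‖F t‖ ≤ M) →
      (∀ s ∈ Icc (-T) T, ∀ t ∈ Icc (-T) T, ‖F t - F s‖ ≤ 2 * M * ((1 + v) / ħ) * |t - s|) →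
      (∫⁻ z in slab T d, ‖u z‖ₑ ^ 2) +
        ∫⁻ z in slab T d, ∫⁻ z' in slab T d, ‖u z - u z'‖ₑ ^ 2 * gagliardoKernel (z - z') ≤
        K * (ENNReal.ofReal ((2 * Real.pi * ħ) ^ d)⁻¹ *
          ENNReal.ofReal (M ^ 2 * (1 + v) ^ 2 / ħ)) := by
  obtain ⟨Bg, hBg, hg⟩ := exists_gagliardo_bound d
  obtain ⟨cs, hcs, hs⟩ := exists_free_shift_bound hd hm χ
  obtain ⟨ct, hct, ht⟩ := exists_free_increment_bound hd hm χ
  obtain ⟨Bl, hBl, hl⟩ := exists_lintegral_lipschitz_le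
  set Ψ : ℝ≥0∞ := ∫⁻ v, ‖χ v‖ₑ ^ 2 with hΨ
  have hΨt : Ψ ≠ ⊤ := (memLp_two_iff.1 (χ.memLp 2)).2.ne
  set o := ENNReal.ofReal (4 + 240 * T ^ 2) with ho
  set τ := ENNReal.ofReal (2 * T) with hτ
  refine ⟨Ψ * τ + Bg * (cs * o + (2 * (ct * o) + 2 * (Ψ * Bl * τ))), by finiteness,
    fun ħ hħ M v hM0 hv F u hu hF hM hG => ?_⟩
  have h0 := hħ.1
  have hI : volume (Ioo (-T) T) ≠ ⊤ := by
    rw [Real.volume_Ioo]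
    exact ENNReal.ofReal_ne_top
  set D := ENNReal.ofReal ((2 * Real.pi * ħ) ^ d)⁻¹ with hD
  set q := ENNReal.ofReal (M ^ 2 * (1 + v) ^ 2 / ħ) with hq
  have hv1 : 1 + v ≤ (1 + v) ^ 2 := by nlinarith
  have hq1 : ENNReal.ofReal (M ^ 2 * ((1 + v) / ħ)) ≤ q := by
    refine ENNReal.ofReal_le_ofReal ?_
    rw [← mul_div_assoc]
    gcongr
  have hq2 : ENNReal.ofReal (M ^ 2) ≤ q := by
    refine ENNReal.ofReal_le_ofReal ?_
    rw [le_div_iff₀ h0]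
    refine mul_le_mul_of_nonneg_left ?_ (by positivity)
    nlinarith [hħ.2]
  have e1 := lintegral_average_sq_le h0 hu hF hM
  have e2 := lintegral_spaceDifference_le hħ hT hv (hs ħ h0 _ hI) hu hF hM0 hM hG
  have e3 := lintegral_timeDifference_le hħ hT hv (ht ħ h0 _ hI)
    (fun t ht' => (hl hM0 (show 0 < (1 + v) / ħ by positivity) hM hG t ht').trans
      (mul_le_mul_right hq1 Bl)) hu hF hM0 hM hG
  rw [ENNReal.ofReal_mul (by positivity)] at e2 e3
  have e4 := hg (Ioo (-T) T) u hu
  calc _ ≤ D * Ψ * q * τ + Bg * (cs * D * (o * q) + (2 * (ct * D * (o * q)) +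
        2 * (D * Ψ * (Bl * q) * τ))) := by
        refine add_le_add (e1.trans ?_) (e4.trans (mul_le_mul_right (add_le_add e2 e3) _))
        gcongr
    _ = _ := by ring

theorem sobolevHalfNorm_eq (Q : Set (ℝ × Space d)) (u : ℝ × Space d → ℂ) :
    sobolevHalfNorm Q u = ((∫⁻ z in Q, ‖u z‖ₑ ^ 2) + ∫⁻ z in Q, ∫⁻ z' in Q,
      ‖u z - u z'‖ₑ ^ 2 * gagliardoKernel (z - z')) ^ (1 / 2 : ℝ) := rfl

theorem sobolevHalfNorm_congr {Q : Set (ℝ × Space d)} {u u' : ℝ × Space d → ℂ}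
    (h : u =ᵐ[volume.restrict Q] u') : sobolevHalfNorm Q u = sobolevHalfNorm Q u' := by
  rw [sobolevHalfNorm, sobolevHalfNorm]
  congr 2
  · refine lintegral_congr_ae ?_
    filter_upwards [h] with z hz
    rw [hz]
  · refine lintegral_congr_ae ?_
    filter_upwards [h] with z hz
    refine lintegral_congr_ae ?_
    filter_upwards [h] with z' hz'
    rw [hz, hz']

/-- With M² = C²(2πħ)^d the Jacobian (2πħ)^(-d) cancels, so the squared norm is at most a constant
times C²(1 + ‖V‖)²/ħ, the constant depending only on d, m, T and ψ. -/
theorem exists_sobolev_bound (hd : 1 ≤ d) {m T C : ℝ} (hm : 0 < m) (hT : 0 < T) (hC : 0 < C)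
    (ψ : 𝓢(Space d, ℂ)) : ∃ A : ℝ, 0 < A ∧ ∀ (V : Space d →ᵇ ℝ) (ħ : ℝ), ħ ∈ Ioc (0 : ℝ) 1 →
      ∀ R : ℝ → L2 d →L[ℂ] L2 d, (∀ t ∈ Icc (-T) T, IsDensityOperator (R t)) →
      IsWOTContinuous T R → IsWeakSolution m ħ T V R →
      (∀ t ∈ Icc (-T) T, TraceSqLe (R t) (C ^ 2 * (2 * Real.pi * ħ) ^ d)) →
      ∀ k, IsDensityMatrix T R k → sobolevHalfNorm (slab T d) (velocityAverage ħ ψ k) ≤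
        ENNReal.ofReal (A * (1 + ‖V‖) * ħ ^ (-(1 / 2) : ℝ)) := by
  obtain ⟨K, hK, hb⟩ := exists_regularity_bound hd hm hT ψ
  -- Adding 1 only secures a positive constant, since K might vanish.
  refine ⟨√K.toReal * C + 1, by positivity, fun V ħ hħ R hR hc hW htr k hk => ?_⟩
  have h0 := hħ.1
  set M : ℝ := √(C ^ 2 * (2 * Real.pi * ħ) ^ d) with hM
  have hM0 : 0 ≤ M := Real.sqrt_nonneg _
  have hM2 : M ^ 2 = C ^ 2 * (2 * Real.pi * ħ) ^ d := Real.sq_sqrt (by positivity)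
  have hex : ∀ t, ∃ κ F : KernelSpace d, t ∈ Icc (-T) T →
      InteractionData (R t) (freeRate m ħ * t) κ F ∧ ‖κ‖ ≤ M := fun t => by
    by_cases ht : t ∈ Icc (-T) T
    · obtain ⟨κ, F, h⟩ := (hR t ht).exists_interactionData hM0 (hM2 ▸ htr t ht) (freeRate m ħ * t)
      exact ⟨κ, F, fun _ => h⟩
    · exact ⟨0, 0, fun h => absurd h ht⟩
  choose κ F hκF using hex
  have hI : ∀ t ∈ Icc (-T) T, InteractionData (R t) (freeRate m ħ * t) (κ t) (F t) :=
    fun t ht => (hκF t ht).1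
  have hκ : ∀ t ∈ Icc (-T) T, ‖κ t‖ ≤ M := fun t ht => (hκF t ht).2
  have hae := aestronglyMeasurable_velocityAverage hħ.1 hk ψ
  obtain ⟨u, hu, hue⟩ := hae
  -- Uniqueness of integral kernels identifies the average computed from the given k with that of κ
  -- t, whose Fourier transform is expressed through F t.
  have hrep : RepresentsAverage m h0 T ψ F u := by
    have h1 := hue
    rw [slab, restrict_slab] at h1
    filter_upwards [Measure.ae_ae_of_ae_prod h1, ae_restrict_mem measurableSet_Ioo] with t h2 ht
    have ht' := Ioo_subset_Icc_self ht
    refine ⟨positionAverage h0 ψ (κ t), ?_, (hI t ht').fourier_positionAverage h0 ψ⟩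
    filter_upwards [h2, (hR t ht').average_ae_eq (hk.2 t ht') (hI t ht').inner_tens h0 ψ]
      with x h3 h4
    rw [← h3, ← h4]
    rfl
  -- Replacing ‖V‖ by 1 + ‖V‖ keeps the rate strictly positive, as the scaling of the singular time
  -- integral requires even for V = 0.
  have hlip : ∀ s ∈ Icc (-T) T, ∀ t ∈ Icc (-T) T,
      ‖F t - F s‖ ≤ 2 * M * ((1 + ‖V‖) / ħ) * |t - s| := fun s hs t ht => by
    refine (lipschitz_interaction hm h0 hT hM0 hW hc hI hκ hs ht).trans ?_
    refine mul_le_mul_of_nonneg_right ?_ (abs_nonneg _)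
    rw [← mul_div_assoc, div_le_div_iff_of_pos_right h0]
    nlinarith [norm_nonneg V]
  have key := hb ħ hħ M ‖V‖ hM0 (norm_nonneg V) F u hu.measurable hrep
    (fun t ht => ((hI t ht).norm_eq ▸ hκ t ht)) hlip
  have hval : ENNReal.ofReal ((2 * Real.pi * ħ) ^ d)⁻¹ *
      ENNReal.ofReal (M ^ 2 * (1 + ‖V‖) ^ 2 / ħ) = ENNReal.ofReal (C ^ 2 * (1 + ‖V‖) ^ 2 / ħ) := by
    rw [← ENNReal.ofReal_mul (by positivity), hM2]
    congr 1
    have : (2 * Real.pi * ħ) ^ d ≠ 0 := by positivity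
    field_simp
  have hsqrt : (K.toReal * (C ^ 2 * (1 + ‖V‖) ^ 2 / ħ)) ^ (1 / 2 : ℝ) =
      √K.toReal * C * (1 + ‖V‖) * ħ ^ (-(1 / 2) : ℝ) := by
    rw [← Real.sqrt_eq_rpow, Real.sqrt_mul ENNReal.toReal_nonneg, Real.sqrt_div (by positivity),
      ← mul_pow, Real.sqrt_sq (by positivity), Real.rpow_neg h0.le, ← Real.sqrt_eq_rpow]
    ring
  have hK' : K * ENNReal.ofReal (C ^ 2 * (1 + ‖V‖) ^ 2 / ħ) =
      ENNReal.ofReal (K.toReal * (C ^ 2 * (1 + ‖V‖) ^ 2 / ħ)) := by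
    rw [ENNReal.ofReal_mul ENNReal.toReal_nonneg, ENNReal.ofReal_toReal hK]
  rw [sobolevHalfNorm_congr hue, sobolevHalfNorm_eq]
  refine (ENNReal.rpow_le_rpow key (by norm_num)).trans ?_
  rw [hval, hK', ENNReal.ofReal_rpow_of_nonneg (by positivity) (by norm_num), hsqrt]
  refine ENNReal.ofReal_le_ofReal ?_
  have : 0 ≤ ħ ^ (-(1 / 2) : ℝ) := by positivity
  gcongr
  linarith

end MainEstimate
end QuantumAveraging

theorem theorem3 (d : ℕ) (hd : 1 ≤ d) (m T C : ℝ) (hm : 0 < m) (hT : 0 < T) (hC : 0 < C)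
    (ψ : 𝓢(QuantumAveraging.Space d, ℂ)) :
    ∃ A : ℝ, 0 < A ∧
      ∀ (V : QuantumAveraging.Space d →ᵇ ℝ)
        (R : ℝ → ℝ → QuantumAveraging.L2 d →L[ℂ] QuantumAveraging.L2 d),
        (∀ ħ ∈ Set.Ioc (0 : ℝ) 1,
          (∀ t ∈ Set.Icc (-T) T, QuantumAveraging.IsDensityOperator (R ħ t)) ∧
          QuantumAveraging.IsWOTContinuous T (R ħ) ∧
          QuantumAveraging.IsWeakSolution m ħ T V (R ħ) ∧
          (∀ t ∈ Set.Icc (-T) T,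
            QuantumAveraging.TraceSqLe (R ħ t) (C ^ 2 * (2 * Real.pi * ħ) ^ d))) →
        ∀ ħ ∈ Set.Ioc (0 : ℝ) 1,
          (∃ k, QuantumAveraging.IsDensityMatrix T (R ħ) k) ∧
          ∀ k, QuantumAveraging.IsDensityMatrix T (R ħ) k →
            QuantumAveraging.AverageConverges T ħ ψ k ∧
            QuantumAveraging.MemSobolevHalf (QuantumAveraging.slab T d)
              (QuantumAveraging.velocityAverage ħ ψ k) ∧
            QuantumAveraging.sobolevHalfNorm (QuantumAveraging.slab T d)
                (QuantumAveraging.velocityAverage ħ ψ k) ≤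
              ENNReal.ofReal (A * (1 + ‖V‖) * ħ ^ (-(1 / 2) : ℝ)) ∧
            (V ≠ 0 →
              QuantumAveraging.sobolevHalfNorm (QuantumAveraging.slab T d)
                  (QuantumAveraging.velocityAverage ħ ψ k) ≤
                ENNReal.ofReal ((A * (1 + 1 / ‖V‖)) * ‖V‖ * ħ ^ (-(1 / 2) : ℝ))) := by
  obtain ⟨A, hA, hb⟩ := QuantumAveraging.exists_sobolev_bound hd hm hT hC ψ
  refine ⟨A, hA, fun V R h ħ hħ => ?_⟩
  obtain ⟨hR, hc, hW, htr⟩ := h ħ hħ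
  refine ⟨QuantumAveraging.exists_isDensityMatrix hT hR hc, fun k hk => ?_⟩
  have hbd := hb V ħ hħ (R ħ) hR hc hW htr k hk
  refine ⟨QuantumAveraging.averageConverges hħ.1 hR hk ψ,
    ⟨QuantumAveraging.aestronglyMeasurable_velocityAverage hħ.1 hk ψ,
      hbd.trans_lt ENNReal.ofReal_lt_top⟩, hbd, fun hV => hbd.trans (le_of_eq ?_)⟩
  have hV' : ‖V‖ ≠ 0 := norm_ne_zero_iff.2 hV
  congr 2
  field_simp
  ring
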